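/- **Theorem.** Let $\mathbb K$ be a field of characteristic zero and let $X$ be a simply-connected space that admits positive weights over $\mathbb K$. Then $X$ is BV exact over $\mathbb K$. Here the notions are the following. Let $A_{PL}(X)$ be the algebra of polynomial differential forms with coefficients in $\mathbb K$ on the singular simplicial set of $X$ (the polynomial de Rham algebra of $X$). *Positive weights.* $X$ admits positive weights if its minimal Sullivan model $(\wedge V,d)\xrightarrow{\simeq}A_{PL}(X)$ has a direct sum decomposition $V=\bigoplus_{i>0}V_{(i)}$ into graded subspaces such that $d(V_{(i)})\subset(\wedge V)_{(i)}$ for all $i$, where the weight on $V$ is extended multiplicatively to $\wedge V$, that is, $(\wedge V)_{(i)}$ is spanned by the products $v_1\cdots v_r$ with $v_j\in V_{(i_j)}$ and $i_1+\dots+i_r=i$. *BV exactness.* For a nonnegatively graded cochain algebra $\Omega$ over $\mathbb K$, regarded as a chain algebra in nonpositive degrees (so that an element of cohomological degree $n$ has $\deg=-n$), let $C(\Omega)=\bigoplus_{k\ge0}\Omega\otimes(\Omega/\mathbb K)^{\otimes k}$, with $\epsilon_i=\deg w_0+\dots+\deg w_i-i$ (so $\epsilon_{-1}=1$), $$b(w_0,\dots,w_k)=-\sum_{i=0}^k(-1)^{\epsilon_{i-1}}(w_0,\dots,dw_i,\dots,w_k)-\sum_{i=0}^{k-1}(-1)^{\epsilon_i}(w_0,\dots,w_iw_{i+1},\dots,w_k)+(-1)^{(\deg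 w_k-1)\epsilon_{k-1}}(w_kw_0,w_1,\dots,w_{k-1}),$$ where the last term is present only for $k\ge1$, and $$B(w_0,\dots,w_k)=\sum_{i=0}^k(-1)^{(\epsilon_{i-1}+1)(\epsilon_k-\epsilon_{i-1})}(1,w_i,\dots,w_k,w_0,\dots,w_{i-1}).$$ The reduced Hochschild homology $\widetilde{HH}_*(\Omega)$ is the homology of $(C(\Omega)/C(\mathbb K),b)$, and $\widetilde B\colon\widetilde{HH}_*(\Omega)\to\widetilde{HH}_*(\Omega)$ is the operator induced by Connes' operator $B$. The algebra $\Omega$ is BV exact if $\operatorname{Im}\widetilde B=\operatorname{Ker}\widetilde B$, and the space $X$ is BV exact if $A_{PL}(X)$ is. -/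

import Mathlib

open scoped TensorProduct DirectSum

/-! ### Cochain algebras -/

/-- A differential graded algebra over `K`, cohomologically graded in nonnegative degrees
(a nonnegative cochain algebra): the differential has degree `+1`. -/
structure CochainAlg (K : Type*) [Field K] where
  carrier : Type*
  [ring : Ring carrier]
  [algebra : Algebra K carrier]
  gr : ℕ → Submodule K carrier
  [graded : GradedAlgebra gr]
  d : carrier →ₗ[K] carrier
  d_mem : ∀ (n : ℕ) (x : carrier), x ∈ gr n → d x ∈ gr (n + 1)
  d_d : ∀ x : carrier, d (d x) = 0
  leibniz : ∀ (n : ℕ) (x y : carrier), x ∈ gr n → d (x * y) = d x * y + (-1 : K) ^ n • (x * d y)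

attribute [instance] CochainAlg.ring CochainAlg.algebra CochainAlg.graded

namespace CochainAlg

variable {K : Type*} [Field K]

/-- Morphisms of cochain algebras. -/
structure Hom (A B : CochainAlg K) where
  toAlgHom : A.carrier →ₐ[K] B.carrier
  map_gr : ∀ (n : ℕ) (x : A.carrier), x ∈ A.gr n → toAlgHom x ∈ B.gr n
  map_d : ∀ x : A.carrier, toAlgHom (A.d x) = B.d (toAlgHom x)

/-- The cohomology `ker d / im d`. -/
abbrev Cohomology (A : CochainAlg K) : Type _ :=
  LinearMap.ker A.d ⧸ (LinearMap.range A.d).comap (LinearMap.ker A.d).subtype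

/-- The map induced on cocycles. -/
def Hom.mapCocycles {A B : CochainAlg K} (f : Hom A B) :
    LinearMap.ker A.d →ₗ[K] LinearMap.ker B.d :=
  f.toAlgHom.toLinearMap.restrict (fun x hx => by
    rw [LinearMap.mem_ker] at hx ⊢
    rw [AlgHom.toLinearMap_apply, ← f.map_d, hx, map_zero])

/-- The map induced on cohomology. -/
def Hom.mapCohomology {A B : CochainAlg K} (f : Hom A B) : A.Cohomology →ₗ[K] B.Cohomology :=
  Submodule.mapQ _ _ f.mapCocycles (by
    rintro ⟨x, hx⟩ ⟨y, hy⟩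
    exact ⟨f.toAlgHom y, by rw [← f.map_d, hy]; rfl⟩)

/-- Quasi-isomorphisms of cochain algebras. -/
def Hom.IsQuasiIso {A B : CochainAlg K} (f : Hom A B) : Prop :=
  Function.Bijective f.mapCohomology

end CochainAlg

/-! ### Free graded commutative algebras and Sullivan algebras -/

section FreeCGA

variable {K : Type*} [Field K]

/-- The relations `v w = (-1)^{mn} w v` for `v` of degree `m` and `w` of degree `n`. -/
inductive FreeCGA.Rel (V : ℕ → Type*) [∀ n, AddCommGroup (V n)] [∀ n, Module K (V n)] :
    TensorAlgebra K (⨁ n, V n) → TensorAlgebra K (⨁ n, V n) → Prop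
  | swap (m n : ℕ) (v : V m) (w : V n) :
      Rel V
        (TensorAlgebra.ι K (DirectSum.lof K ℕ V m v) * TensorAlgebra.ι K (DirectSum.lof K ℕ V n w))
        ((-1 : K) ^ (m * n) •
          (TensorAlgebra.ι K (DirectSum.lof K ℕ V n w) *
            TensorAlgebra.ι K (DirectSum.lof K ℕ V m v)))

/-- The free graded commutative algebra `∧V` on a graded vector space `V = ⨁ Vⁿ`, over a field of
characteristic zero: the tensor algebra modulo graded commutativity. -/
def FreeCGA (K : Type*) [Field K] (V : ℕ → Type*)
    [∀ n, AddCommGroup (V n)] [∀ n, Module K (V n)] : Type _ :=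
  RingQuot (FreeCGA.Rel (K := K) V)

noncomputable instance (V : ℕ → Type*) [∀ n, AddCommGroup (V n)] [∀ n, Module K (V n)] :
    Ring (FreeCGA K V) :=
  inferInstanceAs (Ring (RingQuot (FreeCGA.Rel (K := K) V)))

noncomputable instance (V : ℕ → Type*) [∀ n, AddCommGroup (V n)] [∀ n, Module K (V n)] :
    Algebra K (FreeCGA K V) :=
  inferInstanceAs (Algebra K (RingQuot (FreeCGA.Rel (K := K) V)))

/-- The algebra map `∧V → A` extending linear maps `Vⁿ → A` whose values commute in the graded
sense. -/
noncomputable def FreeCGA.lift {V : ℕ → Type*} [∀ n, AddCommGroup (V n)] [∀ n, Module K (V n)]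
    {A : Type*} [Ring A] [Algebra K A] (f : ∀ n, V n →ₗ[K] A)
    (hf : ∀ (m n : ℕ) (v : V m) (w : V n), f m v * f n w = (-1 : K) ^ (m * n) • (f n w * f m v)) :
    FreeCGA K V →ₐ[K] A :=
  RingQuot.liftAlgHom K ⟨TensorAlgebra.lift K (DirectSum.toModule K ℕ A f), by
    rintro _ _ ⟨m, n, v, w⟩
    simp only [map_mul, map_smul, TensorAlgebra.lift_ι_apply, DirectSum.toModule_lof]
    exact hf m n v w⟩

end FreeCGA

/-- Given sets `S i` of elements of index `i`, the linear span of all products of such elements with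
total index `p`. -/
def homogPart (K : Type*) [Field K] {A : Type*} [Ring A] [Algebra K A] (S : ℕ → Set A) (p : ℕ) :
    Submodule K A :=
  Submodule.span K {x | ∃ l : List (ℕ × A), (∀ q ∈ l, q.2 ∈ S q.1) ∧
    (l.map Prod.fst).sum = p ∧ (l.map Prod.snd).prod = x}

namespace CochainAlg

variable {K : Type*} [Field K]

/-- `M` is a minimal Sullivan algebra `(∧V, d)` on the graded subspace `V = ⨁_{n ≥ 1} Vⁿ ⊆ M`. -/
structure IsMinimalSullivan (M : CochainAlg K) (V : ℕ → Submodule K M.carrier) : Prop where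
  /-- `Vⁿ` consists of elements of degree `n`. -/
  le_gr : ∀ n, V n ≤ M.gr n
  /-- `V` is concentrated in positive degrees. -/
  zero : V 0 = ⊥
  /-- `M` is the free graded commutative algebra on `V`. -/
  free : ∃ hc : ∀ (m n : ℕ) (v : V m) (w : V n),
      (v * w : M.carrier) = (-1 : K) ^ (m * n) • (w * v : M.carrier),
    Function.Bijective (FreeCGA.lift (fun n => (V n).subtype) hc)
  /-- The nilpotence condition: `V` is the union of graded subspaces `V(0) ⊆ V(1) ⊆ ⋯` with
  `d = 0` on `V(0)` and `d V(k+1) ⊆ ∧V(k)`. -/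
  nilpotent : ∃ F : ℕ → ℕ → Submodule K M.carrier,
    (∀ n, Monotone fun k => F k n) ∧ (∀ n, ⨆ k, F k n = V n) ∧
    (∀ n, ∀ v ∈ F 0 n, M.d v = 0) ∧
    (∀ k n, ∀ v ∈ F (k + 1) n, M.d v ∈ Algebra.adjoin K (⋃ m, (F k m : Set M.carrier)))
  /-- Minimality: `d V ⊆ ∧⁺V · ∧⁺V`. -/
  decomposable : ∀ n, ∀ v ∈ V n, M.d v ∈ (⨆ i ≥ 1, M.gr i) * (⨆ i ≥ 1, M.gr i)

/-- A positive weight decomposition of `(∧V, d)`: a direct sum decomposition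
`V = ⨁_{i > 0} V_(i)` into graded subspaces, `V_(i) = ⨁ n, V_(i)ⁿ` with `V_(i)ⁿ = W i n`, such that
`d V_(i) ⊆ (∧V)_(i)`, where weights are extended multiplicatively to `∧V`. -/
structure IsPositiveWeight (M : CochainAlg K) (V : ℕ → Submodule K M.carrier)
    (W : ℕ → ℕ → Submodule K M.carrier) : Prop where
  indep : ∀ n, iSupIndep fun i => W i n
  iSup_eq : ∀ n, ⨆ i, W i n = V n
  pos : ∀ n, W 0 n = ⊥
  d_mem : ∀ i n, ∀ v ∈ W i n,
    M.d v ∈ homogPart K (fun j => ⋃ m, (W j m : Set M.carrier)) i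

end CochainAlg

/-! ### Polynomial differential forms on simplices -/

/-- Generators of the algebra of polynomial forms on the `n`-simplex. -/
inductive PolyForm.Gen (n : ℕ) : Type
  | t (i : Fin (n + 1)) : Gen n
  | dt (i : Fin (n + 1)) : Gen n

open FreeAlgebra in
/-- The relations of the algebra of polynomial forms on the `n`-simplex: the `t_i` (degree `0`) and
`dt_i` (degree `1`) commute in the graded sense, `∑ t_i = 1` and `∑ dt_i = 0`. -/
inductive PolyForm.Rel (K : Type*) [Field K] (n : ℕ) :
    FreeAlgebra K (PolyForm.Gen n) → FreeAlgebra K (PolyForm.Gen n) → Prop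
  | t_t (i j : Fin (n + 1)) : Rel K n (ι K (.t i) * ι K (.t j)) (ι K (.t j) * ι K (.t i))
  | t_dt (i j : Fin (n + 1)) : Rel K n (ι K (.t i) * ι K (.dt j)) (ι K (.dt j) * ι K (.t i))
  | dt_dt (i j : Fin (n + 1)) : Rel K n (ι K (.dt i) * ι K (.dt j)) (-(ι K (.dt j) * ι K (.dt i)))
  | sum_t : Rel K n (∑ i, ι K (.t i)) 1
  | sum_dt : Rel K n (∑ i, ι K (.dt i)) 0

/-- The algebra `∧(t_0, …, t_n, dt_0, …, dt_n) / (∑ t_i - 1, ∑ dt_i)` of polynomial differential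
forms on the standard `n`-simplex, over a field of characteristic zero. -/
def PolyForm (K : Type*) [Field K] (n : ℕ) : Type _ := RingQuot (PolyForm.Rel K n)

noncomputable instance (K : Type*) [Field K] (n : ℕ) : Ring (PolyForm K n) :=
  inferInstanceAs (Ring (RingQuot (PolyForm.Rel K n)))

noncomputable instance (K : Type*) [Field K] (n : ℕ) : Algebra K (PolyForm K n) :=
  inferInstanceAs (Algebra K (RingQuot (PolyForm.Rel K n)))

namespace PolyForm

variable {K : Type*} [Field K]

/-- The quotient map from the free algebra. -/
noncomputable def mk (K : Type*) [Field K] (n : ℕ) :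
    FreeAlgebra K (Gen n) →ₐ[K] PolyForm K n :=
  RingQuot.mkAlgHom K (Rel K n)

theorem mk_rel {n : ℕ} {x y : FreeAlgebra K (Gen n)} (h : Rel K n x y) : mk K n x = mk K n y :=
  RingQuot.mkAlgHom_rel K h

/-- The generators, as polynomial forms. -/
noncomputable def gen (K : Type*) [Field K] {n : ℕ} (g : Gen n) : PolyForm K n :=
  mk K n (FreeAlgebra.ι K g)

/-- The barycentric coordinate `t_i`. -/
noncomputable def t (K : Type*) [Field K] {n : ℕ} (i : Fin (n + 1)) : PolyForm K n := gen K (.t i)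

/-- The differential `dt_i`. -/
noncomputable def dt (K : Type*) [Field K] {n : ℕ} (i : Fin (n + 1)) : PolyForm K n :=
  gen K (.dt i)

theorem t_mul_t {n : ℕ} (i j : Fin (n + 1)) : t K i * t K j = t K j * t K i := by
  simpa [t, gen] using mk_rel (Rel.t_t (K := K) i j)

theorem t_mul_dt {n : ℕ} (i j : Fin (n + 1)) : t K i * dt K j = dt K j * t K i := by
  simpa [t, dt, gen] using mk_rel (Rel.t_dt (K := K) i j)

theorem dt_mul_dt {n : ℕ} (i j : Fin (n + 1)) : dt K i * dt K j = -(dt K j * dt K i) := by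
  simpa [dt, gen] using mk_rel (Rel.dt_dt (K := K) i j)

theorem sum_t (n : ℕ) : ∑ i : Fin (n + 1), t K i = 1 := by
  simpa [t, gen] using mk_rel (Rel.sum_t (K := K) (n := n))

theorem sum_dt (n : ℕ) : ∑ i : Fin (n + 1), dt K i = 0 := by
  simpa [dt, gen] using mk_rel (Rel.sum_dt (K := K) (n := n))

/-- Algebra maps out of the algebra of polynomial forms. -/
noncomputable def lift {n : ℕ} {B : Type*} [Ring B] [Algebra K B] (a c : Fin (n + 1) → B)
    (h₁ : ∀ i j, a i * a j = a j * a i) (h₂ : ∀ i j, a i * c j = c j * a i)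
    (h₃ : ∀ i j, c i * c j = -(c j * c i)) (h₄ : ∑ i, a i = 1) (h₅ : ∑ i, c i = 0) :
    PolyForm K n →ₐ[K] B :=
  RingQuot.liftAlgHom K ⟨FreeAlgebra.lift K (fun g => match g with | .t i => a i | .dt i => c i), by
    rintro _ _ (⟨i, j⟩ | ⟨i, j⟩ | ⟨i, j⟩ | _ | _)
    · simpa using h₁ i j
    · simpa using h₂ i j
    · simpa using h₃ i j
    · simpa using h₄
    · simpa using h₅⟩

@[simp] theorem lift_t {n : ℕ} {B : Type*} [Ring B] [Algebra K B] (a c : Fin (n + 1) → B)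
    (h₁ h₂ h₃ h₄ h₅) (i : Fin (n + 1)) : lift (K := K) a c h₁ h₂ h₃ h₄ h₅ (t K i) = a i :=
  (RingQuot.liftAlgHom_mkAlgHom_apply K _ _ _).trans (by simp)

@[simp] theorem lift_dt {n : ℕ} {B : Type*} [Ring B] [Algebra K B] (a c : Fin (n + 1) → B)
    (h₁ h₂ h₃ h₄ h₅) (i : Fin (n + 1)) : lift (K := K) a c h₁ h₂ h₃ h₄ h₅ (dt K i) = c i :=
  (RingQuot.liftAlgHom_mkAlgHom_apply K _ _ _).trans (by simp)

theorem hom_ext {n : ℕ} {B : Type*} [Ring B] [Algebra K B] {f g : PolyForm K n →ₐ[K] B}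
    (h₁ : ∀ i, f (t K i) = g (t K i)) (h₂ : ∀ i, f (dt K i) = g (dt K i)) : f = g := by
  refine RingQuot.ringQuot_ext' K f g (FreeAlgebra.hom_ext (funext fun x => ?_))
  cases x with
  | t i => exact h₁ i
  | dt i => exact h₂ i

/-- Pullback of forms along a simplicial operator `α : [m] → [n]`:
`t_j ↦ ∑_{α i = j} t_i` and `dt_j ↦ ∑_{α i = j} dt_i`. -/
noncomputable def pullback (K : Type*) [Field K] {m n : ℕ} (α : Fin (m + 1) → Fin (n + 1)) :
    PolyForm K n →ₐ[K] PolyForm K m :=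
  lift (fun j => ∑ i with α i = j, t K i) (fun j => ∑ i with α i = j, dt K i)
    (fun i j => by
      rw [Finset.sum_mul_sum, Finset.sum_mul_sum, Finset.sum_comm]
      exact Finset.sum_congr rfl fun _ _ => Finset.sum_congr rfl fun _ _ => t_mul_t _ _)
    (fun i j => by
      rw [Finset.sum_mul_sum, Finset.sum_mul_sum, Finset.sum_comm]
      exact Finset.sum_congr rfl fun _ _ => Finset.sum_congr rfl fun _ _ => t_mul_dt _ _)
    (fun i j => by
      rw [Finset.sum_mul_sum, Finset.sum_mul_sum, Finset.sum_comm, ← Finset.sum_neg_distrib]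
      refine Finset.sum_congr rfl fun _ _ => ?_
      rw [← Finset.sum_neg_distrib]
      exact Finset.sum_congr rfl fun _ _ => dt_mul_dt _ _)
    (by rw [Finset.sum_fiberwise, sum_t])
    (by rw [Finset.sum_fiberwise, sum_dt])

/-- The algebra map `x ↦ [[(-1)^{|x|} x, d x], [0, x]]`; its upper right entry is the exterior
derivative. -/
noncomputable def dMatrix (K : Type*) [Field K] (n : ℕ) :
    PolyForm K n →ₐ[K] Matrix (Fin 2) (Fin 2) (PolyForm K n) :=
  lift (fun i => !![t K i, dt K i; 0, t K i]) (fun i => !![-dt K i, 0; 0, dt K i])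
    (fun i j => by
      simp [t_mul_t i j, t_mul_dt i j, ← t_mul_dt j i, add_comm])
    (fun i j => by simp [t_mul_dt i j, dt_mul_dt i j])
    (fun i j => by simp [dt_mul_dt i j])
    (by
      ext i j
      fin_cases i <;> fin_cases j <;> simp [Matrix.sum_apply, sum_t, sum_dt])
    (by
      ext i j
      fin_cases i <;> fin_cases j <;> simp [Matrix.sum_apply, sum_dt])

/-- The exterior derivative on polynomial forms. -/
noncomputable def d (K : Type*) [Field K] (n : ℕ) : PolyForm K n →ₗ[K] PolyForm K n where
  toFun x := dMatrix K n x 0 1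
  map_add' x y := by simp
  map_smul' c x := by simp

/-- Polynomial forms of degree `p`: the span of products of coordinates `t_i` (degree `0`) and
differentials `dt_i` (degree `1`) with exactly `p` differentials. -/
noncomputable def gr (K : Type*) [Field K] (n p : ℕ) : Submodule K (PolyForm K n) :=
  homogPart K (fun j : ℕ => match j with
    | 0 => Set.range (t K (n := n))
    | 1 => Set.range (dt K (n := n))
    | _ + 2 => ∅) p

theorem d_t {n : ℕ} (i : Fin (n + 1)) : d K n (t K i) = dt K i := by
  simp [d, dMatrix]

theorem d_dt {n : ℕ} (i : Fin (n + 1)) : d K n (dt K i) = 0 := by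
  simp [d, dMatrix]

/-- The sign automorphism `x ↦ (-1)^{|x|} x`. -/
noncomputable def sign (K : Type*) [Field K] (n : ℕ) : PolyForm K n →ₐ[K] PolyForm K n :=
  lift (t K) (fun i => -dt K i) t_mul_t (fun i j => by simp [t_mul_dt i j])
    (fun i j => by simp [dt_mul_dt i j]) (sum_t n) (by simp [sum_dt])

theorem induction {n : ℕ} {P : PolyForm K n → Prop} (h0 : ∀ c : K, P (algebraMap K _ c))
    (h1 : ∀ i, P (t K i)) (h2 : ∀ i, P (dt K i)) (hm : ∀ x y, P x → P y → P (x * y))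
    (ha : ∀ x y, P x → P y → P (x + y)) (x : PolyForm K n) : P x := by
  obtain ⟨y, rfl⟩ := RingQuot.mkAlgHom_surjective K (Rel K n) x
  change P (mk K n y)
  induction y using FreeAlgebra.induction with
  | grade0 r => simpa using h0 r
  | grade1 g =>
    cases g with
    | t i => exact h1 i
    | dt i => exact h2 i
  | mul a b ha' hb' => rw [map_mul]; exact hm _ _ ha' hb'
  | add a b ha' hb' => rw [map_add]; exact ha _ _ ha' hb'

theorem dMatrix_apply {n : ℕ} (x : PolyForm K n) :
    dMatrix K n x = !![sign K n x, d K n x; 0, x] := by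
  have key : dMatrix K n x 0 0 = sign K n x ∧ dMatrix K n x 1 0 = 0 ∧ dMatrix K n x 1 1 = x := by
    induction x using induction with
    | h0 c => simp [Matrix.algebraMap_matrix_apply]
    | h1 i => simp [dMatrix, sign]
    | h2 i => simp [dMatrix, sign]
    | hm x y hx hy =>
      simp only [map_mul, Matrix.mul_apply, Fin.sum_univ_two, hx.1, hx.2.1, hx.2.2, hy.1, hy.2.1,
        hy.2.2]
      simp
    | ha x y hx hy =>
      simp only [map_add, Matrix.add_apply, hx.1, hx.2.1, hx.2.2, hy.1, hy.2.1, hy.2.2]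
      simp
  ext i j
  fin_cases i <;> fin_cases j
  · exact key.1
  · rfl
  · exact key.2.1
  · exact key.2.2

theorem d_mul {n : ℕ} (x y : PolyForm K n) :
    d K n (x * y) = d K n x * y + sign K n x * d K n y := by
  have h := congrFun (congrFun (map_mul (dMatrix K n) x y) 0) 1
  rw [dMatrix_apply, dMatrix_apply x, dMatrix_apply y] at h
  simpa [Matrix.mul_fin_two, add_comm] using h

theorem d_algebraMap {n : ℕ} (c : K) : d K n (algebraMap K _ c) = 0 := by
  simp [d, Matrix.algebraMap_matrix_apply]

theorem sign_sign {n : ℕ} (x : PolyForm K n) : sign K n (sign K n x) = x := by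
  have : (sign K n).comp (sign K n) = AlgHom.id K _ :=
    hom_ext (fun i => by simp [sign]) (fun i => by simp [sign])
  exact DFunLike.congr_fun this x

theorem d_sign {n : ℕ} (x : PolyForm K n) : d K n (sign K n x) = -sign K n (d K n x) := by
  induction x using induction with
  | h0 c => simp [d_algebraMap]
  | h1 i => simp [sign, d_t]
  | h2 i => simp [sign, d_dt]
  | hm x y hx hy => simp only [map_mul, d_mul, hx, hy, map_add, sign_sign]; noncomm_ring
  | ha x y hx hy => simp only [map_add, hx, hy]; abel

theorem d_d {n : ℕ} (x : PolyForm K n) : d K n (d K n x) = 0 := by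
  induction x using induction with
  | h0 c => simp [d_algebraMap]
  | h1 i => simp [d_t, d_dt]
  | h2 i => simp [d_dt]
  | hm x y hx hy => simp only [d_mul, map_add, hx, hy, d_sign]; noncomm_ring
  | ha x y hx hy => simp only [map_add, hx, hy, add_zero]

theorem d_pullback {m n : ℕ} (α : Fin (m + 1) → Fin (n + 1)) (x : PolyForm K n) :
    d K m (pullback K α x) = pullback K α (d K n x) := by
  have hs : ∀ x, sign K m (pullback K α x) = pullback K α (sign K n x) := by
    intro x
    have : (sign K m).comp (pullback K α) = (pullback K α).comp (sign K n) :=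
      hom_ext (fun i => by simp [sign, pullback]) (fun i => by simp [sign, pullback])
    exact DFunLike.congr_fun this x
  induction x using induction with
  | h0 c => simp [d_algebraMap]
  | h1 i => simp [d_t, pullback]
  | h2 i => simp [d_dt, pullback]
  | hm x y hx hy => simp only [map_mul, d_mul, hx, hy, map_add, hs]
  | ha x y hx hy => simp only [map_add, hx, hy]

theorem one_mem_gr (n : ℕ) : (1 : PolyForm K n) ∈ gr K n 0 :=
  Submodule.subset_span ⟨[], by simp, by simp, by simp⟩

theorem mul_mem_gr {n p q : ℕ} {x y : PolyForm K n} (hx : x ∈ gr K n p) (hy : y ∈ gr K n q) :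
    x * y ∈ gr K n (p + q) := by
  have h : gr K n p * gr K n q ≤ gr K n (p + q) := by
    rw [gr, gr, homogPart, homogPart, Submodule.span_mul_span, Submodule.span_le]
    rintro _ ⟨_, ⟨l, hl, hl', rfl⟩, _, ⟨l', hm, hm', rfl⟩, rfl⟩
    refine Submodule.subset_span ⟨l ++ l', ?_, by simp [hl', hm'], by simp⟩
    intro q hq
    rcases List.mem_append.1 hq with hq | hq
    · exact hl q hq
    · exact hm q hq
  exact h (Submodule.mul_mem_mul hx hy)

theorem t_mem_gr {n : ℕ} (i : Fin (n + 1)) : t K i ∈ gr K n 0 :=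
  Submodule.subset_span ⟨[(0, t K i)], by simp, by simp, by simp⟩

theorem dt_mem_gr {n : ℕ} (i : Fin (n + 1)) : dt K i ∈ gr K n 1 :=
  Submodule.subset_span ⟨[(1, dt K i)], by simp, by simp, by simp⟩

theorem gr_induction {n : ℕ} {P : ℕ → PolyForm K n → Prop} (h0 : ∀ p, P p 0)
    (h1 : P 0 1) (ht : ∀ p i x, x ∈ gr K n p → P p x → P p (t K i * x))
    (hdt : ∀ p i x, x ∈ gr K n p → P p x → P (p + 1) (dt K i * x))
    (ha : ∀ p x y, P p x → P p y → P p (x + y)) (hs : ∀ p (c : K) x, P p x → P p (c • x))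
    (p : ℕ) (x : PolyForm K n) (hx : x ∈ gr K n p) : P p x := by
  refine Submodule.span_induction (p := fun x _ => P p x) ?_ (h0 p)
    (fun x y _ _ hx hy => ha p x y hx hy) (fun c x _ hx => hs p c x hx) hx
  clear hx x
  rintro _ ⟨l, hl, rfl, rfl⟩
  induction l with
  | nil => simpa using h1
  | cons a l ih =>
    have hl' : ∀ q ∈ l, _ := fun q hq => hl q (List.mem_cons_of_mem _ hq)
    have hmem : (l.map Prod.snd).prod ∈ gr K n (l.map Prod.fst).sum :=
      Submodule.subset_span ⟨l, hl', rfl, rfl⟩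
    have ih := ih hl'
    have ha := hl a List.mem_cons_self
    obtain ⟨k, g⟩ := a
    match k, ha with
    | 0, ⟨i, hi⟩ =>
      obtain rfl : t K i = g := hi
      simpa using ht _ i _ hmem ih
    | 1, ⟨i, hi⟩ =>
      obtain rfl : dt K i = g := hi
      simpa [add_comm] using hdt _ i _ hmem ih

theorem sign_of_mem_gr {n p : ℕ} {x : PolyForm K n} (hx : x ∈ gr K n p) :
    sign K n x = (-1 : K) ^ p • x := by
  refine gr_induction (P := fun p x => sign K n x = (-1 : K) ^ p • x) ?_ ?_ ?_ ?_ ?_ ?_ p x hx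
  · intro p; simp
  · simp
  · intro p i x _ ih; rw [map_mul, ih]; simp [sign]
  · intro p i x _ ih; rw [map_mul, ih]; simp [sign, pow_succ]
  · intro p x y hx hy; rw [map_add, hx, hy, smul_add]
  · intro p c x hx; rw [map_smul, hx, smul_comm]

theorem d_mem_gr {n p : ℕ} {x : PolyForm K n} (hx : x ∈ gr K n p) : d K n x ∈ gr K n (p + 1) := by
  refine gr_induction (P := fun p x => d K n x ∈ gr K n (p + 1)) ?_ ?_ ?_ ?_ ?_ ?_ p x hx
  · intro p; simp
  · have h := d_algebraMap (K := K) (n := n) 1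
    rw [map_one] at h
    rw [h]; exact Submodule.zero_mem _
  · intro p i x hx ih
    rw [d_mul, d_t]
    refine Submodule.add_mem _ (by simpa [add_comm] using mul_mem_gr (dt_mem_gr i) hx) ?_
    simpa [sign] using mul_mem_gr (t_mem_gr i) ih
  · intro p i x hx ih
    rw [d_mul, d_dt, zero_mul, zero_add]
    have := mul_mem_gr (dt_mem_gr i) ih
    simpa [sign, add_comm, add_left_comm] using this
  · intro p x y hx hy; rw [map_add]; exact Submodule.add_mem _ hx hy
  · intro p c x hx; rw [map_smul]; exact Submodule.smul_mem _ _ hx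

end PolyForm

/-! ### The polynomial de Rham algebra `A_PL` -/

namespace APL

open CategoryTheory Opposite

universe u v

variable (K : Type v) [Field K] (S : SSet.{u})

/-- Polynomial forms of degree `p` on a simplicial set `S`: families assigning to every `n`-simplex
of `S` a polynomial form of degree `p` on the standard `n`-simplex, compatibly with all simplicial
operators. -/
noncomputable def forms (p : ℕ) :
    Submodule K (∀ n : SimplexCategoryᵒᵖ, S.obj n → PolyForm K n.unop.len) where
  carrier := {ω | (∀ n σ, ω n σ ∈ PolyForm.gr K n.unop.len p) ∧
    ∀ (m n : SimplexCategoryᵒᵖ) (α : n ⟶ m) (σ : S.obj n),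
      ω m (S.map α σ) = PolyForm.pullback K α.unop.toOrderHom (ω n σ)}
  zero_mem' := ⟨fun _ _ => Submodule.zero_mem _, fun _ _ _ _ => (map_zero _).symm⟩
  add_mem' := fun {a b} ha hb => ⟨fun n σ => Submodule.add_mem _ (ha.1 n σ) (hb.1 n σ),
    fun m n α σ => by
      change a m _ + b m _ = PolyForm.pullback K _ (a n σ + b n σ)
      rw [ha.2, hb.2, map_add]⟩
  smul_mem' := fun c a ha => ⟨fun n σ => Submodule.smul_mem _ _ (ha.1 n σ),
    fun m n α σ => by
      change c • a m _ = PolyForm.pullback K _ (c • a n σ)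
      rw [ha.2, map_smul]⟩

instance : SetLike.GradedMonoid (forms K S) where
  one_mem := ⟨fun _ _ => PolyForm.one_mem_gr _, fun _ _ _ _ => (map_one _).symm⟩
  mul_mem := fun p q a b ha hb => ⟨fun n σ => PolyForm.mul_mem_gr (ha.1 n σ) (hb.1 n σ),
    fun m n α σ => by
      change a m _ * b m _ = PolyForm.pullback K _ (a n σ * b n σ)
      rw [ha.2, hb.2, map_mul]⟩

/-- The exterior derivative, computed simplexwise. -/
noncomputable def dFamily : (∀ n : SimplexCategoryᵒᵖ, S.obj n → PolyForm K n.unop.len) →ₗ[K]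
    (∀ n : SimplexCategoryᵒᵖ, S.obj n → PolyForm K n.unop.len) where
  toFun ω n σ := PolyForm.d K _ (ω n σ)
  map_add' a b := by ext n σ; exact map_add _ _ _
  map_smul' c a := by ext n σ; exact (PolyForm.d K _).map_smul c (a n σ)

theorem dFamily_mem {p : ℕ} {ω} (h : ω ∈ forms K S p) : dFamily K S ω ∈ forms K S (p + 1) :=
  ⟨fun n σ => PolyForm.d_mem_gr (h.1 n σ), fun m n α σ => by
    change PolyForm.d K _ (ω m _) = PolyForm.pullback K _ (PolyForm.d K _ (ω n σ))
    rw [h.2, PolyForm.d_pullback]⟩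

/-- The exterior derivative on forms of degree `p`. -/
noncomputable def dForms (p : ℕ) : forms K S p →ₗ[K] forms K S (p + 1) :=
  (dFamily K S).restrict fun _ h => dFamily_mem K S h

/-- The exterior derivative on `⨁ p, A_PL^p`. -/
noncomputable def dTotal : (⨁ p, forms K S p) →ₗ[K] ⨁ p, forms K S p :=
  DirectSum.toModule K ℕ _ fun p => DirectSum.lof K ℕ (fun p => forms K S p) (p + 1) ∘ₗ dForms K S p

theorem dTotal_lof (p : ℕ) (ω : forms K S p) :
    dTotal K S (DirectSum.lof K ℕ (fun p => forms K S p) p ω) =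
      DirectSum.lof K ℕ (fun p => forms K S p) (p + 1) (dForms K S p ω) := by
  simp [dTotal]

/-- The summand `A_PL^p` of `⨁ p, A_PL^p`. -/
noncomputable def gr (p : ℕ) : Submodule K (⨁ p, forms K S p) :=
  LinearMap.range (DirectSum.lof K ℕ (fun p => forms K S p) p)

instance : SetLike.GradedMonoid (gr K S) where
  one_mem := ⟨⟨1, SetLike.GradedOne.one_mem⟩, rfl⟩
  mul_mem := by
    rintro p q _ _ ⟨a, rfl⟩ ⟨b, rfl⟩
    exact ⟨⟨a.1 * b.1, SetLike.GradedMul.mul_mem a.2 b.2⟩,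
      (DirectSum.of_mul_of (A := fun p => forms K S p) a b).symm⟩

noncomputable instance : DirectSum.Decomposition (gr K S) :=
  DirectSum.Decomposition.ofLinearMap (gr K S)
    (DirectSum.toModule K ℕ _ fun p => DirectSum.lof K ℕ (fun p => gr K S p) p ∘ₗ
      (DirectSum.lof K ℕ (fun p => forms K S p) p).rangeRestrict)
    (by
      ext p ω : 2
      simp only [LinearMap.comp_apply, DirectSum.toModule_lof, LinearMap.id_apply]
      exact DirectSum.coeLinearMap_lof (gr K S) p _)
    (by
      ext p ⟨_, ω, rfl⟩ : 2
      simp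
      rfl)

noncomputable instance : GradedAlgebra (gr K S) where

theorem lof_mul_lof {i j : ℕ} (u : forms K S i) (w : forms K S j) :
    DirectSum.lof K ℕ (fun p => forms K S p) i u * DirectSum.lof K ℕ (fun p => forms K S p) j w =
      DirectSum.lof K ℕ (fun p => forms K S p) (i + j)
        ⟨u.1 * w.1, SetLike.GradedMul.mul_mem u.2 w.2⟩ :=
  DirectSum.of_mul_of (A := fun p => forms K S p) u w

theorem lof_congr {i j : ℕ} (h : i = j) (u : forms K S i) (w : forms K S j) (huw : u.1 = w.1) :
    DirectSum.lof K ℕ (fun p => forms K S p) i u =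
      DirectSum.lof K ℕ (fun p => forms K S p) j w := by
  subst h
  rw [Subtype.ext huw]

theorem dTotal_dTotal (x : ⨁ p, forms K S p) : dTotal K S (dTotal K S x) = 0 := by
  have h : dTotal K S ∘ₗ dTotal K S = 0 := by
    refine DirectSum.linearMap_ext K fun p => LinearMap.ext fun ω => ?_
    have : dForms K S (p + 1) (dForms K S p ω) = 0 := by
      ext n σ
      exact PolyForm.d_d _
    rw [LinearMap.comp_apply, LinearMap.comp_apply, dTotal_lof, dTotal_lof, this, map_zero]
    rfl
  exact LinearMap.congr_fun h x

theorem dForms_leibniz {n p : ℕ} (a : forms K S n) (b : forms K S p) :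
    dFamily K S (a.1 * b.1) =
      (dForms K S n a).1 * b.1 + (-1 : K) ^ n • (a.1 * (dForms K S p b).1) := by
  ext m σ
  change PolyForm.d K _ (a.1 m σ * b.1 m σ) = PolyForm.d K _ (a.1 m σ) * b.1 m σ +
    (-1 : K) ^ n • (a.1 m σ * PolyForm.d K _ (b.1 m σ))
  rw [PolyForm.d_mul, PolyForm.sign_of_mem_gr (a.2.1 m σ), smul_mul_assoc]

theorem dTotal_leibniz {n : ℕ} (a : forms K S n) (y : ⨁ p, forms K S p) :
    dTotal K S (DirectSum.lof K ℕ (fun p => forms K S p) n a * y) =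
      dTotal K S (DirectSum.lof K ℕ (fun p => forms K S p) n a) * y +
        (-1 : K) ^ n • (DirectSum.lof K ℕ (fun p => forms K S p) n a * dTotal K S y) := by
  induction y using DirectSum.induction_on with
  | zero => simp only [mul_zero, map_zero, smul_zero, add_zero]
  | of p b =>
    change dTotal K S (_ * DirectSum.lof K ℕ (fun p => forms K S p) p b) =
      dTotal K S _ * DirectSum.lof K ℕ (fun p => forms K S p) p b +
        (-1 : K) ^ n • (_ * dTotal K S (DirectSum.lof K ℕ (fun p => forms K S p) p b))
    have h : ((dForms K S n a).1 * b.1) ∈ forms K S (n + p + 1) := by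
      have := SetLike.GradedMul.mul_mem (dForms K S n a).2 b.2
      rwa [show n + 1 + p = n + p + 1 by omega] at this
    rw [lof_mul_lof, dTotal_lof, dTotal_lof, dTotal_lof, lof_mul_lof, lof_mul_lof,
      lof_congr K S (show n + 1 + p = n + p + 1 by omega) _ ⟨_, h⟩ rfl]
    rw [← LinearMap.map_smul]
    refine Eq.trans ?_ (map_add (DirectSum.lof K ℕ (fun p => forms K S p) (n + p + 1)) _ _)
    exact congrArg _ (Subtype.ext (dForms_leibniz K S a b))
  | add x y hx hy => rw [mul_add, map_add, hx, hy, map_add, mul_add, mul_add, smul_add]; abel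

end APL

/-- The polynomial de Rham algebra of a simplicial set. -/
noncomputable def APL.ofSSet (K : Type*) [Field K] (S : SSet) : CochainAlg K where
  carrier := ⨁ p, APL.forms K S p
  gr := APL.gr K S
  d := APL.dTotal K S
  d_mem := by
    rintro n _ ⟨a, rfl⟩
    exact ⟨_, (APL.dTotal_lof K S n a).symm⟩
  d_d := APL.dTotal_dTotal K S
  leibniz := by
    rintro n _ y ⟨a, rfl⟩
    exact APL.dTotal_leibniz K S a y

/-- The polynomial de Rham algebra `A_PL(X)` of a topological space, with coefficients in `K`: the
polynomial forms on its singular simplicial set. -/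
noncomputable def polynomialDeRham (K : Type*) [Field K] (X : Type*) [TopologicalSpace X] : CochainAlg K :=
  APL.ofSSet K (TopCat.toSSet.obj (TopCat.of X))

/-! ### The Hochschild complex -/

namespace CochainAlg

variable {K : Type*} [Field K] (A : CochainAlg K)

/-- The projection of `A` onto the sum of its components of degree congruent to `e` modulo `2`. -/
noncomputable def parityProj (e : ZMod 2) : A.carrier →ₗ[K] A.carrier :=
  DirectSum.toModule K ℕ A.carrier (fun n => if (n : ZMod 2) = e then (A.gr n).subtype else 0) ∘ₗ
    (DirectSum.decomposeLinearEquiv A.gr).toLinearMap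

/-- The tensor power `A ⊗ A^{⊗ k}`, spanned by the words `(w_0, …, w_k)`. -/
abbrev Word (k : ℕ) : Type _ := ⨂[K] _ : Fin (k + 1), A.carrier

/-- Multiplication of a word `(w_0, …, w_k)` of homogeneous elements by the sign
`(-1)^{s(e_0, …, e_k)}`, where `e_j` is the degree of `w_j` modulo `2`. -/
noncomputable def signed (k : ℕ) (s : (Fin (k + 1) → ZMod 2) → ZMod 2) : A.Word k →ₗ[K] A.Word k :=
  ∑ e : Fin (k + 1) → ZMod 2, (-1 : K) ^ (s e).val • PiTensorProduct.map fun j => A.parityProj (e j)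

/-- `(w_0, …, w_k) ↦ (w_0, …, d w_i, …, w_k)`. -/
noncomputable def dAt (k : ℕ) (i : Fin (k + 1)) : A.Word k →ₗ[K] A.Word k :=
  PiTensorProduct.map (Function.update (fun _ => LinearMap.id) i A.d)

/-- Multiplying two adjacent letters is linear in each letter. -/
theorem exists_contract_update (k : ℕ) (i : Fin (k + 1)) (w : Fin (k + 2) → A.carrier)
    (j : Fin (k + 2)) : ∃ (p : Fin (k + 1)) (g : A.carrier →ₗ[K] A.carrier), ∀ x,
      Fin.contractNth i.castSucc (· * ·) (Function.update w j x) =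
        Function.update (Fin.contractNth i.castSucc (· * ·) w) p (g x) := by
  by_cases h1 : j = i.castSucc
  · subst h1
    refine ⟨i, LinearMap.mulRight K (w i.succ), fun x => funext fun q => ?_⟩
    simp only [Fin.contractNth, Function.update_apply, Fin.ext_iff, Fin.val_castSucc, Fin.val_succ,
      LinearMap.mulRight_apply]
    split_ifs <;> first | rfl | omega | skip
    rw [show q = i from Fin.ext ‹_›]
  by_cases h2 : j = i.succ
  · subst h2
    refine ⟨i, LinearMap.mulLeft K (w i.castSucc), fun x => funext fun q => ?_⟩
    simp only [Fin.contractNth, Function.update_apply, Fin.ext_iff, Fin.val_castSucc, Fin.val_succ,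
      LinearMap.mulLeft_apply]
    split_ifs <;> first | rfl | omega | skip
    rw [show q = i from Fin.ext ‹_›]
  simp only [Fin.ext_iff, Fin.val_castSucc, Fin.val_succ] at h1 h2
  by_cases h3 : j.val < i.val
  · refine ⟨⟨j.val, by omega⟩, LinearMap.id, fun x => funext fun q => ?_⟩
    simp only [Fin.contractNth, Function.update_apply, Fin.ext_iff, Fin.val_castSucc, Fin.val_succ,
      LinearMap.id_apply]
    split_ifs <;> first | rfl | omega
  · refine ⟨⟨j.val - 1, by omega⟩, LinearMap.id, fun x => funext fun q => ?_⟩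
    simp only [Fin.contractNth, Function.update_apply, Fin.ext_iff, Fin.val_castSucc, Fin.val_succ,
      LinearMap.id_apply]
    split_ifs <;> first | rfl | omega

/-- `(w_0, …, w_{k+1}) ↦ (w_0, …, w_i w_{i+1}, …, w_{k+1})`. -/
noncomputable def mulAt (k : ℕ) (i : Fin (k + 1)) : A.Word (k + 1) →ₗ[K] A.Word k :=
  PiTensorProduct.lift
    { toFun := fun w => PiTensorProduct.tprod K (Fin.contractNth i.castSucc (· * ·) w)
      map_update_add' := by
        intro inst w j x y
        obtain rfl : inst = instDecidableEqFin _ := Subsingleton.elim _ _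
        obtain ⟨p, g, h⟩ := A.exists_contract_update k i w j
        rw [h, h, h, map_add, MultilinearMap.map_update_add]
      map_update_smul' := by
        intro inst w j c x
        obtain rfl : inst = instDecidableEqFin _ := Subsingleton.elim _ _
        obtain ⟨p, g, h⟩ := A.exists_contract_update k i w j
        rw [h, h, map_smul, MultilinearMap.map_update_smul] }

/-- `(w_0, …, w_k) ↦ (w_i, …, w_k, w_0, …, w_{i-1})`. -/
noncomputable def rotate (k : ℕ) (i : Fin (k + 1)) : A.Word k →ₗ[K] A.Word k :=
  (PiTensorProduct.reindex K (fun _ => A.carrier) (Equiv.subRight i)).toLinearMap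

/-- `(w_0, …, w_k) ↦ (1, w_0, …, w_k)`. -/
noncomputable def consOne (k : ℕ) : A.Word k →ₗ[K] A.Word (k + 1) :=
  PiTensorProduct.lift
    ((PiTensorProduct.tprod K (s := fun _ : Fin (k + 2) => A.carrier)).curryLeft 1)

/-- For `e_j = deg w_j` modulo `2`, the number `ε_{i-1} = deg w_0 + ⋯ + deg w_{i-1} - (i - 1)`
modulo `2`. -/
def epsBefore {k : ℕ} (e : Fin (k + 1) → ZMod 2) (i : ℕ) : ZMod 2 :=
  (∑ j with j.val < i, e j) - ((i : ZMod 2) - 1)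

/-- The terms of the Hochschild differential involving `d`:
`(w_0, …, w_k) ↦ - ∑_{i ≤ k} (-1)^{ε_{i-1}} (w_0, …, d w_i, …, w_k)`. -/
noncomputable def bInner (k : ℕ) : A.Word k →ₗ[K] A.Word k :=
  -∑ i : Fin (k + 1), A.dAt k i ∘ₗ A.signed k fun e => epsBefore e i.val

/-- The terms of the Hochschild differential involving the product, on words `(w_0, …, w_n)` with
`n = k + 1`:
`(w_0, …, w_n) ↦ - ∑_{i < n} (-1)^{ε_i} (w_0, …, w_i w_{i+1}, …, w_n)
+ (-1)^{(deg w_n - 1) ε_{n-1}} (w_n w_0, w_1, …, w_{n-1})`. -/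
noncomputable def bOuter (k : ℕ) : A.Word (k + 1) →ₗ[K] A.Word k :=
  -(∑ i : Fin (k + 1), A.mulAt k i ∘ₗ A.signed (k + 1) fun e => epsBefore e (i.val + 1)) +
    A.mulAt k 0 ∘ₗ A.rotate (k + 1) (Fin.last (k + 1)) ∘ₗ
      A.signed (k + 1) fun e => (e (Fin.last (k + 1)) - 1) * epsBefore e (k + 1)

/-- Connes' operator on words:
`(w_0, …, w_k) ↦ ∑_{i ≤ k} (-1)^{(ε_{i-1} + 1)(ε_k - ε_{i-1})} (1, w_i, …, w_k, w_0, …, w_{i-1})`. -/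
noncomputable def connesWord (k : ℕ) : A.Word k →ₗ[K] A.Word (k + 1) :=
  ∑ i : Fin (k + 1), A.consOne k ∘ₗ A.rotate k i ∘ₗ
    A.signed k fun e => (epsBefore e i.val + 1) * (epsBefore e (k + 1) - epsBefore e i.val)

/-- The (unnormalized) chains `⨁ k, A ⊗ A^{⊗ k}`. -/
abbrev Chains : Type _ := ⨁ k, A.Word k

/-- The word `(w_0, …, w_k)` as a chain. -/
noncomputable def word {k : ℕ} (w : Fin (k + 1) → A.carrier) : A.Chains :=
  DirectSum.lof K ℕ A.Word k (PiTensorProduct.tprod K w)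

/-- The Hochschild differential `b`. -/
noncomputable def hochschildB : A.Chains →ₗ[K] A.Chains :=
  DirectSum.toModule K ℕ _ fun k => match k with
    | 0 => DirectSum.lof K ℕ A.Word 0 ∘ₗ A.bInner 0
    | k + 1 => DirectSum.lof K ℕ A.Word (k + 1) ∘ₗ A.bInner (k + 1) +
        DirectSum.lof K ℕ A.Word k ∘ₗ A.bOuter k

/-- Connes' operator `B`. -/
noncomputable def connesB : A.Chains →ₗ[K] A.Chains :=
  DirectSum.toModule K ℕ _ fun k => DirectSum.lof K ℕ A.Word (k + 1) ∘ₗ A.connesWord k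

/-- The subcomplex of chains vanishing in the reduced Hochschild complex `C(A) / C(K)`, where
`C(A) = ⨁ k, A ⊗ (A/K)^{⊗ k}`: it is spanned by the words `(w_0, …, w_k)` with `w_i = 1` for some
`i ≥ 1` and by the word `(1)`. -/
noncomputable def trivialChains : Submodule K A.Chains :=
  Submodule.span K ({x | ∃ (k : ℕ) (w : Fin (k + 1) → A.carrier), (∃ i, i ≠ 0 ∧ w i = 1) ∧
    A.word w = x} ∪ {A.word (k := 0) fun _ => 1})

/-- Chains which are cycles for `b` in the reduced Hochschild complex. -/
noncomputable def redCycles : Submodule K A.Chains := A.trivialChains.comap A.hochschildB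

/-- Chains which are boundaries for `b` in the reduced Hochschild complex. -/
noncomputable def redBoundaries : Submodule K A.Chains :=
  LinearMap.range A.hochschildB ⊔ A.trivialChains

/-- The reduced Hochschild homology of `A`, cycles modulo boundaries, as a subspace of chains modulo
boundaries. -/
noncomputable def redHochschildHomology : Submodule K (A.Chains ⧸ A.redBoundaries) :=
  A.redCycles.map A.redBoundaries.mkQ

/-- The kernel of the operator induced by `B` on reduced Hochschild homology: the classes of the
cycles `x` for which `B x` is a boundary. -/
noncomputable def kerRedB : Submodule K (A.Chains ⧸ A.redBoundaries) :=
  (A.redCycles ⊓ A.redBoundaries.comap A.connesB).map A.redBoundaries.mkQ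

/-- The image of the operator induced by `B` on reduced Hochschild homology: the classes of the
cycles `B y` for `y` a cycle. -/
noncomputable def rangeRedB : Submodule K (A.Chains ⧸ A.redBoundaries) :=
  (A.redCycles.map A.connesB).map A.redBoundaries.mkQ

/-- Batalin-Vilkovisky exactness: `Im B = Ker B` on reduced Hochschild homology. -/
def IsBVExact : Prop := A.rangeRedB = A.kerRedB

end CochainAlg

/-! ### Spaces -/

/-- `M` together with `φ : M → A_PL(X)` is a minimal Sullivan model of `X` generated by `V`. -/
def IsMinimalSullivanModel (K : Type*) [Field K] (X : Type*) [TopologicalSpace X]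
    (M : CochainAlg K) (V : ℕ → Submodule K M.carrier)
    (φ : CochainAlg.Hom M (polynomialDeRham K X)) : Prop :=
  M.IsMinimalSullivan V ∧ φ.IsQuasiIso

universe u v w

/-- The space `X` admits positive weights: its minimal Sullivan model `(∧V, d)` over `K` has a
positive weight decomposition. -/
def AdmitsPositiveWeights (K : Type v) [Field K] (X : Type u) [TopologicalSpace X] : Prop :=
  ∃ (M : CochainAlg.{v, w} K) (V : ℕ → Submodule K M.carrier)
    (φ : CochainAlg.Hom M (polynomialDeRham K X)) (W : ℕ → ℕ → Submodule K M.carrier),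
    IsMinimalSullivanModel K X M V φ ∧ M.IsPositiveWeight V W

/-- The space `X` is BV exact (over `K`) if its polynomial de Rham algebra is. -/
def IsBVExactSpace (K : Type v) [Field K] (X : Type u) [TopologicalSpace X] : Prop :=
  (polynomialDeRham K X).IsBVExact

/-! The weight decomposition of the minimal model `∧V` defines a derivation `D` of degree `0` that
multiplies elements of weight `i` by `i`; it commutes with `d` because `d` preserves weights. `D`
acts on Hochschild chains by the Lie derivative `L`, which multiplies a word of weight-homogeneous
letters by its total weight.

The engine is the Cartan homotopy formula `b E + E b + B e + e B = L` together with `b e = -e b`.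
Here `e` multiplies `D w_k` onto `w_0`, and `E` is a cyclic sum that inserts a `1` in front
(`GradedDerivation.cartan`, `GradedDerivation.hochschildB_contraction`). If `x` is a reduced cycle
and `B x` is a boundary, the formula gives `L x = B (e x)` modulo boundaries, so `L` carries `Ker B`
into `Im B`. All weights of `V` are positive, so a word of total weight zero consists of scalars and
vanishes in the reduced complex. Since the characteristic is zero, `L` is diagonalizable there with
nonzero eigenvalues, and dividing by `L` gives `Ker B ⊆ Im B`. The opposite inclusion is `B B = 0`
on the reduced complex. This proves exactness of `∧V` (`GradedDerivation.isBVExact`,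
`IsPositiveWeight.isBVExact`).

Exactness passes from `∧V` to the polynomial de Rham algebra because a quasi-isomorphism induces an
isomorphism on reduced Hochschild homology compatible with `B`. Over a field it has a homotopy
inverse as a map of complexes; tensor powers of the homotopies treat words of a fixed length, and an
induction on the length treats the whole complex (`Hom.IsQuasiIso.exists_chains`,
`Hom.IsQuasiIso.isBVExact`).

To control signs, `b` and `B` are rewritten with a signed rotation `rot`, signed products `contr j`
and the insertion `ins`. Each sign follows the Koszul rule for letters shifted by one degree, so a
sign identity becomes an identity of exponents in `ZMod 2`. -/

/-! ### Words of homogeneous letters -/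

namespace CochainAlg

variable {K : Type*} [Field K]

/-- The sign `(-1)^z` for a parity `z`. -/
def sgn (K : Type*) [Field K] (z : ZMod 2) : K := (-1) ^ z.val

theorem sgn_add (y z : ZMod 2) : sgn K (y + z) = sgn K y * sgn K z := by
  rw [sgn, sgn, sgn, ← pow_add, ZMod.val_add, ← neg_one_pow_eq_pow_mod_two]

@[simp] theorem sgn_zero : sgn K 0 = 1 := by simp [sgn]

@[simp] theorem sgn_one : sgn K 1 = -1 := by simp [sgn, ZMod.val_one]

theorem sgn_natCast (n : ℕ) : sgn K (n : ZMod 2) = (-1) ^ n := by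
  induction n with
  | zero => simp
  | succ n ih => rw [Nat.cast_succ, sgn_add, ih, sgn_one, pow_succ]

/-- Homogeneous elements of a cochain algebra. -/
structure Letter (A : CochainAlg K) where
  val : A.carrier
  deg : ℕ
  mem : val ∈ A.gr deg

/-- The parity of the degree of a letter in the suspension. -/
def Letter.par {A : CochainAlg K} (a : A.Letter) : ZMod 2 := a.deg + 1

/-- The product of letters. -/
def Letter.mul {A : CochainAlg K} (a b : A.Letter) : A.Letter :=
  ⟨a.val * b.val, a.deg + b.deg, SetLike.GradedMul.mul_mem a.mem b.mem⟩

/-- The unit as a letter. -/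
def Letter.one {A : CochainAlg K} : A.Letter := ⟨1, 0, SetLike.GradedOne.one_mem⟩

@[simp] theorem Letter.par_mul {A : CochainAlg K} (a b : A.Letter) :
    (a.mul b).par = a.par + b.par + 1 := by
  have : (1 : ZMod 2) + 1 = 0 := by decide
  simp only [Letter.par, Letter.mul, Nat.cast_add]
  linear_combination -this

@[simp] theorem Letter.par_one {A : CochainAlg K} : (Letter.one : A.Letter).par = 1 := by
  simp [Letter.par, Letter.one]

variable (A : CochainAlg K)

/-- The parity of a list of letters. -/
def par {A : CochainAlg K} (l : List A.Letter) : ZMod 2 := (l.map Letter.par).sum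

@[simp] theorem par_nil : par ([] : List A.Letter) = 0 := rfl

@[simp] theorem par_cons (a : A.Letter) (l : List A.Letter) : par (a :: l) = a.par + par l := by
  simp [par]

@[simp] theorem par_append (l l' : List A.Letter) : par (l ++ l') = par l + par l' := by
  simp [par]

/-- The chain given by a nonempty list of letters. -/
noncomputable def wd {A : CochainAlg K} : List A.Letter → A.Chains
  | [] => 0
  | a :: l => A.word (k := l.length) fun i => ((a :: l).get i).val

theorem wd_eq {k : ℕ} (w : Fin (k + 1) → A.carrier) (l : List A.Letter) (h : l.length = k + 1)
    (hw : ∀ i : Fin (k + 1), w i = (l.get (i.cast h.symm)).val) : A.word w = wd l := by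
  match l, h with
  | a :: l, h =>
    obtain rfl : l.length = k := by simpa using h
    exact congrArg A.word (funext hw)

theorem parityProj_of_mem {n : ℕ} {x : A.carrier} (hx : x ∈ A.gr n) (e : ZMod 2) :
    A.parityProj e x = if (n : ZMod 2) = e then x else 0 := by
  lift x to A.gr n using hx
  simp only [parityProj, LinearMap.comp_apply, LinearEquiv.coe_coe,
    DirectSum.decomposeLinearEquiv_apply, DirectSum.decompose_coe]
  erw [DirectSum.toModule_lof]
  split_ifs <;> rfl

/-- Of all parity vectors in the sum defining `signed`, only the one given by the degrees of the
letters contributes: any other projects some letter to zero. -/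
theorem signed_tprod {k : ℕ} (s : (Fin (k + 1) → ZMod 2) → ZMod 2) (w : Fin (k + 1) → A.carrier)
    (n : Fin (k + 1) → ℕ) (hw : ∀ j, w j ∈ A.gr (n j)) :
    A.signed k s (PiTensorProduct.tprod K w) =
      sgn K (s fun j => n j) • PiTensorProduct.tprod K w := by
  rw [signed, LinearMap.sum_apply, Finset.sum_eq_single fun j => (n j : ZMod 2)]
  · rw [LinearMap.smul_apply, PiTensorProduct.map_tprod, sgn]
    congr 2
    funext j
    rw [parityProj_of_mem A (hw j), if_pos rfl]
  · intro e _ he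
    obtain ⟨j, hj⟩ := Function.ne_iff.1 he
    rw [LinearMap.smul_apply, PiTensorProduct.map_tprod,
      (PiTensorProduct.tprod K).map_coord_zero j, smul_zero]
    rw [parityProj_of_mem A (hw j), if_neg (Ne.symm hj)]
  · simp

/-- Modulo 2 the shift `-(i - 1)` equals `i + 1`, so `ε_{i-1} + 1` is the total degree of the first
`i` letters after suspension. This turns the signs of `b` and `B` into Koszul signs. -/
theorem sum_par_get {k : ℕ} (l : List A.Letter) (h : l.length = k + 1) (i : ℕ) (hi : i ≤ k + 1) :
    epsBefore (fun j : Fin (k + 1) => ((l.get (j.cast h.symm)).deg : ZMod 2)) i + 1 =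
      par (l.take i) := by
  have two : (1 : ZMod 2) + 1 = 0 := by decide
  induction i with
  | zero => simp [epsBefore, two]
  | succ i ih =>
    rw [List.take_add_one, List.getElem?_eq_getElem (by omega), Option.toList_some, par_append,
      ← ih (by omega), par_cons, par_nil]
    have : (Finset.univ.filter fun j : Fin (k + 1) => j.val < i + 1) =
        insert ⟨i, by omega⟩ (Finset.univ.filter fun j : Fin (k + 1) => j.val < i) := by
      ext j; simp [Fin.ext_iff]; omega
    simp only [epsBefore]
    rw [this, Finset.sum_insert (by simp), Nat.cast_add, Letter.par]
    simp only [List.get_eq_getElem, Fin.val_cast]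
    linear_combination -two

/-! ### Elementary operators on words, with Koszul signs. -/

/-- Multiplication of the letters in positions `j` and `j + 1`, with the Koszul sign. -/
noncomputable def contr (j : ℕ) : A.Chains →ₗ[K] A.Chains :=
  DirectSum.toModule K ℕ _ fun k => match k with
    | 0 => 0
    | k + 1 => if h : j < k + 1 then DirectSum.lof K ℕ A.Word k ∘ₗ A.mulAt k ⟨j, h⟩ ∘ₗ
        A.signed (k + 1) (fun e => epsBefore e (j + 1) + 1) else 0

/-- Cyclic rotation moving the last letter to the front, with the Koszul sign. -/
noncomputable def rot : A.Chains →ₗ[K] A.Chains :=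
  DirectSum.toModule K ℕ _ fun k => DirectSum.lof K ℕ A.Word k ∘ₗ A.rotate k (Fin.last k) ∘ₗ
    A.signed k fun e => (e (Fin.last k) + 1) * (epsBefore e k + 1)

/-- Insertion of the letter `1` in front. -/
noncomputable def ins : A.Chains →ₗ[K] A.Chains :=
  DirectSum.toModule K ℕ _ fun k => DirectSum.lof K ℕ A.Word (k + 1) ∘ₗ A.consOne k

/-- Application of a linear map of parity `ε` to the letter in position `i`, with the Koszul
sign. -/
noncomputable def applyAt (φ : A.carrier →ₗ[K] A.carrier) (ε : ZMod 2) (i : ℕ) :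
    A.Chains →ₗ[K] A.Chains :=
  DirectSum.toModule K ℕ _ fun k => if h : i < k + 1 then DirectSum.lof K ℕ A.Word k ∘ₗ
    PiTensorProduct.map (Function.update (fun _ => LinearMap.id) ⟨i, h⟩ φ) ∘ₗ
      A.signed k (fun e => ε * (epsBefore e i + 1)) else 0

theorem wd_cons_eq {l : List A.Letter} {k : ℕ} (h : l.length = k + 1) :
    wd l = DirectSum.lof K ℕ A.Word k
      (PiTensorProduct.tprod K fun i => (l.get (i.cast h.symm)).val) :=
  (A.wd_eq _ l h fun _ => rfl).symm

/-- The product is odd on suspended letters (see `Letter.par_mul`): it passes the prefix `p`, and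
the extra `a.par` is the sign of the suspended product itself. Both together absorb the minus sign
in front of the product terms of `b`. -/
theorem contr_wd (p : List A.Letter) (a b : A.Letter) (q : List A.Letter) :
    A.contr p.length (wd (p ++ a :: b :: q)) =
      sgn K (par p + a.par) • wd (p ++ a.mul b :: q) := by
  have hl : (p ++ a :: b :: q).length = (p.length + q.length + 1) + 1 := by simp; omega
  rw [wd_cons_eq A hl, contr, DirectSum.toModule_lof]
  simp only [show p.length < p.length + q.length + 1 by omega, dif_pos, LinearMap.comp_apply]
  rw [signed_tprod A _ _ _ (fun j => Letter.mem _), sum_par_get A _ hl _ (by omega), map_smul,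
    map_smul, mulAt, PiTensorProduct.lift.tprod]
  have ht : par (List.take (p.length + 1) (p ++ a :: b :: q)) = par p + a.par := by
    simp [List.take_append, List.take_of_length_le]
  rw [ht]
  congr 1
  refine A.wd_eq _ _ (by simp; omega) fun i => ?_
  simp only [Fin.contractNth, List.get_eq_getElem, Fin.val_castSucc, Fin.val_cast, Fin.val_succ]
  split_ifs with h1 h2
  · simp [h1]
  · simp [h2, Letter.mul]
  · have h3 : ¬ (i : ℕ) < p.length := h1
    have h4 : ¬ (i : ℕ) = p.length := h2
    obtain ⟨j, hj⟩ : ∃ j, (i : ℕ) = p.length + (j + 1) := ⟨i - p.length - 1, by omega⟩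
    simp [List.getElem_append, hj, show p.length + (j + 1) + 1 - p.length = j + 1 + 1 by omega,
      show ¬ p.length + (j + 1) + 1 < p.length by omega]

theorem contr_wd_of_le (l : List A.Letter) (j : ℕ) (h : l.length ≤ j + 1) :
    A.contr j (wd l) = 0 := by
  match l with
  | [] => exact map_zero _
  | [a] => rw [wd_cons_eq A (k := 0) rfl, contr, DirectSum.toModule_lof]; rfl
  | a :: b :: l =>
    rw [wd_cons_eq A (k := l.length + 1) rfl, contr, DirectSum.toModule_lof]
    simp only [List.length_cons] at h
    simp only [show ¬ j < l.length + 1 by omega, dif_neg, not_false_eq_true]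
    rfl

theorem rotate_tprod {k : ℕ} (i : Fin (k + 1)) (w : Fin (k + 1) → A.carrier) :
    A.rotate k i (PiTensorProduct.tprod K w) = PiTensorProduct.tprod K fun j => w (j + i) := by
  simp only [rotate, LinearEquiv.coe_coe]
  erw [PiTensorProduct.reindex_tprod]
  rfl

theorem rot_wd (p : List A.Letter) (c : A.Letter) :
    A.rot (wd (p ++ [c])) = sgn K (c.par * par p) • wd (c :: p) := by
  have hl : (p ++ [c]).length = p.length + 1 := by simp
  rw [wd_cons_eq A hl, rot, DirectSum.toModule_lof]
  simp only [LinearMap.comp_apply]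
  rw [signed_tprod A _ _ _ (fun j => Letter.mem _), sum_par_get A _ hl _ (by omega), map_smul,
    map_smul, rotate_tprod]
  have ht : par (List.take p.length (p ++ [c])) = par p := by
    simp
  rw [ht]
  simp only [List.get_eq_getElem, Fin.val_cast, Fin.val_last, List.getElem_concat_length]
  congr 1
  refine A.wd_eq _ _ (by simp) fun i => ?_
  simp only [List.get_eq_getElem, Fin.val_cast]
  obtain ⟨i, hi⟩ := i
  cases i with
  | zero => simp
  | succ i =>
    have : (i + 1 + p.length) % (p.length + 1) = i := by
      rw [show i + 1 + p.length = i + (p.length + 1) by omega, Nat.add_mod_right,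
        Nat.mod_eq_of_lt (by omega)]
    simp [Fin.val_add, this, show i < p.length by omega]

theorem consOne_tprod {k : ℕ} (w : Fin (k + 1) → A.carrier) :
    A.consOne k (PiTensorProduct.tprod K w) = PiTensorProduct.tprod K (Fin.cons 1 w) := by
  simp [consOne, PiTensorProduct.lift.tprod]

theorem ins_wd {l : List A.Letter} (hl : l ≠ []) : A.ins (wd l) = wd (Letter.one :: l) := by
  obtain ⟨k, hk⟩ : ∃ k, l.length = k + 1 := Nat.exists_eq_succ_of_ne_zero (by simpa using hl)
  rw [wd_cons_eq A hk, ins, DirectSum.toModule_lof, LinearMap.comp_apply, consOne_tprod]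
  refine A.wd_eq _ _ (by simp [hk]) fun i => ?_
  refine Fin.cases ?_ (fun i => ?_) i
  · rfl
  · simp

/-- The image of a letter under a homogeneous map. -/
def Letter.map {A : CochainAlg K} {B : CochainAlg K} (φ : A.carrier →ₗ[K] B.carrier) {m : ℕ}
    (hφ : ∀ n, ∀ x ∈ A.gr n, φ x ∈ B.gr (n + m)) (a : A.Letter) : B.Letter :=
  ⟨φ a.val, a.deg + m, hφ _ _ a.mem⟩

@[simp] theorem Letter.par_map {B : CochainAlg K} (φ : A.carrier →ₗ[K] B.carrier) {m : ℕ}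
    (hφ : ∀ n, ∀ x ∈ A.gr n, φ x ∈ B.gr (n + m)) (a : A.Letter) :
    (a.map φ hφ).par = a.par + m := by
  simp [Letter.par, Letter.map]; ring

theorem applyAt_wd (φ : A.carrier →ₗ[K] A.carrier) (ε : ZMod 2) (p : List A.Letter)
    (a b : A.Letter) (q : List A.Letter) (hb : b.val = φ a.val) :
    A.applyAt φ ε p.length (wd (p ++ a :: q)) = sgn K (ε * par p) • wd (p ++ b :: q) := by
  have hl : (p ++ a :: q).length = (p.length + q.length) + 1 := by simp; omega
  rw [wd_cons_eq A hl, applyAt, DirectSum.toModule_lof]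
  simp only [show p.length < p.length + q.length + 1 by omega, dif_pos, LinearMap.comp_apply]
  rw [signed_tprod A _ _ _ (fun j => Letter.mem _), sum_par_get A _ hl _ (by omega), map_smul,
    map_smul, PiTensorProduct.map_tprod]
  have ht : par (List.take p.length (p ++ a :: q)) = par p := by simp
  rw [ht]
  congr 1
  refine A.wd_eq _ _ (by simp; omega) fun i => ?_
  simp only [List.get_eq_getElem, Fin.val_cast, Function.update_apply, Fin.ext_iff]
  split_ifs with h1
  · simp [h1, hb]
  · rcases Nat.lt_or_gt_of_ne h1 with h | h
    · simp [h]
    · obtain ⟨j, hj⟩ : ∃ j, (i : ℕ) = p.length + (j + 1) := ⟨i - p.length - 1, by omega⟩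
      simp [hj]

theorem applyAt_wd_of_le (φ : A.carrier →ₗ[K] A.carrier) (ε : ZMod 2) (l : List A.Letter) (i : ℕ)
    (h : l.length ≤ i) : A.applyAt φ ε i (wd l) = 0 := by
  match l with
  | [] => exact map_zero _
  | a :: l =>
    rw [wd_cons_eq A (k := l.length) rfl, applyAt, DirectSum.toModule_lof]
    simp only [List.length_cons] at h
    simp only [show ¬ i < l.length + 1 by omega, dif_neg, not_false_eq_true]
    rfl

/-! ### Reduction to words of homogeneous letters. -/

/-- Chains of words with `n` letters. -/
def wordsOfLength (n : ℕ) : Submodule K A.Chains :=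
  Submodule.span K {x | ∃ l : List A.Letter, l.length = n ∧ wd l = x}

variable {A}

theorem wd_mem {l : List A.Letter} {n : ℕ} (h : l.length = n) : wd l ∈ A.wordsOfLength n :=
  Submodule.subset_span ⟨l, h, rfl⟩

theorem eq_on_wordsOfLength {M : Type*} [AddCommGroup M] [Module K M] {n : ℕ}
    {f g : A.Chains →ₗ[K] M} (h : ∀ l : List A.Letter, l.length = n → f (wd l) = g (wd l))
    {x : A.Chains} (hx : x ∈ A.wordsOfLength n) : f x = g x := by
  refine LinearMap.eqOn_span (s := {x | ∃ l : List A.Letter, l.length = n ∧ wd l = x}) ?_ hx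
  rintro _ ⟨l, hl, rfl⟩
  exact h l hl

theorem wordsOfLength_le {M : Type*} [AddCommGroup M] [Module K M] {n : ℕ}
    {f : A.Chains →ₗ[K] M} {S : Submodule K M} (h : ∀ l : List A.Letter, l.length = n →
      f (wd l) ∈ S) {x : A.Chains} (hx : x ∈ A.wordsOfLength n) : f x ∈ S := by
  have : A.wordsOfLength n ≤ S.comap f := Submodule.span_le.2 (by rintro _ ⟨l, hl, rfl⟩; exact h l hl)
  exact this hx

/-- A multilinear function of homogeneous components. -/
theorem word_mem {k : ℕ} {S : Submodule K A.Chains} (w : Fin (k + 1) → A.carrier)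
    (h : ∀ n : Fin (k + 1) → ℕ, (∀ j, w j = 1 → n j = 0) →
      A.word (fun j => (DirectSum.decompose A.gr (w j) (n j) : A.carrier)) ∈ S) : A.word w ∈ S := by
  classical
  -- A letter equal to `1` is indexed by degree `0` alone, so every term of the expansion keeps its
  -- `1` in the same position. This is what allows the trivial chains to be spanned by homogeneous
  -- words.
  have hw : w = fun j => ∑ n ∈ (if w j = 1 then {0} else (DirectSum.decompose A.gr (w j)).support),
      (DirectSum.decompose A.gr (w j) n : A.carrier) := by
    funext j
    split_ifs with hj
    · rw [hj, Finset.sum_singleton, DirectSum.decompose_of_mem_same _ SetLike.GradedOne.one_mem]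
    · exact (DirectSum.sum_support_decompose A.gr (w j)).symm
  have key := ((PiTensorProduct.tprod K (s := fun _ : Fin (k + 1) => A.carrier))).map_sum_finset
    (fun j n => (DirectSum.decompose A.gr (w j) n : A.carrier))
    (fun j => if w j = 1 then {0} else (DirectSum.decompose A.gr (w j)).support)
  rw [← hw] at key
  rw [word, key, map_sum]
  refine Submodule.sum_mem _ fun n hn => h n fun j hj => ?_
  have := Fintype.mem_piFinset.1 hn j
  simpa [hj] using this

theorem iSup_wordsOfLength : ⨆ n, A.wordsOfLength (n + 1) = ⊤ := by
  rw [eq_top_iff]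
  rintro x -
  induction x using DirectSum.induction_on with
  | zero => exact Submodule.zero_mem _
  | add x y hx hy => exact Submodule.add_mem _ hx hy
  | of k x =>
    induction x using PiTensorProduct.induction_on with
    | add x y hx hy => rw [map_add]; exact Submodule.add_mem _ hx hy
    | smul_tprod r w =>
      change DirectSum.lof K ℕ A.Word k _ ∈ _
      rw [map_smul]
      refine Submodule.smul_mem _ _ (word_mem (A := A) w fun n _ => ?_)
      refine Submodule.mem_iSup_of_mem k ?_
      rw [A.wd_eq _ (List.ofFn fun j => (⟨_, n j, SetLike.coe_mem
        (DirectSum.decompose A.gr (w j) (n j))⟩ : A.Letter)) (by simp)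
        (fun i => by rw [List.get_ofFn]; rfl)]
      exact wd_mem (by simp)

/-- Operator identities are checked at a fixed word length, because the expressions of `b` and `B`
through `rot` and `contr` are sums whose range depends on the length. -/
theorem chains_ext {M : Type*} [AddCommGroup M] [Module K M] {f g : A.Chains →ₗ[K] M}
    (h : ∀ n, ∀ x ∈ A.wordsOfLength (n + 1), f x = g x) : f = g := by
  have : ⨆ n, A.wordsOfLength (n + 1) ≤ LinearMap.eqLocus f g := iSup_le fun n x hx => h n x hx
  rw [iSup_wordsOfLength] at this
  exact LinearMap.ext fun x => this trivial

end CochainAlg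

/-! ### Relations between the operators on words -/

namespace CochainAlg

variable {K : Type*} [Field K]

/-- Graded derivations of a cochain algebra. -/
structure GradedDerivation (A : CochainAlg K) where
  toFun : A.carrier →ₗ[K] A.carrier
  deg : ℕ
  map_mem : ∀ n, ∀ x ∈ A.gr n, toFun x ∈ A.gr (n + deg)
  leibniz : ∀ n, ∀ x ∈ A.gr n, ∀ y,
    toFun (x * y) = toFun x * y + sgn K (deg * n) • (x * toFun y)

variable {A : CochainAlg K}

/-- The differential as a graded derivation. -/
def differential (A : CochainAlg K) : A.GradedDerivation where
  toFun := A.d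
  deg := 1
  map_mem := A.d_mem
  leibniz n x hx y := by
    rw [Nat.cast_one, one_mul, sgn_natCast]; exact A.leibniz n x y hx

namespace GradedDerivation

theorem map_one (φ : A.GradedDerivation) : φ.toFun 1 = 0 := by
  have h := φ.leibniz 0 1 SetLike.GradedOne.one_mem 1
  simpa using h

/-- The action of a graded derivation on letters. -/
def letter (φ : A.GradedDerivation) (a : A.Letter) : A.Letter := a.map φ.toFun φ.map_mem

@[simp] theorem par_letter (φ : A.GradedDerivation) (a : A.Letter) :
    (φ.letter a).par = a.par + φ.deg := Letter.par_map A _ _ a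

/-- The action of a graded derivation in one position. -/
noncomputable def act (φ : A.GradedDerivation) (i : ℕ) : A.Chains →ₗ[K] A.Chains :=
  A.applyAt φ.toFun φ.deg i

theorem act_wd (φ : A.GradedDerivation) (p : List A.Letter) (a : A.Letter) (q : List A.Letter) :
    φ.act p.length (wd (p ++ a :: q)) = sgn K (φ.deg * par p) • wd (p ++ φ.letter a :: q) :=
  A.applyAt_wd _ _ p a _ q rfl

end GradedDerivation

/-- The degree attached to a letter is bookkeeping that the chain forgets. This removes mismatches
such as the degrees of `(a b) c` and `a (b c)`. -/
theorem wd_congr {l l' : List A.Letter} (h : l.map Letter.val = l'.map Letter.val) :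
    wd l = wd l' := by
  have hl : l.length = l'.length := by simpa using congrArg List.length h
  match l, hl with
  | [], hl => rw [List.eq_nil_of_length_eq_zero hl.symm]
  | a :: l, hl =>
    rw [wd_cons_eq A (k := l.length) rfl]
    refine A.wd_eq _ _ (by simpa using hl.symm) fun i => ?_
    have := List.getElem_of_eq h (i := i) (by simp; omega)
    rw [List.getElem_map, List.getElem_map] at this
    exact this

/-- Two summands suffice for every use: the Leibniz rule, eigenvalue equations and vanishing
letters. -/
theorem wd_linear (p q : List A.Letter) (a b c : A.Letter) (r s : K)
    (h : c.val = r • a.val + s • b.val) :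
    wd (p ++ c :: q) = r • wd (p ++ a :: q) + s • wd (p ++ b :: q) := by
  have hl : ∀ a : A.Letter, (p ++ a :: q).length = (p.length + q.length) + 1 := fun a => by
    simp; omega
  have hu : ∀ b : A.Letter, (fun i : Fin (p.length + q.length + 1) =>
      ((p ++ b :: q).get (i.cast (hl b).symm)).val) = Function.update (fun i =>
        ((p ++ a :: q).get (i.cast (hl a).symm)).val) ⟨p.length, by omega⟩ b.val := by
    intro b
    funext i
    simp only [List.get_eq_getElem, Fin.val_cast, Function.update_apply, Fin.ext_iff]
    split_ifs with h1
    · simp [h1]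
    · rcases Nat.lt_or_gt_of_ne h1 with h | h
      · simp [h]
      · obtain ⟨j, hj⟩ : ∃ j, (i : ℕ) = p.length + (j + 1) := ⟨i - p.length - 1, by omega⟩
        simp [hj]
  rw [wd_cons_eq A (hl a), wd_cons_eq A (hl b), wd_cons_eq A (hl c), hu c, hu b, h,
    MultilinearMap.map_update_add, MultilinearMap.map_update_smul, MultilinearMap.map_update_smul,
    ← hu a, map_add, map_smul, map_smul]

theorem wd_eq_zero (p q : List A.Letter) (c : A.Letter) (h : c.val = 0) : wd (p ++ c :: q) = 0 := by
  simpa using wd_linear p q c c c 0 0 (by simpa using h)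

theorem exists_split (l : List A.Letter) (i : ℕ) (h : i < l.length) :
    ∃ p a q, l = p ++ a :: q ∧ p.length = i := by
  refine ⟨l.take i, l[i], l.drop (i + 1), ?_, by simp; omega⟩
  rw [← List.drop_eq_getElem_cons, List.take_append_drop]

theorem exists_split_two (l : List A.Letter) (i : ℕ) (h : i + 1 < l.length) :
    ∃ p a b q, l = p ++ a :: b :: q ∧ p.length = i := by
  obtain ⟨p, a, q, rfl, hp⟩ := exists_split l i (by omega)
  match q with
  | [] => simp at h; omega
  | b :: q => exact ⟨p, a, b, q, rfl, hp⟩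

theorem exists_concat (l : List A.Letter) (h : 0 < l.length) : ∃ p c, l = p ++ [c] :=
  ⟨_, _, (List.dropLast_append_getLast (List.ne_nil_of_length_pos h)).symm⟩

theorem sgn_smul_congr {M : Type*} [AddCommGroup M] [Module K M] {y z : ZMod 2} {u v : M}
    (h : y = z) (h' : u = v) : sgn K y • u = sgn K z • v := by rw [h, h']

theorem neg_eq_sgn {M : Type*} [AddCommGroup M] [Module K M] (u : M) : -u = sgn K 1 • u := by
  simp

theorem rot_mem {n : ℕ} {x : A.Chains} (hx : x ∈ A.wordsOfLength n) :
    A.rot x ∈ A.wordsOfLength n := by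
  refine wordsOfLength_le (fun l hl => ?_) hx
  rcases Nat.eq_zero_or_pos l.length with h | h
  · rw [List.eq_nil_of_length_eq_zero h]
    change A.rot 0 ∈ _
    simp
  · obtain ⟨p, c, rfl⟩ := exists_concat l h
    rw [rot_wd]
    exact Submodule.smul_mem _ _ (wd_mem (by simpa using hl))

theorem rot_pow_mem {n : ℕ} {x : A.Chains} (r : ℕ) (hx : x ∈ A.wordsOfLength n) :
    (A.rot ^ r) x ∈ A.wordsOfLength n := by
  induction r with
  | zero => simpa
  | succ r ih => rw [pow_succ', Module.End.mul_apply]; exact rot_mem ih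

theorem contr_mem {n : ℕ} {x : A.Chains} (j : ℕ) (hx : x ∈ A.wordsOfLength (n + 1)) :
    A.contr j x ∈ A.wordsOfLength n := by
  refine wordsOfLength_le (fun l hl => ?_) hx
  rcases Nat.lt_or_ge (j + 1) l.length with h | h
  · obtain ⟨p, a, b, q, rfl, rfl⟩ := exists_split_two l j h
    rw [contr_wd]
    exact Submodule.smul_mem _ _ (wd_mem (by simp at hl ⊢; omega))
  · rw [contr_wd_of_le A l j h]; exact Submodule.zero_mem _

theorem ins_mem {n : ℕ} {x : A.Chains} (hx : x ∈ A.wordsOfLength (n + 1)) :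
    A.ins x ∈ A.wordsOfLength (n + 2) := by
  refine wordsOfLength_le (fun l hl => ?_) hx
  rw [ins_wd A (by rintro rfl; simp at hl)]
  exact wd_mem (by simpa using hl)

theorem GradedDerivation.act_mem (φ : A.GradedDerivation) {n : ℕ} {x : A.Chains} (i : ℕ)
    (hx : x ∈ A.wordsOfLength n) : φ.act i x ∈ A.wordsOfLength n := by
  refine wordsOfLength_le (fun l hl => ?_) hx
  rcases Nat.lt_or_ge i l.length with h | h
  · obtain ⟨p, a, q, rfl, rfl⟩ := exists_split l i h
    rw [act_wd]
    exact Submodule.smul_mem _ _ (wd_mem (by simpa using hl))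
  · rw [GradedDerivation.act, applyAt_wd_of_le A _ _ l i h]; exact Submodule.zero_mem _

theorem contr_eq_zero {n : ℕ} {x : A.Chains} (j : ℕ) (hx : x ∈ A.wordsOfLength n) (h : n ≤ j + 1) :
    A.contr j x = 0 :=
  eq_on_wordsOfLength (g := 0) (fun l hl => contr_wd_of_le A l j (by omega)) hx

/-- The Koszul signs of the single rotations add up to that of moving the block `q` past `p`: the
letters of `q` cross each other an even number of times. The induction removes the last letter of
`q`, since that is the one `rot` moves. -/
theorem rot_pow_wd (p q : List A.Letter) :
    (A.rot ^ q.length) (wd (p ++ q)) = sgn K (par q * par p) • wd (q ++ p) := by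
  induction q using List.reverseRecOn generalizing p with
  | nil => simp
  | append_singleton q c ih =>
    rw [List.length_append, List.length_singleton, pow_succ, Module.End.mul_apply,
      ← List.append_assoc, rot_wd, map_smul, ← List.cons_append, ih, smul_smul, ← sgn_add]
    refine sgn_smul_congr ?_ (by simp)
    simp only [par_append, par_cons, par_nil]
    -- Here and in the sign checks below, only an identity between exponents in `ZMod 2` is left,
    -- and it is verified on all values.
    generalize par p = x, par q = y, c.par = z
    decide +revert

/-- The whole word moves past an empty block, so the signed cyclic operator has order dividing `n`
with no residual sign. -/
theorem rot_pow_length {n : ℕ} {x : A.Chains} (hx : x ∈ A.wordsOfLength n) :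
    (A.rot ^ n) x = x := by
  refine eq_on_wordsOfLength (g := LinearMap.id) (fun l hl => ?_) hx
  rw [← hl]
  simpa using rot_pow_wd [] l

/-- One of the cyclic relations. The product is shifted by one position; the sign from the moved
letter passing an odd product balances the sign from the product passing that letter. -/
theorem rot_contr {n j : ℕ} (h : j + 2 < n) {x : A.Chains} (hx : x ∈ A.wordsOfLength n) :
    A.rot (A.contr j x) = A.contr (j + 1) (A.rot x) := by
  refine eq_on_wordsOfLength (f := A.rot ∘ₗ A.contr j) (g := A.contr (j + 1) ∘ₗ A.rot)
    (fun l hl => ?_) hx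
  obtain ⟨l, c, rfl⟩ := exists_concat l (by omega)
  obtain ⟨p, a, b, q, rfl, rfl⟩ := exists_split_two l j (by simp at hl; omega)
  rw [LinearMap.comp_apply, LinearMap.comp_apply, rot_wd, List.append_assoc, List.cons_append,
    List.cons_append, contr_wd, map_smul, map_smul, ← List.cons_append, ← List.append_assoc, rot_wd]
  have := contr_wd A (c :: p) a b q
  rw [List.length_cons, List.cons_append] at this
  rw [this, List.cons_append, smul_smul, smul_smul, ← sgn_add, ← sgn_add]
  refine sgn_smul_congr ?_ rfl
  simp only [par_append, par_cons, Letter.par_mul]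
  generalize par p = x, par q = y, c.par = z, a.par = u, b.par = v
  decide +revert

/-- Moving the product `a c` of the last two letters to the front amounts to moving `c`, then `a`,
and multiplying there. -/
theorem rot_contr_last {m : ℕ} {x : A.Chains} (hx : x ∈ A.wordsOfLength (m + 2)) :
    A.rot (A.contr m x) = A.contr 0 (A.rot (A.rot x)) := by
  refine eq_on_wordsOfLength (f := A.rot ∘ₗ A.contr m) (g := A.contr 0 ∘ₗ A.rot ∘ₗ A.rot)
    (fun l hl => ?_) hx
  obtain ⟨p, a, c, q, rfl, rfl⟩ := exists_split_two l m (by omega)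
  obtain rfl : q = [] := by simpa using hl
  have h1 := rot_wd A (p ++ [a]) c
  rw [List.append_assoc, List.singleton_append] at h1
  have h2 := rot_wd A (c :: p) a
  rw [List.cons_append] at h2
  have h3 := contr_wd A [] a c p
  rw [List.length_nil, List.nil_append] at h3
  simp only [LinearMap.comp_apply]
  rw [contr_wd, map_smul, rot_wd, h1, map_smul, h2, map_smul, map_smul, h3]
  simp only [smul_smul, ← sgn_add, List.nil_append]
  refine sgn_smul_congr ?_ rfl
  simp only [par_append, par_cons, Letter.par_mul, par_nil]
  generalize par p = x, c.par = z, a.par = u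
  decide +revert

theorem contr_zero_ins {n : ℕ} {x : A.Chains} (hx : x ∈ A.wordsOfLength (n + 1)) :
    A.contr 0 (A.ins x) = -x := by
  refine eq_on_wordsOfLength (f := A.contr 0 ∘ₗ A.ins) (g := -LinearMap.id) (fun l hl => ?_) hx
  obtain ⟨a, l, rfl⟩ := List.exists_cons_of_length_pos (l := l) (by omega)
  have := contr_wd A [] Letter.one a l
  rw [List.length_nil, List.nil_append] at this
  rw [LinearMap.comp_apply, ins_wd A (by simp), this]
  simp only [par_nil, Letter.par_one, zero_add, sgn_one, List.nil_append,
    LinearMap.neg_apply, LinearMap.id_apply]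
  exact congrArg Neg.neg (wd_congr (by simp [Letter.mul, Letter.one]))

/-- An even linear operator applied to the first letter. -/
theorem contr_zero_applyAt_rot_ins (φ : A.carrier →ₗ[K] A.carrier)
    (hφ : ∀ n, ∀ x ∈ A.gr n, φ x ∈ A.gr n) {n : ℕ} {x : A.Chains}
    (hx : x ∈ A.wordsOfLength (n + 1)) :
    A.contr 0 (A.applyAt φ 0 0 (A.rot (A.ins x))) = A.applyAt φ 0 0 (A.rot x) := by
  refine eq_on_wordsOfLength (f := A.contr 0 ∘ₗ A.applyAt φ 0 0 ∘ₗ A.rot ∘ₗ A.ins)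
    (g := A.applyAt φ 0 0 ∘ₗ A.rot) (fun l hl => ?_) hx
  -- After the rotation the inserted `1` is the second letter, and the product `φ c * 1` removes it.
  -- The case `φ = id` serves the wrap-around term of `b`, the case of a derivation serves `e B`.
  obtain ⟨p, c, rfl⟩ := exists_concat l (by omega)
  have h1 := A.applyAt_wd φ 0 [] c (c.map φ (m := 0) hφ) (Letter.one :: p) rfl
  have h2 := contr_wd A [] (c.map φ (m := 0) hφ) Letter.one p
  have h3 := A.applyAt_wd φ 0 [] c (c.map φ (m := 0) hφ) p rfl
  rw [List.length_nil, List.nil_append] at h1 h2 h3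
  simp only [LinearMap.comp_apply]
  rw [ins_wd A (by simp), ← List.cons_append, rot_wd, rot_wd, map_smul, map_smul, map_smul, h1, h3]
  simp only [List.nil_append] at h2 ⊢
  rw [map_smul, h2]
  simp only [smul_smul, ← sgn_add]
  refine sgn_smul_congr ?_ (wd_congr (by simp [Letter.mul, Letter.one]))
  simp only [par_cons, par_nil, Letter.par_one, Letter.par_map]
  generalize par p = x, c.par = z
  simp only [Nat.cast_zero]
  decide +revert

theorem contr_succ_ins {n j : ℕ} (h : j + 1 < n) {x : A.Chains} (hx : x ∈ A.wordsOfLength n) :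
    A.contr (j + 1) (A.ins x) = -A.ins (A.contr j x) := by
  refine eq_on_wordsOfLength (f := A.contr (j + 1) ∘ₗ A.ins) (g := -(A.ins ∘ₗ A.contr j))
    (fun l hl => ?_) hx
  obtain ⟨p, a, b, q, rfl, rfl⟩ := exists_split_two l j (by omega)
  have := contr_wd A (Letter.one :: p) a b q
  rw [List.length_cons, List.cons_append] at this
  rw [LinearMap.comp_apply, ins_wd A (by simp), this, LinearMap.neg_apply, LinearMap.comp_apply,
    contr_wd, map_smul, ins_wd A (by simp), neg_eq_sgn (K := K), smul_smul, ← sgn_add]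
  rw [List.cons_append, par_cons, Letter.par_one]
  congr 2
  ring

/-- The simplicial identity, with a minus sign because both products are odd. For `i = j` the
products overlap and the reason is associativity; for `i < j` they involve disjoint pairs. -/
theorem contr_contr {n i j : ℕ} (hij : i ≤ j) (h : j + 2 < n) {x : A.Chains}
    (hx : x ∈ A.wordsOfLength n) :
    A.contr i (A.contr (j + 1) x) = -A.contr j (A.contr i x) := by
  refine eq_on_wordsOfLength (f := A.contr i ∘ₗ A.contr (j + 1)) (g := -(A.contr j ∘ₗ A.contr i))
    (fun l hl => ?_) hx
  rw [LinearMap.neg_apply, LinearMap.comp_apply, LinearMap.comp_apply]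
  rcases hij.eq_or_lt with rfl | hij
  · obtain ⟨p, a, q, rfl, rfl⟩ := exists_split l i (by omega)
    obtain ⟨p', b, c, q, rfl, h0⟩ := exists_split_two q 0 (by simp at hl; omega)
    obtain rfl := List.eq_nil_of_length_eq_zero h0
    have h1 := contr_wd A (p ++ [a]) b c q
    simp only [List.length_append, List.length_singleton, List.append_assoc,
      List.singleton_append] at h1
    rw [List.nil_append, h1, contr_wd, map_smul, map_smul, contr_wd, contr_wd,
      neg_eq_sgn (K := K)]
    simp only [smul_smul, ← sgn_add]
    refine sgn_smul_congr ?_ (wd_congr (by simp [Letter.mul, mul_assoc]))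
    simp only [par_append, par_cons, par_nil, Letter.par_mul]
    generalize par p = x, a.par = y, b.par = z
    decide +revert
  · obtain ⟨p, a, b, q, rfl, rfl⟩ := exists_split_two l i (by omega)
    obtain ⟨k, rfl⟩ : ∃ k, j = p.length + 1 + k := ⟨j - p.length - 1, by omega⟩
    obtain ⟨q, c, d, r, rfl, rfl⟩ := exists_split_two q k (by simp at hl; omega)
    have h1 := contr_wd A (p ++ a :: b :: q) c d r
    have h2 := contr_wd A (p ++ a.mul b :: q) c d r
    simp only [List.length_append, List.length_cons, List.append_assoc, List.cons_append] at h1 h2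
    rw [show p.length + 1 + q.length + 1 = p.length + (q.length + 1 + 1) by omega, h1, contr_wd,
      map_smul, map_smul, contr_wd, show p.length + 1 + q.length = p.length + (q.length + 1) by omega,
      h2, neg_eq_sgn (K := K)]
    simp only [smul_smul, ← sgn_add]
    refine sgn_smul_congr ?_ rfl
    simp only [par_append, par_cons, Letter.par_mul]
    generalize par p = x, a.par = y, b.par = z, par q = u, c.par = v
    decide +revert

theorem contr_contr_rot (φ : A.carrier →ₗ[K] A.carrier)
    (hφ : ∀ n, ∀ x ∈ A.gr n, φ x ∈ A.gr n) {n i : ℕ} (h : i + 2 < n) {x : A.Chains}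
    (hx : x ∈ A.wordsOfLength n) :
    A.contr i (A.contr 0 (A.applyAt φ 0 0 (A.rot x))) =
      -A.contr 0 (A.applyAt φ 0 0 (A.rot (A.contr i x))) := by
  refine eq_on_wordsOfLength (f := A.contr i ∘ₗ A.contr 0 ∘ₗ A.applyAt φ 0 0 ∘ₗ A.rot)
    (g := -(A.contr 0 ∘ₗ A.applyAt φ 0 0 ∘ₗ A.rot ∘ₗ A.contr i)) (fun l hl => ?_) hx
  obtain ⟨l, c, rfl⟩ := exists_concat l (by omega)
  obtain ⟨p, a, b, q, rfl, rfl⟩ := exists_split_two l i (by simp at hl; omega)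
  have hat : ∀ q, A.applyAt φ 0 0 (wd (c :: q)) = wd (c.map φ (m := 0) hφ :: q) := fun q => by
    have := A.applyAt_wd φ 0 [] c (c.map φ (m := 0) hφ) q rfl
    simpa using this
  have hc : ∀ (a b : A.Letter) q, A.contr 0 (wd (a :: b :: q)) = sgn K a.par • wd (a.mul b :: q) :=
    fun a b q => by simpa using contr_wd A [] a b q
  have h0 := rot_wd A (p ++ a.mul b :: q) c
  rw [List.append_assoc, List.cons_append] at h0
  simp only [LinearMap.neg_apply, LinearMap.comp_apply]
  rw [rot_wd, map_smul, hat, List.append_assoc, List.cons_append, List.cons_append, contr_wd,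
    map_smul, neg_eq_sgn (K := K)]
  simp only [map_smul, h0, hat]
  -- An empty `p` means `i = 0`: the wrapped letter and the contraction share the letter `a`, and
  -- associativity is needed. Otherwise the two products are disjoint.
  match p with
  | [] =>
    simp only [List.nil_append, List.length_nil, hc, map_smul]
    simp only [smul_smul, ← sgn_add]
    refine sgn_smul_congr ?_ (wd_congr (by simp [Letter.mul, mul_assoc]))
    simp only [par_cons, par_nil, Letter.par_mul, Letter.par_map, Nat.cast_zero]
    generalize a.par = y, b.par = z, par q = u, c.par = v
    decide +revert
  | w :: p =>
    have := contr_wd A ((c.map φ (m := 0) hφ).mul w :: p) a b q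
    simp only [List.length_cons, List.cons_append] at this
    simp only [List.cons_append, List.length_cons, hc, map_smul, this]
    simp only [smul_smul, ← sgn_add]
    refine sgn_smul_congr ?_ rfl
    simp only [par_append, par_cons, Letter.par_mul, Letter.par_map, Nat.cast_zero]
    generalize a.par = y, b.par = z, par q = u, c.par = v, par p = t, w.par = s
    decide +revert

theorem applyAt_id {n i : ℕ} (h : i < n) {x : A.Chains} (hx : x ∈ A.wordsOfLength n) :
    A.applyAt LinearMap.id 0 i x = x := by
  refine eq_on_wordsOfLength (g := LinearMap.id) (fun l hl => ?_) hx
  obtain ⟨p, a, q, rfl, rfl⟩ := exists_split l i (by omega)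
  rw [A.applyAt_wd _ _ p a a q rfl]
  simp

/-- Multiplying the last two letters onto the first, one at a time or jointly, gives `a (c w)` and
`(a c) w`. -/
theorem contr_rot_contr_rot {m : ℕ} {x : A.Chains} (hx : x ∈ A.wordsOfLength (m + 3)) :
    A.contr 0 (A.rot (A.contr 0 (A.rot x))) = -A.contr 0 (A.rot (A.contr (m + 1) x)) := by
  refine eq_on_wordsOfLength (f := A.contr 0 ∘ₗ A.rot ∘ₗ A.contr 0 ∘ₗ A.rot)
    (g := -(A.contr 0 ∘ₗ A.rot ∘ₗ A.contr (m + 1))) (fun l hl => ?_) hx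
  obtain ⟨w, l, rfl⟩ := List.exists_cons_of_length_pos (l := l) (by omega)
  obtain ⟨p, a, c, q, rfl, rfl⟩ := exists_split_two l m (by simp at hl; omega)
  obtain rfl : q = [] := by simpa using hl
  have hc : ∀ (a b : A.Letter) q, A.contr 0 (wd (a :: b :: q)) = sgn K a.par • wd (a.mul b :: q) :=
    fun a b q => by simpa using contr_wd A [] a b q
  have h1 := rot_wd A (w :: p ++ [a]) c
  rw [List.append_assoc, List.singleton_append] at h1
  have h2 := contr_wd A (w :: p) a c []
  have h3 := rot_wd A (w :: p) (a.mul c)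
  have h4 := rot_wd A (c.mul w :: p) a
  simp only [List.length_cons, List.cons_append] at h1 h2 h3 h4
  simp only [LinearMap.neg_apply, LinearMap.comp_apply, map_smul, hc, h1, h2, h3, h4,
    neg_eq_sgn (K := K)]
  simp only [smul_smul, ← sgn_add]
  refine sgn_smul_congr ?_ (wd_congr (by simp [Letter.mul, mul_assoc]))
  simp only [par_append, par_cons, Letter.par_mul, par_nil]
  generalize a.par = y, c.par = v, par p = t, w.par = s
  decide +revert

/-! ### Derivations against rotations, products and insertions. -/

namespace GradedDerivation

variable (φ : A.GradedDerivation)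

/-- The three terms are `a φ(c) w`, `φ(a) c w` and `φ(a c) w`, and the Leibniz rule makes them
cancel with their signs. In the proof of `faces_contraction` the derivation property enters only
through this lemma. -/
theorem contr_rot_leibniz (h0 : φ.deg = 0) {m : ℕ} {x : A.Chains}
    (hx : x ∈ A.wordsOfLength (m + 3)) :
    A.contr 0 (A.rot (A.contr 0 (φ.act 0 (A.rot x)))) +
      A.contr 0 (φ.act 0 (A.rot (A.contr 0 (A.rot x)))) +
      A.contr 0 (φ.act 0 (A.rot (A.contr (m + 1) x))) = 0 := by
  refine eq_on_wordsOfLength (f := A.contr 0 ∘ₗ A.rot ∘ₗ A.contr 0 ∘ₗ φ.act 0 ∘ₗ A.rot +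
    A.contr 0 ∘ₗ φ.act 0 ∘ₗ A.rot ∘ₗ A.contr 0 ∘ₗ A.rot +
    A.contr 0 ∘ₗ φ.act 0 ∘ₗ A.rot ∘ₗ A.contr (m + 1)) (g := 0) (fun l hl => ?_) hx
  obtain ⟨w, l, rfl⟩ := List.exists_cons_of_length_pos (l := l) (by omega)
  obtain ⟨p, a, c, q, rfl, rfl⟩ := exists_split_two l m (by simp at hl; omega)
  obtain rfl : q = [] := by simpa using hl
  have hc : ∀ (a b : A.Letter) q, A.contr 0 (wd (a :: b :: q)) = sgn K a.par • wd (a.mul b :: q) :=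
    fun a b q => by simpa using contr_wd A [] a b q
  have hat : ∀ (c : A.Letter) q, φ.act 0 (wd (c :: q)) = wd (φ.letter c :: q) := fun c q => by
    simpa using φ.act_wd [] c q
  have h1 := rot_wd A (w :: p ++ [a]) c
  rw [List.append_assoc, List.singleton_append] at h1
  have h2 := contr_wd A (w :: p) a c []
  have h3 := rot_wd A (w :: p) (a.mul c)
  have h4 := rot_wd A (c.mul w :: p) a
  have h5 := rot_wd A ((φ.letter c).mul w :: p) a
  simp only [List.length_cons, List.cons_append] at h1 h2 h3 h4 h5
  have key := wd_linear [] p (((φ.letter a).mul c).mul w) ((a.mul (φ.letter c)).mul w)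
    ((φ.letter (a.mul c)).mul w) 1 1 (by
      simp only [Letter.mul, letter, Letter.map]
      rw [φ.leibniz a.deg _ a.mem, h0]; simp [add_mul])
  simp only [List.nil_append, one_smul] at key
  simp only [LinearMap.add_apply, LinearMap.zero_apply, LinearMap.comp_apply, map_smul, hc, hat, h1,
    h2, h3, h4, h5, key]
  rw [wd_congr (l := a.mul ((φ.letter c).mul w) :: p) (l' := (a.mul (φ.letter c)).mul w :: p)
    (by simp [Letter.mul, mul_assoc]), wd_congr (l := (φ.letter a).mul (c.mul w) :: p)
    (l' := ((φ.letter a).mul c).mul w :: p) (by simp [Letter.mul, mul_assoc])]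
  simp only [smul_smul, ← sgn_add, smul_add]
  simp only [par_append, par_cons, Letter.par_mul, par_nil, par_letter, h0, Nat.cast_zero]
  generalize wd (((φ.letter a).mul c).mul w :: p) = U, wd ((a.mul (φ.letter c)).mul w :: p) = V
  generalize a.par = y, c.par = v, par p = t, w.par = s
  generalize h1 : sgn K (_ : ZMod 2) = e1
  generalize h2 : sgn K (_ : ZMod 2) = e2
  generalize h3 : sgn K (_ : ZMod 2) = e3
  have h4 : e1 = -e3 := by
    rw [← h1, ← h3, ← neg_one_mul, ← sgn_one, ← sgn_add]; congr 1; clear h1 h2 h3; decide +revert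
  have h5 : e2 = -e3 := by
    rw [← h2, ← h3, ← neg_one_mul, ← sgn_one, ← sgn_add]; congr 1; clear h1 h2 h3; decide +revert
  rw [h4, h5]
  module

theorem rot_act {n i : ℕ} (h : i + 1 < n) {x : A.Chains} (hx : x ∈ A.wordsOfLength n) :
    A.rot (φ.act i x) = φ.act (i + 1) (A.rot x) := by
  refine eq_on_wordsOfLength (f := A.rot ∘ₗ φ.act i) (g := φ.act (i + 1) ∘ₗ A.rot)
    (fun l hl => ?_) hx
  obtain ⟨l, c, rfl⟩ := exists_concat l (by omega)
  obtain ⟨p, a, q, rfl, rfl⟩ := exists_split l i (by simp at hl; omega)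
  rw [LinearMap.comp_apply, LinearMap.comp_apply, rot_wd, List.append_assoc, List.cons_append,
    act_wd, map_smul, map_smul, ← List.cons_append, ← List.append_assoc, rot_wd]
  have := φ.act_wd (c :: p) a q
  rw [List.length_cons, List.cons_append] at this
  rw [this, List.cons_append, smul_smul, smul_smul, ← sgn_add, ← sgn_add]
  refine sgn_smul_congr ?_ rfl
  simp only [par_append, par_cons, par_letter]
  generalize par p = x, par q = y, c.par = z, a.par = u, (φ.deg : ZMod 2) = v
  decide +revert

theorem rot_act_last {m : ℕ} {x : A.Chains} (hx : x ∈ A.wordsOfLength (m + 1)) :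
    A.rot (φ.act m x) = φ.act 0 (A.rot x) := by
  refine eq_on_wordsOfLength (f := A.rot ∘ₗ φ.act m) (g := φ.act 0 ∘ₗ A.rot)
    (fun l hl => ?_) hx
  obtain ⟨p, c, rfl⟩ := exists_concat l (by omega)
  obtain rfl : p.length = m := by simpa using hl
  have := φ.act_wd [] c p
  rw [List.length_nil, List.nil_append] at this
  rw [LinearMap.comp_apply, LinearMap.comp_apply, rot_wd, act_wd, map_smul, map_smul, rot_wd, this]
  simp only [smul_smul, ← sgn_add, List.nil_append]
  refine sgn_smul_congr ?_ rfl
  simp only [par_nil, par_letter]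
  generalize par p = x, c.par = z, (φ.deg : ZMod 2) = v
  decide +revert

theorem act_zero_ins {n : ℕ} {x : A.Chains} (hx : x ∈ A.wordsOfLength (n + 1)) :
    φ.act 0 (A.ins x) = 0 := by
  refine eq_on_wordsOfLength (f := φ.act 0 ∘ₗ A.ins) (g := 0) (fun l hl => ?_) hx
  have := φ.act_wd [] Letter.one l
  rw [List.length_nil, List.nil_append] at this
  rw [LinearMap.comp_apply, ins_wd A (by rintro rfl; simp at hl), this, wd_eq_zero _ _ _ φ.map_one,
    smul_zero, LinearMap.zero_apply]

theorem act_succ_ins {n i : ℕ} (h : i < n) {x : A.Chains} (hx : x ∈ A.wordsOfLength n) :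
    φ.act (i + 1) (A.ins x) = sgn K φ.deg • A.ins (φ.act i x) := by
  refine eq_on_wordsOfLength (f := φ.act (i + 1) ∘ₗ A.ins)
    (g := sgn K (φ.deg : ZMod 2) • (A.ins ∘ₗ φ.act i)) (fun l hl => ?_) hx
  obtain ⟨p, a, q, rfl, rfl⟩ := exists_split l i (by omega)
  have := φ.act_wd (Letter.one :: p) a q
  rw [List.length_cons, List.cons_append] at this
  rw [LinearMap.comp_apply, ins_wd A (by simp), this, LinearMap.smul_apply, LinearMap.comp_apply,
    act_wd, map_smul, ins_wd A (by simp), smul_smul, ← sgn_add]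
  rw [List.cons_append, par_cons, Letter.par_one]
  congr 2
  ring

theorem act_contr_of_lt {n i j : ℕ} (hij : i < j) (h : j + 1 < n) {x : A.Chains}
    (hx : x ∈ A.wordsOfLength n) :
    φ.act i (A.contr j x) = sgn K φ.deg • A.contr j (φ.act i x) := by
  refine eq_on_wordsOfLength (f := φ.act i ∘ₗ A.contr j)
    (g := sgn K (φ.deg : ZMod 2) • (A.contr j ∘ₗ φ.act i)) (fun l hl => ?_) hx
  obtain ⟨p, a, q, rfl, rfl⟩ := exists_split l i (by omega)
  obtain ⟨k, rfl⟩ : ∃ k, j = p.length + 1 + k := ⟨j - p.length - 1, by omega⟩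
  obtain ⟨q, c, d, r, rfl, rfl⟩ := exists_split_two q k (by simp at hl; omega)
  have h1 := contr_wd A (p ++ a :: q) c d r
  have h2 := contr_wd A (p ++ φ.letter a :: q) c d r
  simp only [List.length_append, List.length_cons, List.append_assoc, List.cons_append] at h1 h2
  rw [LinearMap.comp_apply, LinearMap.smul_apply, LinearMap.comp_apply, act_wd,
    show p.length + 1 + q.length = p.length + (q.length + 1) by omega, h1, map_smul, map_smul, h2,
    act_wd]
  simp only [smul_smul, ← sgn_add]
  refine sgn_smul_congr ?_ rfl
  simp only [par_append, par_cons, par_letter]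
  generalize par p = x, a.par = y, par q = u, c.par = v, (φ.deg : ZMod 2) = w
  decide +revert

theorem act_contr_of_gt {n i j : ℕ} (hij : j < i) (h : i + 1 < n) {x : A.Chains}
    (hx : x ∈ A.wordsOfLength n) :
    φ.act i (A.contr j x) = sgn K φ.deg • A.contr j (φ.act (i + 1) x) := by
  refine eq_on_wordsOfLength (f := φ.act i ∘ₗ A.contr j)
    (g := sgn K (φ.deg : ZMod 2) • (A.contr j ∘ₗ φ.act (i + 1))) (fun l hl => ?_) hx
  obtain ⟨p, a, b, q, rfl, rfl⟩ := exists_split_two l j (by omega)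
  obtain ⟨k, rfl⟩ : ∃ k, i = p.length + 1 + k := ⟨i - p.length - 1, by omega⟩
  obtain ⟨q, c, r, rfl, rfl⟩ := exists_split q k (by simp at hl; omega)
  have h1 := φ.act_wd (p ++ a :: b :: q) c r
  have h2 := φ.act_wd (p ++ a.mul b :: q) c r
  simp only [List.length_append, List.length_cons, List.append_assoc, List.cons_append] at h1 h2
  rw [LinearMap.comp_apply, LinearMap.smul_apply, LinearMap.comp_apply, contr_wd, map_smul,
    show p.length + 1 + q.length = p.length + (q.length + 1) by omega, h2,
    show p.length + (q.length + 1) + 1 = p.length + (q.length + 1 + 1) by omega, h1, map_smul,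
    contr_wd]
  simp only [smul_smul, ← sgn_add]
  refine sgn_smul_congr ?_ rfl
  simp only [par_append, par_cons, Letter.par_mul]
  generalize par p = x, a.par = y, par q = u, b.par = v, (φ.deg : ZMod 2) = w
  decide +revert

/-- The Leibniz rule at the contracted position; away from it a derivation only passes the odd
product. -/
theorem act_contr_self {n j : ℕ} (h : j + 1 < n) {x : A.Chains} (hx : x ∈ A.wordsOfLength n) :
    φ.act j (A.contr j x) =
      sgn K φ.deg • (A.contr j (φ.act j x) + A.contr j (φ.act (j + 1) x)) := by
  refine eq_on_wordsOfLength (f := φ.act j ∘ₗ A.contr j)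
    (g := sgn K (φ.deg : ZMod 2) • (A.contr j ∘ₗ φ.act j + A.contr j ∘ₗ φ.act (j + 1)))
    (fun l hl => ?_) hx
  obtain ⟨p, a, b, q, rfl, rfl⟩ := exists_split_two l j (by omega)
  have h1 := φ.act_wd (p ++ [a]) b q
  simp only [List.length_append, List.length_singleton, List.append_assoc,
    List.singleton_append] at h1
  have key := wd_linear p q ((φ.letter a).mul b) (a.mul (φ.letter b)) (φ.letter (a.mul b)) 1
    (sgn K (φ.deg * (a.par + 1))) (by
      simp only [Letter.mul, letter, Letter.map]
      rw [φ.leibniz a.deg _ a.mem, one_smul, Letter.par, add_assoc,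
        show (1 : ZMod 2) + 1 = 0 by decide, add_zero])
  simp only [LinearMap.comp_apply, LinearMap.smul_apply, LinearMap.add_apply, contr_wd, map_smul,
    act_wd, h1, key, smul_add, one_smul]
  simp only [smul_smul, ← sgn_add]
  refine congrArg₂ _ (sgn_smul_congr ?_ rfl) (sgn_smul_congr ?_ rfl) <;>
  simp only [par_append, par_cons, par_nil, par_letter] <;>
  generalize par p = x, a.par = y, (φ.deg : ZMod 2) = w <;>
  decide +revert

/-- Stated for two derivations so as to cover both `d` against itself and the weight derivation
against `d`. The hypothesis `hc` matters only when both act on the same letter. -/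
theorem act_act (ψ : A.GradedDerivation)
    (hc : ∀ x, φ.toFun (ψ.toFun x) = sgn K (φ.deg * ψ.deg) • ψ.toFun (φ.toFun x)) {n i j : ℕ}
    (hi : i < n) (hj : j < n) {x : A.Chains} (hx : x ∈ A.wordsOfLength n) :
    φ.act i (ψ.act j x) = sgn K (φ.deg * ψ.deg) • ψ.act j (φ.act i x) := by
  have key : ∀ (φ ψ : A.GradedDerivation) (p q r : List A.Letter) (a b : A.Letter),
      φ.act p.length (ψ.act (p.length + 1 + q.length) (wd (p ++ a :: q ++ b :: r))) =
      sgn K (φ.deg * ψ.deg) • ψ.act (p.length + 1 + q.length)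
        (φ.act p.length (wd (p ++ a :: q ++ b :: r))) := by
    intro φ ψ p q r a b
    have h1 := ψ.act_wd (p ++ a :: q) b r
    have h2 := ψ.act_wd (p ++ φ.letter a :: q) b r
    simp only [List.length_append, List.length_cons, List.append_assoc, List.cons_append] at h1 h2
    rw [show p.length + 1 + q.length = p.length + (q.length + 1) by omega, List.append_assoc,
      List.cons_append, h1, map_smul, act_wd, act_wd, map_smul, h2]
    simp only [smul_smul, ← sgn_add]
    refine sgn_smul_congr ?_ rfl
    simp only [par_append, par_cons, par_letter]
    generalize par p = x, a.par = y, par q = u, (φ.deg : ZMod 2) = w, (ψ.deg : ZMod 2) = v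
    decide +revert
  refine eq_on_wordsOfLength (f := φ.act i ∘ₗ ψ.act j)
    (g := sgn K (φ.deg * ψ.deg : ZMod 2) • (ψ.act j ∘ₗ φ.act i)) (fun l hl => ?_) hx
  rw [LinearMap.comp_apply, LinearMap.smul_apply, LinearMap.comp_apply]
  rcases lt_trichotomy i j with hij | rfl | hij
  · obtain ⟨p, a, q, rfl, rfl⟩ := exists_split l i (by omega)
    obtain ⟨k, rfl⟩ : ∃ k, j = p.length + 1 + k := ⟨j - p.length - 1, by omega⟩
    obtain ⟨q, b, r, rfl, rfl⟩ := exists_split q k (by simp at hl; omega)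
    simpa using key φ ψ p q r a b
  · obtain ⟨p, a, q, rfl, rfl⟩ := exists_split l i (by omega)
    rw [act_wd, map_smul, act_wd, act_wd, map_smul, act_wd,
      wd_linear p q (ψ.letter (φ.letter a)) a (φ.letter (ψ.letter a)) (sgn K (φ.deg * ψ.deg)) 0 (by
        simp [letter, Letter.map, hc])]
    simp only [smul_smul, ← sgn_add, zero_smul, add_zero]
    exact sgn_smul_congr (by ring) rfl
  · obtain ⟨p, a, q, rfl, rfl⟩ := exists_split l j (by omega)
    obtain ⟨k, rfl⟩ : ∃ k, i = p.length + 1 + k := ⟨i - p.length - 1, by omega⟩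
    obtain ⟨q, b, r, rfl, rfl⟩ := exists_split q k (by simp at hl; omega)
    have := key ψ φ p q r a b
    simp only [List.append_assoc, List.cons_append] at this
    rw [this, smul_smul, ← sgn_add]
    rw [show ((φ.deg : ZMod 2) * ψ.deg + ψ.deg * φ.deg) = 0 by
      generalize (φ.deg : ZMod 2) = w, (ψ.deg : ZMod 2) = v
      decide +revert, sgn_zero, one_smul]

end GradedDerivation

end CochainAlg

/-! ### The Hochschild differential and Connes' operator in terms of rotations and contractions -/

namespace CochainAlg

variable {K : Type*} [Field K] {A : CochainAlg K}

/-- The sum of the actions of a graded derivation in the first `n` positions. -/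
noncomputable def GradedDerivation.tot (φ : A.GradedDerivation) (n : ℕ) : A.Chains →ₗ[K] A.Chains :=
  ∑ i ∈ Finset.range n, φ.act i

variable (A) in
/-- The sum of the contractions of adjacent letters in cyclic words with `n` letters. -/
noncomputable def faces (n : ℕ) : A.Chains →ₗ[K] A.Chains :=
  ∑ j ∈ Finset.range (n - 1), A.contr j + A.contr 0 ∘ₗ A.rot

variable (A) in
/-- The sum of the rotations of words with `n` letters. -/
noncomputable def norm (n : ℕ) : A.Chains →ₗ[K] A.Chains := ∑ r ∈ Finset.range n, A.rot ^ r

theorem GradedDerivation.tot_apply (φ : A.GradedDerivation) (n : ℕ) (x : A.Chains) :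
    φ.tot n x = ∑ i ∈ Finset.range n, φ.act i x := by simp [tot]

theorem faces_apply (n : ℕ) (x : A.Chains) :
    A.faces n x = ∑ j ∈ Finset.range (n - 1), A.contr j x + A.contr 0 (A.rot x) := by
  simp [faces]

theorem norm_apply (n : ℕ) (x : A.Chains) :
    A.norm n x = ∑ r ∈ Finset.range n, (A.rot ^ r) x := by simp [norm]

theorem wordsOfLength_zero {x : A.Chains} (hx : x ∈ A.wordsOfLength 0) : x = 0 :=
  eq_on_wordsOfLength (f := LinearMap.id) (g := 0) (fun l hl => by
    rw [List.eq_nil_of_length_eq_zero hl]; rfl) hx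

theorem neg_sgn (z : ZMod 2) : -sgn K z = sgn K (z + 1) := by rw [sgn_add, sgn_one]; ring

theorem neg_sgn_smul (z : ZMod 2) (u : A.Chains) : -(sgn K z • u) = sgn K (z + 1) • u := by
  rw [add_comm, sgn_add, mul_smul]; exact neg_eq_sgn _

theorem sgn_differential_smul (u : A.Chains) : sgn K (A.differential.deg : ZMod 2) • u = -u := by
  have : (A.differential.deg : ZMod 2) = 1 := by simp [differential]
  rw [this, neg_eq_sgn (K := K)]

/-- The global minus signs of `b` are absorbed into the suspended parities, and the cyclic term
becomes a rotation followed by the first product. -/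
theorem hochschildB_apply {n : ℕ} {x : A.Chains} (hx : x ∈ A.wordsOfLength n) :
    A.hochschildB x = A.differential.tot n x + A.faces n x := by
  refine eq_on_wordsOfLength (g := A.differential.tot n + A.faces n) (fun l hl => ?_) hx
  rw [LinearMap.add_apply, GradedDerivation.tot_apply, faces_apply]
  match n with
  | 0 =>
    rw [List.eq_nil_of_length_eq_zero hl]
    change A.hochschildB 0 = ∑ i ∈ Finset.range 0, _ + (_ + A.contr 0 (A.rot 0))
    simp
  | n + 1 =>
    have hin : DirectSum.lof K ℕ A.Word n (A.bInner n
        (PiTensorProduct.tprod K fun i => (l.get (i.cast hl.symm)).val)) =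
        ∑ i ∈ Finset.range (n + 1), A.differential.act i (wd l) := by
      rw [Finset.sum_range, bInner, LinearMap.neg_apply, LinearMap.sum_apply, map_neg, map_sum,
        ← Finset.sum_neg_distrib]
      refine Finset.sum_congr rfl fun i _ => ?_
      rw [wd_cons_eq A hl, GradedDerivation.act, applyAt, DirectSum.toModule_lof]
      simp only [i.2, dif_pos, LinearMap.comp_apply]
      rw [signed_tprod A _ _ _ (fun j => Letter.mem _), signed_tprod A _ _ _ (fun j => Letter.mem _),
        map_smul, map_smul, map_smul, map_smul, neg_sgn_smul]
      simp only [differential, Nat.cast_one, one_mul]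
      rfl
    rw [← hin]
    -- On words with one letter `b` has no product terms; accordingly `range (n - 1)` is empty and
    -- `contr 0` vanishes.
    match n with
    | 0 =>
      rw [contr_eq_zero 0 (rot_mem (wd_mem hl)) (by omega), wd_cons_eq A hl, hochschildB,
        DirectSum.toModule_lof]
      simp
    | k + 1 =>
      have h1 : ∀ j : Fin (k + 1), A.contr j (wd l) = -DirectSum.lof K ℕ A.Word k
          (A.mulAt k j (A.signed (k + 1) (fun e => epsBefore e (j.val + 1))
          (PiTensorProduct.tprod K fun i => (l.get (i.cast hl.symm)).val))) := by
        intro j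
        rw [wd_cons_eq A hl, contr, DirectSum.toModule_lof]
        simp only [j.2, dif_pos, LinearMap.comp_apply]
        rw [signed_tprod A _ _ _ (fun j => Letter.mem _),
          signed_tprod A _ _ _ (fun j => Letter.mem _),
          map_smul, map_smul, map_smul, map_smul, neg_sgn_smul]
      have h2 : A.contr 0 (A.rot (wd l)) = DirectSum.lof K ℕ A.Word k
          (A.mulAt k 0 (A.rotate (k + 1) (Fin.last (k + 1)) (A.signed (k + 1) (fun e =>
          (e (Fin.last (k + 1)) - 1) * epsBefore e (k + 1))
          (PiTensorProduct.tprod K fun i => (l.get (i.cast hl.symm)).val)))) := by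
        rw [wd_cons_eq A hl, rot, DirectSum.toModule_lof]
        simp only [LinearMap.comp_apply]
        rw [signed_tprod A _ _ _ (fun j => Letter.mem _),
          signed_tprod A _ _ _ (fun j => Letter.mem _), map_smul, map_smul, map_smul, map_smul,
          map_smul, map_smul, contr, DirectSum.toModule_lof]
        simp only [Nat.zero_lt_succ, dif_pos, LinearMap.comp_apply]
        have h4 := signed_tprod A (k := k + 1) (fun e => epsBefore e (0 + 1) + 1)
          (fun j => (l.get ((j + Fin.last (k + 1)).cast hl.symm)).val)
          (fun j => (l.get ((j + Fin.last (k + 1)).cast hl.symm)).deg) (fun j => Letter.mem _)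
        rw [rotate_tprod, h4, map_smul, map_smul, smul_smul, ← sgn_add]
        -- After the rotation, `contr 0` contributes the parity of the former last letter `c`. Added
        -- to the rotation sign it gives `c.par * (par p + 1)`, which is the sign `(deg w_n - 1)
        -- ε_{n-1}` of the cyclic term.
        have h3 : ∀ e : Fin (k + 2) → ZMod 2, epsBefore e (0 + 1) + 1 = e 0 + 1 := by
          intro e
          have : (Finset.univ.filter fun j : Fin (k + 2) => j.val < 0 + 1) = {0} := by
            ext j
            simp only [Finset.mem_filter, Finset.mem_univ, true_and, Finset.mem_singleton,
              Fin.ext_iff, Fin.val_zero]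
            omega
          rw [epsBefore, this]; simp
        rw [h3, zero_add]
        refine congrArg₂ _ (congrArg _ ?_) rfl
        generalize ((l.get ((Fin.last (k + 1)).cast hl.symm)).deg : ZMod 2) = y,
          epsBefore _ (k + 1) = z
        decide +revert
      rw [Nat.add_sub_cancel, Finset.sum_range, Finset.sum_congr rfl fun j _ => h1 j, h2,
        wd_cons_eq A hl, hochschildB, DirectSum.toModule_lof]
      simp only [LinearMap.add_apply, LinearMap.comp_apply, bOuter, LinearMap.neg_apply,
        LinearMap.sum_apply, map_add, map_neg, map_sum, Finset.sum_neg_distrib]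

theorem norm_eq_sum_succ {n : ℕ} {x : A.Chains} (hx : x ∈ A.wordsOfLength n) :
    A.norm n x = ∑ r ∈ Finset.range n, (A.rot ^ (r + 1)) x := by
  have h := Finset.sum_range_succ' (fun r => (A.rot ^ r) x) n
  rw [Finset.sum_range_succ, rot_pow_length hx, pow_zero, Module.End.one_apply,
    add_left_inj] at h
  rw [norm_apply, h]

/-- The sign `(ε_{i-1} + 1)(ε_k - ε_{i-1})` is the product of the suspended parities of the two
blocks that are exchanged, hence exactly the sign of a power of `rot`. -/
theorem connesB_apply {n : ℕ} {x : A.Chains} (hx : x ∈ A.wordsOfLength n) :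
    A.connesB x = A.ins (A.norm n x) := by
  refine eq_on_wordsOfLength (g := A.ins ∘ₗ A.norm n) (fun l hl => ?_) hx
  rw [LinearMap.comp_apply]
  match n with
  | 0 =>
    rw [List.eq_nil_of_length_eq_zero hl]
    change A.connesB 0 = A.ins (A.norm 0 0)
    simp
  | k + 1 =>
    have h1 : ∀ i : Fin (k + 1), DirectSum.lof K ℕ A.Word k (A.rotate k i (A.signed k (fun e =>
        (epsBefore e i.val + 1) * (epsBefore e (k + 1) - epsBefore e i.val))
        (PiTensorProduct.tprod K fun i => (l.get (i.cast hl.symm)).val))) =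
        (A.rot ^ (k + 1 - i)) (wd l) := by
      intro i
      obtain ⟨p, q, rfl, hp⟩ : ∃ p q, l = p ++ q ∧ p.length = i :=
        ⟨l.take i, l.drop i, (List.take_append_drop _ _).symm, by rw [List.length_take, hl]; omega⟩
      have hq : q.length = k + 1 - i := by
        rw [List.length_append] at hl
        omega
      have h2 := sum_par_get A _ hl i (by omega)
      have h3 := sum_par_get A _ hl (k + 1) le_rfl
      rw [List.take_of_length_le (by omega)] at h3
      rw [← hp, List.take_left, hp] at h2
      rw [← hq, rot_pow_wd, signed_tprod A _ _ _ (fun j => Letter.mem _), map_smul, map_smul,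
        rotate_tprod]
      refine congrArg₂ _ (congrArg _ ?_) (A.wd_eq _ _ (by simp; omega) fun j => ?_)
      · rw [h2, eq_sub_of_add_eq h2, eq_sub_of_add_eq h3, par_append]
        ring
      · simp only [List.get_eq_getElem, Fin.val_cast, Fin.val_add]
        congr 1
        rcases Nat.lt_or_ge j q.length with h | h
        · simp only [Nat.mod_eq_of_lt (show (j + i : ℕ) < k + 1 by omega)]
          rw [List.getElem_append_right (by omega), List.getElem_append_left h]
          congr 1; omega
        · have : (j + i : ℕ) % (k + 1) = j - q.length := by
            rw [show (j + i : ℕ) = (j - q.length) + (k + 1) by omega, Nat.add_mod_right,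
              Nat.mod_eq_of_lt (by omega)]
          simp only [this]
          rw [List.getElem_append_right h, List.getElem_append_left]
    -- The term of index `i` is the rotation by `k + 1 - i`, so the exponents run from `1` to `k +
    -- 1` instead of `0` to `k`; the full rotation is the identity.
    have h2 : A.norm (k + 1) (wd l) = ∑ i : Fin (k + 1), (A.rot ^ (k + 1 - i)) (wd l) := by
      rw [norm_eq_sum_succ (wd_mem hl), ← Finset.sum_range (fun i => (A.rot ^ (k + 1 - i)) (wd l)),
        ← Finset.sum_range_reflect]
      refine Finset.sum_congr rfl fun i hi => ?_
      have := Finset.mem_range.1 hi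
      rw [show k + 1 - 1 - i + 1 = k + 1 - i by omega]
    rw [h2, ← Finset.sum_congr rfl fun i _ => h1 i, wd_cons_eq A hl, connesB,
      DirectSum.toModule_lof, map_sum, LinearMap.comp_apply, connesWord, LinearMap.sum_apply,
      map_sum]
    refine Finset.sum_congr rfl fun i _ => ?_
    rw [ins, DirectSum.toModule_lof]
    rfl

theorem faces_mem {n : ℕ} {x : A.Chains} (hx : x ∈ A.wordsOfLength (n + 1)) :
    A.faces (n + 1) x ∈ A.wordsOfLength n := by
  rw [faces_apply]
  exact Submodule.add_mem _ (Submodule.sum_mem _ fun j _ => contr_mem j hx)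
    (contr_mem 0 (rot_mem hx))

theorem GradedDerivation.tot_mem (φ : A.GradedDerivation) {n : ℕ} (r : ℕ) {x : A.Chains}
    (hx : x ∈ A.wordsOfLength n) : φ.tot r x ∈ A.wordsOfLength n := by
  rw [tot_apply]
  exact Submodule.sum_mem _ fun j _ => φ.act_mem j hx

theorem norm_mem {n : ℕ} (r : ℕ) {x : A.Chains} (hx : x ∈ A.wordsOfLength n) :
    A.norm r x ∈ A.wordsOfLength n := by
  rw [norm_apply]
  exact Submodule.sum_mem _ fun j _ => rot_pow_mem j hx

theorem rot_norm {n : ℕ} {x : A.Chains} (hx : x ∈ A.wordsOfLength n) :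
    A.rot (A.norm n x) = A.norm n x := by
  conv_rhs => rw [norm_eq_sum_succ hx]
  rw [norm_apply, map_sum]
  simp only [pow_succ', Module.End.mul_apply]

/-- Each rotation raises the position of a product by one, and a product at the end reappears at
position `0` of a word rotated once more. After `r` rotations the positions `j ≥ r` come from terms
that have not wrapped, the positions `j ≤ r` from those that have. -/
theorem rot_pow_faces {m r : ℕ} (h : r < m) {x : A.Chains} (hx : x ∈ A.wordsOfLength (m + 1)) :
    (A.rot ^ r) (A.faces (m + 1) x) =
      ∑ j ∈ Finset.range m, (if r ≤ j then A.contr j ((A.rot ^ r) x) else 0) +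
        ∑ j ∈ Finset.range m, (if j ≤ r then A.contr j ((A.rot ^ (r + 1)) x) else 0) := by
  obtain ⟨m, rfl⟩ : ∃ k, m = k + 1 := ⟨m - 1, by omega⟩
  induction r with
  | zero =>
    rw [faces_apply, Finset.sum_range_succ' (fun j => if j ≤ 0 then _ else _)]
    simp
  | succ r ih =>
    have hr := rot_pow_mem r hx
    have hr' := rot_pow_mem (r + 1) hx
    rw [pow_succ', Module.End.mul_apply, ih (by omega), map_add, map_sum, map_sum,
      Finset.sum_range_succ, Finset.sum_range_succ (fun j => A.rot (if j ≤ r then _ else _)),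
      Finset.sum_range_succ', Finset.sum_range_succ' (fun j => if j ≤ r + 1 then _ else _)]
    rw [if_pos (by omega), rot_contr_last hr, if_neg (show ¬ m ≤ r by omega), map_zero, add_zero,
      if_neg (by omega), add_zero, if_pos (Nat.zero_le _)]
    simp only [pow_succ' _ (r + 1), Module.End.mul_apply, Nat.add_le_add_iff_right]
    rw [add_assoc, add_comm (A.contr 0 _)]
    refine congrArg₂ _ (Finset.sum_congr rfl fun j hj => ?_)
      (congrArg₂ _ (Finset.sum_congr rfl fun j hj => ?_) ?_)
    · have := Finset.mem_range.1 hj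
      split_ifs
      · rw [rot_contr (by omega) hr]
      · exact map_zero _
    · have := Finset.mem_range.1 hj
      split_ifs
      · rw [rot_contr (by omega) hr']
      · exact map_zero _
    · rw [pow_succ', Module.End.mul_apply]

/-- A rearrangement of a double sum. -/
theorem sum_rearrange {G : Type*} [AddCommMonoid G] (f : ℕ → ℕ → G) (m : ℕ) :
    ∑ r ∈ Finset.range m, (∑ j ∈ Finset.range m, (if r ≤ j then f j r else 0) +
      ∑ j ∈ Finset.range m, (if j ≤ r then f j (r + 1) else 0)) =
      ∑ j ∈ Finset.range m, ∑ r ∈ Finset.range (m + 1), f j r := by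
  rw [Finset.sum_add_distrib, Finset.sum_comm,
    Finset.sum_comm (f := fun r j => if j ≤ r then f j (r + 1) else 0), ← Finset.sum_add_distrib]
  -- For fixed `j` the first sum covers the rotation exponents up to `j` and the second those from
  -- `j + 1` to `m`.
  refine Finset.sum_congr rfl fun j hj => ?_
  have hj := Finset.mem_range.1 hj
  have h1 : ∑ r ∈ Finset.range (m + 1), (if r ≤ j then f j r else 0) =
      ∑ r ∈ Finset.range m, if r ≤ j then f j r else 0 := by
    rw [Finset.sum_range_succ, if_neg (by omega), add_zero]
  have h2 : ∑ r ∈ Finset.range (m + 1), (if r ≤ j then 0 else f j r) =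
      ∑ r ∈ Finset.range m, if j ≤ r then f j (r + 1) else 0 := by
    rw [Finset.sum_range_succ', if_pos (Nat.zero_le _), add_zero]
    refine Finset.sum_congr rfl fun r _ => ?_
    split_ifs <;> first | rfl | omega
  rw [← h1, ← h2, ← Finset.sum_add_distrib]
  refine Finset.sum_congr rfl fun r _ => ?_
  split_ifs <;> simp

/-- The identity `N b = b' N` of the cyclic bicomplex, where `b'` is the product part of `b` without
its wrap-around term. -/
theorem norm_faces {m : ℕ} {x : A.Chains} (hx : x ∈ A.wordsOfLength (m + 1)) :
    A.norm m (A.faces (m + 1) x) = ∑ j ∈ Finset.range m, A.contr j (A.norm (m + 1) x) := by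
  simp only [norm_apply, map_sum]
  rw [← sum_rearrange (fun j r => A.contr j ((A.rot ^ r) x))]
  exact Finset.sum_congr rfl fun r hr => rot_pow_faces (Finset.mem_range.1 hr) hx

/-- With `s` for insertion of `1` and `t` for `rot`, this is `b s = t - 1 - s b'`: the inserted `1`
is removed by the wrap-around product, giving `t`, and by the first product, giving `-1`. On norms
`t - 1` vanishes. -/
theorem faces_ins {n : ℕ} {x : A.Chains} (hx : x ∈ A.wordsOfLength (n + 1)) :
    A.faces (n + 2) (A.ins x) =
      A.rot x - x - A.ins (∑ j ∈ Finset.range n, A.contr j x) := by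
  have h1 := contr_zero_applyAt_rot_ins LinearMap.id (fun _ _ h => h) hx
  rw [applyAt_id (Nat.succ_pos _) (rot_mem (ins_mem hx)),
    applyAt_id (Nat.succ_pos _) (rot_mem hx)] at h1
  rw [faces_apply, h1, show n + 2 - 1 = n + 1 by omega, Finset.sum_range_succ', contr_zero_ins hx,
    map_sum, Finset.sum_congr rfl fun j hj =>
      contr_succ_ins (by have := Finset.mem_range.1 hj; omega) hx,
    Finset.sum_neg_distrib]
  abel

namespace GradedDerivation

variable (φ : A.GradedDerivation)

theorem rot_tot {n : ℕ} {x : A.Chains} (hx : x ∈ A.wordsOfLength n) :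
    A.rot (φ.tot n x) = φ.tot n (A.rot x) := by
  cases n with
  | zero => simp [tot]
  | succ n =>
    rw [tot_apply, tot_apply, map_sum, Finset.sum_range_succ, Finset.sum_range_succ',
      φ.rot_act_last hx]
    congr 1
    exact Finset.sum_congr rfl fun i hi =>
      φ.rot_act (by have := Finset.mem_range.1 hi; omega) hx

theorem rot_pow_tot {n : ℕ} (r : ℕ) {x : A.Chains} (hx : x ∈ A.wordsOfLength n) :
    (A.rot ^ r) (φ.tot n x) = φ.tot n ((A.rot ^ r) x) := by
  induction r with
  | zero => simp
  | succ r ih =>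
    rw [pow_succ', Module.End.mul_apply, Module.End.mul_apply, ih, φ.rot_tot (rot_pow_mem r hx)]

theorem norm_tot {n : ℕ} (r : ℕ) {x : A.Chains} (hx : x ∈ A.wordsOfLength n) :
    A.norm r (φ.tot n x) = φ.tot n (A.norm r x) := by
  rw [norm_apply, norm_apply, map_sum]
  exact Finset.sum_congr rfl fun i _ => φ.rot_pow_tot i hx

theorem tot_ins {n : ℕ} {x : A.Chains} (hx : x ∈ A.wordsOfLength (n + 1)) :
    φ.tot (n + 2) (A.ins x) = sgn K φ.deg • A.ins (φ.tot (n + 1) x) := by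
  rw [tot_apply, tot_apply, Finset.sum_range_succ', φ.act_zero_ins hx, add_zero, map_sum,
    Finset.smul_sum]
  exact Finset.sum_congr rfl fun i hi => φ.act_succ_ins (Finset.mem_range.1 hi) hx

theorem tot_contr_of_le {n r j : ℕ} (hr : r ≤ j) (h : j + 1 < n) {x : A.Chains}
    (hx : x ∈ A.wordsOfLength n) :
    φ.tot r (A.contr j x) = sgn K φ.deg • A.contr j (φ.tot r x) := by
  rw [tot_apply, tot_apply, map_sum, Finset.smul_sum]
  exact Finset.sum_congr rfl fun i hi =>
    φ.act_contr_of_lt (by have := Finset.mem_range.1 hi; omega) h hx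

theorem tot_contr_of_gt {n r j : ℕ} (hr : j < r) (h : r + 1 ≤ n) {x : A.Chains}
    (hx : x ∈ A.wordsOfLength n) :
    φ.tot r (A.contr j x) = sgn K φ.deg • A.contr j (φ.tot (r + 1) x) := by
  induction r, hr using Nat.le_induction with
  | base =>
    have := φ.tot_contr_of_le le_rfl (show j + 1 < n by omega) hx
    rw [tot_apply, tot_apply] at this
    rw [tot_apply, tot_apply, Finset.sum_range_succ, this, φ.act_contr_self (by omega) hx,
      Finset.sum_range_succ, Finset.sum_range_succ, map_add, map_add, smul_add, smul_add, smul_add,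
      add_assoc]
  | succ r hr ih =>
    have := ih (by omega)
    rw [tot_apply, tot_apply] at this
    rw [tot_apply, tot_apply, Finset.sum_range_succ, this,
      φ.act_contr_of_gt (by omega) (by omega) hx, Finset.sum_range_succ _ (r + 1), map_add, smul_add]

theorem tot_faces {m : ℕ} {x : A.Chains} (hx : x ∈ A.wordsOfLength (m + 1)) :
    φ.tot m (A.faces (m + 1) x) = sgn K φ.deg • A.faces (m + 1) (φ.tot (m + 1) x) := by
  rcases Nat.eq_zero_or_pos m with rfl | hm
  · rw [wordsOfLength_zero (faces_mem hx), wordsOfLength_zero (faces_mem (φ.tot_mem _ hx)),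
      map_zero, smul_zero]
  · rw [faces_apply, faces_apply, map_add, φ.rot_tot hx, φ.tot_contr_of_gt hm le_rfl (rot_mem hx),
      map_sum, smul_add, Finset.smul_sum]
    congr 1
    exact Finset.sum_congr rfl fun j hj => φ.tot_contr_of_gt (Finset.mem_range.1 hj) le_rfl hx

theorem act_tot (ψ : A.GradedDerivation)
    (hc : ∀ x, φ.toFun (ψ.toFun x) = sgn K (φ.deg * ψ.deg) • ψ.toFun (φ.toFun x)) {n i r : ℕ}
    (hi : i < n) (hr : r ≤ n) {x : A.Chains} (hx : x ∈ A.wordsOfLength n) :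
    φ.act i (ψ.tot r x) = sgn K (φ.deg * ψ.deg) • ψ.tot r (φ.act i x) := by
  rw [tot_apply, tot_apply, map_sum, Finset.smul_sum]
  exact Finset.sum_congr rfl fun j hj =>
    φ.act_act ψ hc hi (by have := Finset.mem_range.1 hj; omega) hx

theorem tot_tot (ψ : A.GradedDerivation)
    (hc : ∀ x, φ.toFun (ψ.toFun x) = sgn K (φ.deg * ψ.deg) • ψ.toFun (φ.toFun x)) {n s r : ℕ}
    (hs : s ≤ n) (hr : r ≤ n) {x : A.Chains} (hx : x ∈ A.wordsOfLength n) :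
    φ.tot s (ψ.tot r x) = sgn K (φ.deg * ψ.deg) • ψ.tot r (φ.tot s x) := by
  rw [tot_apply, tot_apply φ, map_sum, Finset.smul_sum]
  exact Finset.sum_congr rfl fun i hi =>
    φ.act_tot ψ hc (by have := Finset.mem_range.1 hi; omega) hr hx

end GradedDerivation

/-! ### The relations `b b = 0` and `b B = -B b`. -/

theorem sum_sum_eq_zero {G : Type*} [AddCommGroup G] (g : ℕ → ℕ → G) (n : ℕ)
    (h : ∀ i j, i ≤ j → j < n → g i (j + 1) = -g j i) :
    ∑ i ∈ Finset.range n, ∑ j ∈ Finset.range (n + 1), g i j = 0 := by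
  induction n with
  | zero => simp
  | succ n ih =>
    simp only [Finset.sum_range_succ _ (n + 1)]
    -- The new row `n` cancels the new column `n + 1`: the pair `(i, n + 1)` is matched with `(n,
    -- i)`.
    rw [Finset.sum_add_distrib, Finset.sum_range_succ,
      ih fun i j hij hj => h i j hij (by omega), Finset.sum_congr rfl fun i hi =>
        h i n (by have := Finset.mem_range.1 hi; omega) (by omega),
      Finset.sum_neg_distrib, zero_add, add_neg_cancel]

/-- Products away from the ends cancel by the simplicial identity. An inner product cancels against
the wrap-around term taken in the other order, and a double wrap-around cancels against wrapping the
product of the last two letters. -/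
theorem faces_faces {m : ℕ} {x : A.Chains} (hx : x ∈ A.wordsOfLength (m + 1)) :
    A.faces m (A.faces (m + 1) x) = 0 := by
  match m with
  | 0 => rw [wordsOfLength_zero (faces_mem hx), map_zero]
  | 1 => exact wordsOfLength_zero (faces_mem (faces_mem hx))
  | k + 2 =>
    have hκ : ∀ i ∈ Finset.range (k + 1), A.contr i (A.contr 0 (A.rot x)) =
        -A.contr 0 (A.rot (A.contr i x)) := by
      intro i hi
      have hi := Finset.mem_range.1 hi
      have := contr_contr_rot LinearMap.id (fun _ _ h => h) (show i + 2 < k + 2 + 1 by omega) hx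
      rwa [applyAt_id (Nat.succ_pos _) (rot_mem hx),
        applyAt_id (Nat.succ_pos _) (rot_mem (contr_mem i hx))] at this
    have h0 := sum_sum_eq_zero (fun i j => A.contr i (A.contr j x)) (k + 1) fun i j hij hj =>
      contr_contr hij (show j + 2 < k + 2 + 1 by omega) hx
    rw [faces_apply, faces_apply, show k + 2 - 1 = k + 1 by omega,
      show k + 2 + 1 - 1 = k + 1 + 1 by omega]
    simp only [map_add, map_sum, Finset.sum_add_distrib]
    rw [h0, contr_rot_contr_rot hx, Finset.sum_congr rfl hκ, Finset.sum_range_succ _ (k + 1),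
      Finset.sum_neg_distrib]
    abel

theorem mul_self_eq_zero_of_neg [CharZero K] {M : Type*} [AddCommGroup M] [Module K M] {x : M}
    (h : x = -x) : x = 0 := by
  have h2 : (2 : K) • x = 0 := by rw [two_smul]; nth_rw 2 [h]; exact add_neg_cancel x
  exact (smul_eq_zero.1 h2).resolve_left two_ne_zero

theorem hochschildB_hochschildB [CharZero K] (x : A.Chains) :
    A.hochschildB (A.hochschildB x) = 0 := by
  suffices h : A.hochschildB ∘ₗ A.hochschildB = 0 from LinearMap.congr_fun h x
  refine chains_ext fun m x hx => ?_
  -- The total action of `d` anticommutes with itself, so its square equals its own negative and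
  -- vanishes in characteristic zero.
  have ht : A.differential.tot (m + 1) (A.differential.tot (m + 1) x) = 0 := by
    refine mul_self_eq_zero_of_neg (K := K) ?_
    have := A.differential.tot_tot A.differential (fun x => by
      simp [differential, A.d_d]) le_rfl le_rfl hx
    have h1 : (A.differential.deg * A.differential.deg : ZMod 2) = A.differential.deg := by
      simp [differential]
    rwa [h1, sgn_differential_smul] at this
  have hf := A.differential.tot_faces hx
  rw [LinearMap.comp_apply, hochschildB_apply hx, map_add, hochschildB_apply (faces_mem hx),
    hochschildB_apply (A.differential.tot_mem _ hx), ht, faces_faces hx, hf,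
    sgn_differential_smul]
  simp

/-- With `B = s N`, it follows from `b s = t - 1 - s b'`, `t N = N` and `b' N = N b`, and the
internal differential anticommutes with `s`. The relation is exact already on unnormalized chains.
-/
theorem hochschildB_connesB (x : A.Chains) :
    A.hochschildB (A.connesB x) = -A.connesB (A.hochschildB x) := by
  suffices h : A.hochschildB ∘ₗ A.connesB = -(A.connesB ∘ₗ A.hochschildB) from
    LinearMap.congr_fun h x
  refine chains_ext fun m x hx => ?_
  have hN := norm_mem (m + 1) hx
  rw [LinearMap.neg_apply, LinearMap.comp_apply, LinearMap.comp_apply, connesB_apply hx,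
    hochschildB_apply (ins_mem hN), hochschildB_apply hx, map_add, connesB_apply (faces_mem hx),
    connesB_apply (A.differential.tot_mem _ hx), A.differential.tot_ins hN, faces_ins hN,
    rot_norm hx, A.differential.norm_tot _ hx, norm_faces hx, map_sum, sgn_differential_smul]
  abel

/-! ### The Cartan homotopy formula -/

namespace GradedDerivation

/-- Contraction by a derivation on Hochschild chains. -/
noncomputable def contraction (φ : A.GradedDerivation) : A.Chains →ₗ[K] A.Chains :=
  A.contr 0 ∘ₗ φ.act 0 ∘ₗ A.rot

/-- The sums over positions and rotations in the second part of the contraction by a derivation. -/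
noncomputable def cyc (φ : A.GradedDerivation) (n : ℕ) : A.Chains →ₗ[K] A.Chains :=
  ∑ r ∈ Finset.range n, φ.tot r ∘ₗ A.rot ^ r

variable (A) in
/-- Assembles operators given on words of each length. -/
noncomputable def byLength (F : ℕ → A.Chains →ₗ[K] A.Chains) : A.Chains →ₗ[K] A.Chains :=
  DirectSum.toModule K ℕ _ fun k => F (k + 1) ∘ₗ DirectSum.lof K ℕ A.Word k

theorem byLength_apply (F : ℕ → A.Chains →ₗ[K] A.Chains) {n : ℕ} {x : A.Chains}
    (hx : x ∈ A.wordsOfLength n) : byLength A F x = F n x := by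
  refine eq_on_wordsOfLength (fun l hl => ?_) hx
  match n, hl with
  | 0, hl =>
    rw [List.eq_nil_of_length_eq_zero hl]
    exact (map_zero _).trans (map_zero _).symm
  | n + 1, hl => rw [wd_cons_eq A hl, byLength, DirectSum.toModule_lof]; rfl

/-- The second part of the contraction by a derivation. -/
noncomputable def cyclicContraction (φ : A.GradedDerivation) : A.Chains →ₗ[K] A.Chains :=
  byLength A fun n => A.ins ∘ₗ φ.cyc n

/-- The Lie derivative on Hochschild chains. -/
noncomputable def lieDerivative (φ : A.GradedDerivation) : A.Chains →ₗ[K] A.Chains :=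
  byLength A φ.tot

variable (φ : A.GradedDerivation)

theorem cyc_apply (n : ℕ) (x : A.Chains) :
    φ.cyc n x = ∑ r ∈ Finset.range n, φ.tot r ((A.rot ^ r) x) := by simp [cyc]

theorem cyc_mem {n : ℕ} (r : ℕ) {x : A.Chains} (hx : x ∈ A.wordsOfLength n) :
    φ.cyc r x ∈ A.wordsOfLength n := by
  rw [cyc_apply]
  exact Submodule.sum_mem _ fun j _ => φ.tot_mem _ (rot_pow_mem j hx)

theorem contraction_mem {n : ℕ} {x : A.Chains} (hx : x ∈ A.wordsOfLength (n + 1)) :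
    φ.contraction x ∈ A.wordsOfLength n := contr_mem 0 (φ.act_mem 0 (rot_mem hx))

theorem act_eq_of_deg_eq_zero (h0 : φ.deg = 0) (i : ℕ) :
    φ.act i = A.applyAt φ.toFun 0 i := by
  rw [act, h0, Nat.cast_zero]

theorem tot_contraction (h0 : φ.deg = 0) (hd : ∀ x, φ.toFun (A.d x) = A.d (φ.toFun x)) {m : ℕ}
    {x : A.Chains} (hx : x ∈ A.wordsOfLength (m + 1)) :
    A.differential.tot m (φ.contraction x) = -φ.contraction (A.differential.tot (m + 1) x) := by
  rcases Nat.eq_zero_or_pos m with rfl | hm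
  · rw [wordsOfLength_zero (φ.contraction_mem hx),
      wordsOfLength_zero (φ.contraction_mem (A.differential.tot_mem _ hx)), map_zero, neg_zero]
  · have h1 := φ.act_tot A.differential (fun x => by simp [h0, differential, hd])
      (Nat.succ_pos m) le_rfl (rot_mem hx)
    rw [h0, Nat.cast_zero, zero_mul, sgn_zero, one_smul] at h1
    simp only [contraction, LinearMap.comp_apply]
    rw [A.differential.rot_tot hx, h1, A.differential.tot_contr_of_gt hm le_rfl
      (φ.act_mem 0 (rot_mem hx)), sgn_differential_smul]

theorem faces_contraction (h0 : φ.deg = 0) {m : ℕ} {x : A.Chains}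
    (hx : x ∈ A.wordsOfLength (m + 1)) :
    A.faces m (φ.contraction x) = -φ.contraction (A.faces (m + 1) x) := by
  match m with
  | 0 =>
    rw [wordsOfLength_zero (φ.contraction_mem hx), wordsOfLength_zero (faces_mem hx), map_zero,
      map_zero, neg_zero]
  | 1 =>
    rw [wordsOfLength_zero (faces_mem (φ.contraction_mem hx)),
      wordsOfLength_zero (φ.contraction_mem (faces_mem hx)), neg_zero]
  | k + 2 =>
    have hφ : ∀ n, ∀ x ∈ A.gr n, φ.toFun x ∈ A.gr n := fun n x hx => by
      simpa [h0] using φ.map_mem n x hx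
    have h1 : ∀ i ∈ Finset.range (k + 1), A.contr i (φ.contraction x) =
        -φ.contraction (A.contr i x) := by
      intro i hi
      have hi := Finset.mem_range.1 hi
      have := contr_contr_rot φ.toFun hφ (show i + 2 < k + 2 + 1 by omega) hx
      rwa [← φ.act_eq_of_deg_eq_zero h0] at this
    have h2 : A.contr 0 (A.rot (φ.contraction x)) + φ.contraction (A.contr 0 (A.rot x)) +
        φ.contraction (A.contr (k + 1) x) = 0 := φ.contr_rot_leibniz h0 hx
    rw [faces_apply, faces_apply, map_add, map_sum, show k + 2 + 1 - 1 = k + 1 + 1 by omega,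
      show k + 2 - 1 = k + 1 by omega, Finset.sum_congr rfl h1, Finset.sum_range_succ _ (k + 1),
      Finset.sum_neg_distrib]
    rw [← sub_eq_zero, ← h2]
    abel

theorem hochschildB_contraction (h0 : φ.deg = 0) (hd : ∀ x, φ.toFun (A.d x) = A.d (φ.toFun x))
    (x : A.Chains) : A.hochschildB (φ.contraction x) = -φ.contraction (A.hochschildB x) := by
  suffices h : A.hochschildB ∘ₗ φ.contraction = -(φ.contraction ∘ₗ A.hochschildB) from
    LinearMap.congr_fun h x
  refine chains_ext fun m x hx => ?_
  rw [LinearMap.neg_apply, LinearMap.comp_apply, LinearMap.comp_apply,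
    hochschildB_apply (φ.contraction_mem hx), hochschildB_apply hx, φ.tot_contraction h0 hd hx,
    φ.faces_contraction h0 hx, map_add]
  abel

/-- The analogue of `N b = b' N` for the partial sums `tot r ∘ rot ^ r`. The defect is the norm of
the contraction, which becomes the term `B e` of the Cartan formula. -/
theorem cyc_faces (h0 : φ.deg = 0) {m : ℕ} {x : A.Chains} (hx : x ∈ A.wordsOfLength (m + 1)) :
    φ.cyc m (A.faces (m + 1) x) + A.norm m (φ.contraction x) =
      ∑ j ∈ Finset.range m, A.contr j (φ.cyc (m + 1) x) := by
  have hle : ∀ r j y, r ≤ j → j < m → y ∈ A.wordsOfLength (m + 1) →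
      φ.tot r (A.contr j y) = A.contr j (φ.tot r y) := fun r j y hr hj hy => by
    simpa [h0] using φ.tot_contr_of_le hr (by omega) hy
  have hgt : ∀ r j y, j < r → r < m → y ∈ A.wordsOfLength (m + 1) →
      φ.tot r (A.contr j y) = A.contr j (φ.tot (r + 1) y) := fun r j y hr hj hy => by
    simpa [h0] using φ.tot_contr_of_gt hr (by omega) hy
  -- Identifies the missing diagonal terms: acting in position `r` and multiplying there, after `r +
  -- 1` rotations, is the contraction rotated `r` times.
  have hrot : ∀ r < m, A.contr r (φ.act r ((A.rot ^ (r + 1)) x)) =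
      (A.rot ^ r) (φ.contraction x) := by
    intro r
    induction r with
    | zero => intro _; simp [contraction]
    | succ r ih =>
      intro hr
      have h1 := rot_pow_mem (r + 1) hx
      rw [pow_succ' _ r, Module.End.mul_apply, ← ih (by omega),
        rot_contr (by omega) (φ.act_mem _ h1), φ.rot_act (by omega) h1, pow_succ' _ (r + 1),
        Module.End.mul_apply]
  simp only [cyc_apply, norm_apply, map_sum]
  rw [← Finset.sum_add_distrib, ← sum_rearrange (fun j r => A.contr j (φ.tot r ((A.rot ^ r) x)))]
  refine Finset.sum_congr rfl fun r hr => ?_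
  have hr := Finset.mem_range.1 hr
  rw [rot_pow_faces hr hx, map_add, map_sum, map_sum, ← hrot r hr, add_assoc]
  congr 1
  · refine Finset.sum_congr rfl fun j hj => ?_
    have hj := Finset.mem_range.1 hj
    split_ifs with h
    · exact hle r j _ h hj (rot_pow_mem _ hx)
    · exact map_zero _
  · have h1 : A.contr r (φ.act r ((A.rot ^ (r + 1)) x)) = ∑ j ∈ Finset.range m,
        if j = r then A.contr r (φ.act r ((A.rot ^ (r + 1)) x)) else 0 := by
      rw [Finset.sum_ite_eq' , if_pos (Finset.mem_range.2 hr)]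
    rw [h1, ← Finset.sum_add_distrib]
    refine Finset.sum_congr rfl fun j hj => ?_
    have hj := Finset.mem_range.1 hj
    have hx' := rot_pow_mem (r + 1) hx
    -- A product at `j < r` merges two of the letters acted on, so the first `r` letters stem from
    -- `r + 1` letters. At `j = r` the derivation has not yet reached the second half of the range
    -- needed, and the diagonal term supplies `act r`.
    rcases lt_trichotomy j r with h | rfl | h
    · rw [if_pos h.le, if_pos h.le, if_neg h.ne, add_zero, hgt r j _ h hr hx']
    · rw [if_pos le_rfl, if_pos rfl, if_pos le_rfl, hle j j _ le_rfl hj hx', ← map_add]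
      rw [tot_apply, tot_apply, Finset.sum_range_succ]
    · rw [if_neg (by omega), if_neg (by omega), if_neg (by omega), map_zero, add_zero]

/-- Rotating `tot r` makes the derivation act in positions `1` to `r`, and the term `act 0`
completes this to `tot (r + 1)`. The sum is then shifted by one index; the boundary term at `r = n`
is the Lie derivative. -/
theorem rot_cyc {n : ℕ} {x : A.Chains} (hx : x ∈ A.wordsOfLength n) :
    A.rot (φ.cyc n x) + φ.act 0 (A.norm n x) = φ.cyc n x + φ.tot n x := by
  have h1 : ∀ r ∈ Finset.range n, A.rot (φ.tot r ((A.rot ^ r) x)) +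
      φ.act 0 ((A.rot ^ (r + 1)) x) = φ.tot (r + 1) ((A.rot ^ (r + 1)) x) := by
    intro r hr
    have hr := Finset.mem_range.1 hr
    rw [tot_apply, tot_apply, map_sum, Finset.sum_range_succ', pow_succ', Module.End.mul_apply]
    congr 1
    exact Finset.sum_congr rfl fun i hi =>
      φ.rot_act (by have := Finset.mem_range.1 hi; omega) (rot_pow_mem r hx)
  have h2 := Finset.sum_range_succ' (fun r => φ.tot r ((A.rot ^ r) x)) n
  have h3 : φ.tot 0 ((A.rot ^ 0) x) = 0 := by simp [tot]
  rw [Finset.sum_range_succ, rot_pow_length hx, h3, add_zero] at h2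
  rw [cyc_apply, h2, norm_eq_sum_succ hx, map_sum, map_sum, ← Finset.sum_add_distrib]
  exact Finset.sum_congr rfl h1

theorem tot_cyc (h0 : φ.deg = 0) (hd : ∀ x, φ.toFun (A.d x) = A.d (φ.toFun x)) {n : ℕ}
    {x : A.Chains} (hx : x ∈ A.wordsOfLength n) :
    φ.cyc n (A.differential.tot n x) = A.differential.tot n (φ.cyc n x) := by
  rw [cyc_apply, cyc_apply, map_sum]
  refine Finset.sum_congr rfl fun r hr => ?_
  have hr := Finset.mem_range.1 hr
  have h1 := φ.tot_tot A.differential (fun x => by simp [h0, differential, hd])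
      hr.le le_rfl (rot_pow_mem r hx)
  rw [h0, Nat.cast_zero, zero_mul, sgn_zero, one_smul] at h1
  rw [A.differential.rot_pow_tot r hx, h1]

/-- The Cartan homotopy formula. -/
theorem cartan (h0 : φ.deg = 0) (hd : ∀ x, φ.toFun (A.d x) = A.d (φ.toFun x)) (x : A.Chains) :
    A.hochschildB (φ.cyclicContraction x) + φ.cyclicContraction (A.hochschildB x) +
      A.connesB (φ.contraction x) + φ.contraction (A.connesB x) = φ.lieDerivative x := by
  suffices h : A.hochschildB ∘ₗ φ.cyclicContraction + φ.cyclicContraction ∘ₗ A.hochschildB +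
      A.connesB ∘ₗ φ.contraction + φ.contraction ∘ₗ A.connesB = φ.lieDerivative from
    LinearMap.congr_fun h x
  refine chains_ext fun m x hx => ?_
  have hφ : ∀ n, ∀ x ∈ A.gr n, φ.toFun x ∈ A.gr n := fun n x hx => by
    simpa [h0] using φ.map_mem n x hx
  have hN := norm_mem (m + 1) hx
  have hX := φ.cyc_mem (m + 1) hx
  -- This computes `e B x` as `act 0` on the norm of `x`. The `t - 1` part of `b s` applied to `cyc`
  -- then combines with it into `L` by `h2`, while `h3` cancels the part `s b'` against `E b` and `B
  -- e`; the internal differential drops out because it commutes with `cyc`.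
  have h1 := contr_zero_applyAt_rot_ins φ.toFun hφ hN
  rw [← φ.act_eq_of_deg_eq_zero h0, rot_norm hx] at h1
  have h1 : φ.contraction (A.ins (A.norm (m + 1) x)) = φ.act 0 (A.norm (m + 1) x) := h1
  have h2 := φ.rot_cyc hx
  have h3 := φ.cyc_faces h0 hx
  simp only [LinearMap.add_apply, LinearMap.comp_apply]
  rw [cyclicContraction, byLength_apply _ hx, LinearMap.comp_apply, hochschildB_apply (ins_mem hX),
    A.differential.tot_ins hX, faces_ins hX, hochschildB_apply hx, map_add,
    byLength_apply _ (faces_mem hx), byLength_apply _ (A.differential.tot_mem _ hx),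
    connesB_apply (φ.contraction_mem hx), connesB_apply hx, h1, LinearMap.comp_apply,
    LinearMap.comp_apply, φ.tot_cyc h0 hd hx, sgn_differential_smul, lieDerivative,
    byLength_apply _ hx, ← h3, map_add]
  rw [← sub_eq_zero] at h2 ⊢
  rw [← h2]
  abel

end GradedDerivation

end CochainAlg

/-! ### Trivial chains and a criterion for exactness -/

namespace CochainAlg

variable {K : Type*} [Field K] {A : CochainAlg K}

theorem wd_mem_trivialChains {p q : List A.Letter} {a : A.Letter} (hp : p ≠ []) (ha : a.val = 1) :
    wd (p ++ a :: q) ∈ A.trivialChains := by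
  have hl : (p ++ a :: q).length = (p.length + q.length) + 1 := by simp; omega
  rw [wd_cons_eq A hl]
  refine Submodule.subset_span (Or.inl ⟨_, _, ⟨⟨p.length, by omega⟩, ?_, ?_⟩, rfl⟩)
  · simpa [Fin.ext_iff] using hp
  · simp [ha]

theorem wd_one_mem_trivialChains : wd [Letter.one] ∈ A.trivialChains := by
  refine Submodule.subset_span (Or.inr (A.wd_eq (k := 0) _ [Letter.one] rfl fun i => ?_).symm)
  obtain rfl := Fin.fin_one_eq_zero i
  rfl

/-- The defining generators have arbitrary letters besides the `1`; splitting those into homogeneous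
components keeps the `1`, so homogeneous words suffice. -/
theorem trivialChains_le {S : Submodule K A.Chains}
    (h : ∀ p q : List A.Letter, p ≠ [] → wd (p ++ Letter.one :: q) ∈ S)
    (h1 : wd [Letter.one] ∈ S) : A.trivialChains ≤ S := by
  refine Submodule.span_le.2 ?_
  rintro _ (⟨k, w, ⟨i, hi, hw⟩, rfl⟩ | rfl)
  · refine word_mem w fun n hn => ?_
    set l : List A.Letter := List.ofFn fun j => (⟨_, n j, SetLike.coe_mem
        (DirectSum.decompose A.gr (w j) (n j))⟩ : A.Letter) with hl
    have hlen : l.length = k + 1 := by simp [hl]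
    rw [A.wd_eq _ l hlen (fun i => by rw [List.get_ofFn]; rfl)]
    obtain ⟨p, a, q, hpq, hp⟩ := exists_split l i (by omega)
    have ha : a.val = 1 := by
      have h2 : l[(i : ℕ)]'(by omega) = a := by
        simp only [hpq]
        simp [← hp]
      rw [← h2]
      simp only [hl, List.getElem_ofFn]
      rw [hw, hn i hw, DirectSum.decompose_of_mem_same _ SetLike.GradedOne.one_mem]
    rw [hpq, wd_congr (l' := p ++ Letter.one :: q) (by simp [ha, Letter.one])]
    refine h p q ?_
    rintro rfl
    exact hi (Fin.ext (by simpa using hp.symm))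
  · rw [A.wd_eq (k := 0) _ [Letter.one] rfl fun i => ?_]
    · exact h1
    · obtain rfl := Fin.fin_one_eq_zero i
      rfl

variable (A) in
/-- The span of the words containing the letter `1`. -/
def unitChains : Submodule K A.Chains :=
  Submodule.span K {x | ∃ p q : List A.Letter, wd (p ++ Letter.one :: q) = x}

theorem wd_mem_unitChains (p q : List A.Letter) : wd (p ++ Letter.one :: q) ∈ A.unitChains :=
  Submodule.subset_span ⟨p, q, rfl⟩

/-- Unlike `trivialChains`, the span `unitChains` is stable under rotation. `B` and the cyclic
contraction take values in it and map it into `trivialChains`, so composites of two of them vanish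
in the reduced complex. -/
theorem trivialChains_le_unitChains : A.trivialChains ≤ A.unitChains :=
  trivialChains_le (fun p q _ => wd_mem_unitChains p q) (wd_mem_unitChains [] [])

theorem unitChains_le {f : A.Chains →ₗ[K] A.Chains} {S : Submodule K A.Chains}
    (h : ∀ p q : List A.Letter, f (wd (p ++ Letter.one :: q)) ∈ S) {x : A.Chains}
    (hx : x ∈ A.unitChains) : f x ∈ S := by
  have : A.unitChains ≤ S.comap f := Submodule.span_le.2 (by rintro _ ⟨p, q, rfl⟩; exact h p q)
  exact this hx

theorem map_mem_of_mem_trivialChains {f : A.Chains →ₗ[K] A.Chains} {S : Submodule K A.Chains}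
    (h : ∀ p q : List A.Letter, p ≠ [] → f (wd (p ++ Letter.one :: q)) ∈ S)
    (h1 : f (wd [Letter.one]) ∈ S) {x : A.Chains} (hx : x ∈ A.trivialChains) : f x ∈ S :=
  trivialChains_le (S := S.comap f) h h1 hx

theorem rot_mem_unitChains {x : A.Chains} (hx : x ∈ A.unitChains) : A.rot x ∈ A.unitChains := by
  refine unitChains_le (fun p q => ?_) hx
  rcases List.eq_nil_or_concat q with rfl | ⟨q, c, rfl⟩
  · rw [rot_wd]
    exact Submodule.smul_mem _ _ (wd_mem_unitChains [] p)
  · have := rot_wd A (p ++ Letter.one :: q) c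
    rw [List.append_assoc, List.cons_append] at this
    rw [List.concat_eq_append, this]
    exact Submodule.smul_mem _ _ (wd_mem_unitChains (c :: p) q)

theorem rot_pow_mem_unitChains (r : ℕ) {x : A.Chains} (hx : x ∈ A.unitChains) :
    (A.rot ^ r) x ∈ A.unitChains := by
  induction r with
  | zero => simpa
  | succ r ih => rw [pow_succ', Module.End.mul_apply]; exact rot_mem_unitChains ih

theorem ins_mem_trivialChains {x : A.Chains} (hx : x ∈ A.unitChains) :
    A.ins x ∈ A.trivialChains := by
  refine unitChains_le (fun p q => ?_) hx
  rw [ins_wd A (by simp)]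
  exact wd_mem_trivialChains (p := Letter.one :: p) (by simp) rfl

/-- A derivation kills `1`, and acting elsewhere leaves the `1` in place. The length of the prefix
is recorded so that a `1` outside the first position stays outside it. -/
theorem GradedDerivation.act_wd_one (φ : A.GradedDerivation) (i : ℕ) (p q : List A.Letter) :
    φ.act i (wd (p ++ Letter.one :: q)) = 0 ∨ ∃ (z : ZMod 2) (p' q' : List A.Letter),
      p'.length = p.length ∧
      φ.act i (wd (p ++ Letter.one :: q)) = sgn K z • wd (p' ++ Letter.one :: q') := by
  rcases lt_trichotomy i p.length with h | rfl | h
  · obtain ⟨p, a, r, rfl, rfl⟩ := exists_split p i h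
    refine Or.inr ⟨φ.deg * par p, p ++ φ.letter a :: r, q, by simp, ?_⟩
    have := φ.act_wd p a (r ++ Letter.one :: q)
    simpa using this
  · refine Or.inl ?_
    rw [act_wd, wd_eq_zero _ _ _ φ.map_one, smul_zero]
  · rcases Nat.lt_or_ge i (p ++ Letter.one :: q).length with h' | h'
    · obtain ⟨k, rfl⟩ : ∃ k, i = p.length + 1 + k := ⟨i - p.length - 1, by omega⟩
      obtain ⟨q, a, r, rfl, rfl⟩ := exists_split q k (by simp at h'; omega)
      refine Or.inr ⟨φ.deg * par (p ++ Letter.one :: q), p, q ++ φ.letter a :: r, rfl, ?_⟩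
      have := φ.act_wd (p ++ Letter.one :: q) a r
      simp only [List.length_append, List.length_cons, List.append_assoc, List.cons_append] at this
      rw [show p.length + 1 + q.length = p.length + (q.length + 1) by omega, this]
    · exact Or.inl (A.applyAt_wd_of_le _ _ _ _ h')

namespace GradedDerivation

variable (φ : A.GradedDerivation)

theorem act_mem_unitChains (i : ℕ) {x : A.Chains} (hx : x ∈ A.unitChains) :
    φ.act i x ∈ A.unitChains := by
  refine unitChains_le (fun p q => ?_) hx
  rcases φ.act_wd_one i p q with h | ⟨z, p', q', -, h⟩
  · rw [h]; exact Submodule.zero_mem _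
  · rw [h]; exact Submodule.smul_mem _ _ (wd_mem_unitChains _ _)

theorem act_mem_trivialChains (i : ℕ) {x : A.Chains} (hx : x ∈ A.trivialChains) :
    φ.act i x ∈ A.trivialChains := by
  refine map_mem_of_mem_trivialChains (fun p q hp => ?_) ?_ hx
  · rcases φ.act_wd_one i p q with h | ⟨z, p', q', hl, h⟩
    · rw [h]; exact Submodule.zero_mem _
    · rw [h]
      refine Submodule.smul_mem _ _ (wd_mem_trivialChains ?_ rfl)
      rintro rfl
      exact hp (List.eq_nil_of_length_eq_zero hl.symm)
  · cases i with
    | zero =>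
      have := φ.act_wd [] Letter.one []
      rw [List.length_nil, List.nil_append] at this
      rw [this, wd_eq_zero _ _ _ φ.map_one, smul_zero]
      exact Submodule.zero_mem _
    | succ i =>
      rw [act, A.applyAt_wd_of_le _ _ _ _ (by simp)]
      exact Submodule.zero_mem _

theorem tot_mem_unitChains (r : ℕ) {x : A.Chains} (hx : x ∈ A.unitChains) :
    φ.tot r x ∈ A.unitChains := by
  rw [tot_apply]
  exact Submodule.sum_mem _ fun i _ => φ.act_mem_unitChains i hx

theorem tot_mem_trivialChains (r : ℕ) {x : A.Chains} (hx : x ∈ A.trivialChains) :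
    φ.tot r x ∈ A.trivialChains := by
  rw [tot_apply]
  exact Submodule.sum_mem _ fun i _ => φ.act_mem_trivialChains i hx

theorem lieDerivative_mem_trivialChains {x : A.Chains} (hx : x ∈ A.trivialChains) :
    φ.lieDerivative x ∈ A.trivialChains := by
  refine map_mem_of_mem_trivialChains (fun p q hp => ?_) ?_ hx
  · rw [lieDerivative, byLength_apply _ (wd_mem rfl)]
    exact φ.tot_mem_trivialChains _ (wd_mem_trivialChains hp rfl)
  · rw [lieDerivative, byLength_apply _ (wd_mem rfl)]
    exact φ.tot_mem_trivialChains _ wd_one_mem_trivialChains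

theorem cyclicContraction_mem_trivialChains {x : A.Chains} (hx : x ∈ A.unitChains) :
    φ.cyclicContraction x ∈ A.trivialChains := by
  refine unitChains_le (fun p q => ?_) hx
  rw [cyclicContraction, byLength_apply _ (wd_mem rfl), LinearMap.comp_apply, cyc_apply]
  exact ins_mem_trivialChains (Submodule.sum_mem _ fun r _ =>
    φ.tot_mem_unitChains _ (rot_pow_mem_unitChains r (wd_mem_unitChains p q)))

theorem cyclicContraction_mem_unitChains (x : A.Chains) :
    φ.cyclicContraction x ∈ A.unitChains := by
  have h : (⊤ : Submodule K A.Chains) ≤ A.unitChains.comap φ.cyclicContraction := by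
    rw [← iSup_wordsOfLength]
    refine iSup_le fun n x hx => ?_
    rw [Submodule.mem_comap, cyclicContraction, byLength_apply _ hx, LinearMap.comp_apply]
    refine wordsOfLength_le (fun l hl => ?_) (φ.cyc_mem (n + 1) hx)
    rw [ins_wd A (by rintro rfl; simp at hl)]
    exact wd_mem_unitChains [] l
  exact h trivial

/-- A final `1` is moved to the front and killed by the derivation. Any other `1` off the first
position keeps its position, because one letter is added in front and one product is taken there. -/
theorem contraction_mem_trivialChains {x : A.Chains} (hx : x ∈ A.trivialChains) :
    φ.contraction x ∈ A.trivialChains := by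
  have hat : ∀ (c : A.Letter) q, φ.act 0 (wd (c :: q)) = wd (φ.letter c :: q) := fun c q => by
    simpa using φ.act_wd [] c q
  refine map_mem_of_mem_trivialChains (fun p q hp => ?_) ?_ hx
  · obtain ⟨a, p, rfl⟩ := List.exists_cons_of_ne_nil hp
    rcases List.eq_nil_or_concat q with rfl | ⟨q, c, rfl⟩
    · have h1 := wd_eq_zero [] (a :: p) (φ.letter Letter.one) φ.map_one
      rw [List.nil_append] at h1
      simp only [contraction, LinearMap.comp_apply]
      rw [rot_wd, map_smul, hat, h1, smul_zero, map_zero]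
      exact Submodule.zero_mem _
    · have h1 := rot_wd A (a :: p ++ Letter.one :: q) c
      have h2 := contr_wd A [] (φ.letter c) a (p ++ Letter.one :: q)
      rw [List.append_assoc, List.cons_append] at h1
      simp only [List.nil_append, List.length_nil, List.cons_append] at h1 h2
      simp only [contraction, LinearMap.comp_apply]
      rw [List.concat_eq_append, List.cons_append, h1, map_smul, hat, map_smul, h2]
      exact Submodule.smul_mem _ _ (Submodule.smul_mem _ _
        (wd_mem_trivialChains (p := (φ.letter c).mul a :: p) (by simp) rfl))
  · rw [wordsOfLength_zero (φ.contraction_mem (wd_mem (l := [Letter.one]) rfl))]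
    exact Submodule.zero_mem _

end GradedDerivation

theorem connesB_mem_trivialChains {x : A.Chains} (hx : x ∈ A.unitChains) :
    A.connesB x ∈ A.trivialChains := by
  refine unitChains_le (fun p q => ?_) hx
  rw [connesB_apply (wd_mem rfl), norm_apply]
  exact ins_mem_trivialChains (Submodule.sum_mem _ fun r _ =>
    rot_pow_mem_unitChains r (wd_mem_unitChains p q))

theorem connesB_mem_unitChains (x : A.Chains) : A.connesB x ∈ A.unitChains := by
  have h : (⊤ : Submodule K A.Chains) ≤ A.unitChains.comap A.connesB := by
    rw [← iSup_wordsOfLength]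
    refine iSup_le fun n x hx => ?_
    rw [Submodule.mem_comap, connesB_apply hx]
    refine wordsOfLength_le (fun l hl => ?_) (norm_mem (n + 1) hx)
    rw [ins_wd A (by rintro rfl; simp at hl)]
    exact wd_mem_unitChains [] l
  exact h trivial

/-! ### Stability of the trivial chains under `b`. -/

theorem contr_wd_one_add_contr_wd_one (p : List A.Letter) (a b : A.Letter) (q : List A.Letter) :
    A.contr p.length (wd (p ++ a :: Letter.one :: b :: q)) +
      A.contr (p.length + 1) (wd (p ++ a :: Letter.one :: b :: q)) = 0 := by
  have h1 := contr_wd A (p ++ [a]) Letter.one b q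
  simp only [List.length_append, List.length_singleton, List.append_assoc,
    List.singleton_append] at h1
  rw [contr_wd, h1, wd_congr (l := p ++ a.mul Letter.one :: b :: q) (l' := p ++ a :: b :: q)
    (by simp [Letter.mul, Letter.one]), wd_congr (l := p ++ a :: (Letter.one : A.Letter).mul b :: q)
    (l' := p ++ a :: b :: q) (by simp [Letter.mul, Letter.one]), Letter.par_one, ← neg_sgn_smul]
  simp only [par_append, par_cons, par_nil, add_zero]
  exact add_neg_cancel _

theorem contr_wd_one_add_contr_rot_wd_one (p : List A.Letter) (a : A.Letter) :
    A.contr p.length (wd (p ++ [a, Letter.one])) + A.contr 0 (A.rot (wd (p ++ [a, Letter.one]))) =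
      0 := by
  have h1 := rot_wd A (p ++ [a]) Letter.one
  simp only [List.append_assoc, List.singleton_append, Letter.par_one, one_mul] at h1
  obtain ⟨c, r, hr⟩ : ∃ c r, p ++ [a] = c :: r := List.exists_cons_of_ne_nil (by simp)
  have h2 := contr_wd A [] Letter.one c r
  simp only [List.nil_append, List.length_nil] at h2
  rw [contr_wd, h1, hr, map_smul, h2, wd_congr (l := p ++ [a.mul Letter.one]) (l' := p ++ [a])
    (by simp [Letter.mul, Letter.one]), wd_congr (l := (Letter.one : A.Letter).mul c :: r)
    (l' := c :: r) (by simp [Letter.mul, Letter.one]), ← hr, smul_smul, ← sgn_add, par_nil,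
    zero_add, Letter.par_one, ← neg_sgn_smul]
  simp only [par_append, par_cons, par_nil, add_zero]
  exact add_neg_cancel _

theorem contr_mem_trivialChains_of_lt {p q : List A.Letter} {j : ℕ} (h : j + 1 < p.length) :
    A.contr j (wd (p ++ Letter.one :: q)) ∈ A.trivialChains := by
  obtain ⟨p, a, b, r, rfl, rfl⟩ := exists_split_two p j h
  have := contr_wd A p a b (r ++ Letter.one :: q)
  rw [List.append_assoc, List.cons_append, List.cons_append, this]
  have h1 := wd_mem_trivialChains (p := p ++ a.mul b :: r) (q := q) (a := Letter.one) (by simp) rfl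
  rw [List.append_assoc, List.cons_append] at h1
  exact Submodule.smul_mem _ _ h1

theorem contr_mem_trivialChains_of_gt {p q : List A.Letter} {j : ℕ} (hp : p ≠ [])
    (h : p.length < j) :
    A.contr j (wd (p ++ Letter.one :: q)) ∈ A.trivialChains := by
  rcases Nat.lt_or_ge (j + 1) (p ++ Letter.one :: q).length with h' | h'
  · obtain ⟨k, rfl⟩ : ∃ k, j = p.length + 1 + k := ⟨j - p.length - 1, by omega⟩
    obtain ⟨q, a, b, r, rfl, rfl⟩ := exists_split_two q k (by simp at h'; omega)
    have := contr_wd A (p ++ Letter.one :: q) a b r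
    simp only [List.length_append, List.length_cons, List.append_assoc, List.cons_append] at this
    rw [show p.length + 1 + q.length = p.length + (q.length + 1) by omega, this]
    exact Submodule.smul_mem _ _ (wd_mem_trivialChains hp rfl)
  · rw [contr_wd_of_le A _ _ h']; exact Submodule.zero_mem _

/-- Only the two products involving the `1` can remove it. They yield the same word with opposite
signs; for a final `1` the second of them is the wrap-around product. -/
theorem faces_wd_one_mem {p q : List A.Letter} (hp : p ≠ []) :
    A.faces (p ++ Letter.one :: q).length (wd (p ++ Letter.one :: q)) ∈ A.trivialChains := by
  obtain ⟨p, a, rfl⟩ := exists_concat p (List.length_pos_of_ne_nil hp)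
  rw [faces_apply]
  have hlt : ∀ j ∈ Finset.range p.length,
      A.contr j (wd (p ++ [a] ++ Letter.one :: q)) ∈ A.trivialChains := fun j hj =>
    contr_mem_trivialChains_of_lt (by have := Finset.mem_range.1 hj; simp; omega)
  match q with
  | [] =>
    rw [show (p ++ [a] ++ [(Letter.one : A.Letter)]).length - 1 = p.length + 1 by simp,
      Finset.sum_range_succ, add_assoc]
    refine Submodule.add_mem _ (Submodule.sum_mem _ hlt) ?_
    have := contr_wd_one_add_contr_rot_wd_one p a
    simp only [List.append_assoc, List.singleton_append]
    rw [this]; exact Submodule.zero_mem _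
  | b :: q =>
    refine Submodule.add_mem _ ?_ ?_
    · rw [show (p ++ [a] ++ Letter.one :: b :: q).length - 1 = (p.length + 1 + 1) + q.length by
        simp; omega, Finset.sum_range_add, Finset.sum_range_succ, Finset.sum_range_succ,
        add_assoc (∑ j ∈ Finset.range p.length, _)]
      refine Submodule.add_mem _ (Submodule.add_mem _ (Submodule.sum_mem _ hlt) ?_)
        (Submodule.sum_mem _ fun j _ => contr_mem_trivialChains_of_gt hp (by simp; omega))
      have := contr_wd_one_add_contr_wd_one p a b q
      simp only [List.append_assoc, List.singleton_append]
      rw [this]; exact Submodule.zero_mem _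
    · obtain ⟨q', c, hq⟩ := exists_concat (b :: q) (by simp)
      obtain ⟨d, r, hr⟩ : ∃ d r, p ++ [a] = d :: r := List.exists_cons_of_ne_nil (by simp)
      have h1 := rot_wd A (d :: r ++ Letter.one :: q') c
      have h2 := contr_wd A [] c d (r ++ Letter.one :: q')
      rw [List.append_assoc, List.cons_append, List.cons_append] at h1
      simp only [List.nil_append, List.length_nil] at h2
      rw [hq, hr, List.cons_append, h1, map_smul, List.cons_append, h2]
      exact Submodule.smul_mem _ _ (Submodule.smul_mem _ _
        (wd_mem_trivialChains (p := c.mul d :: r) (by simp) rfl))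

theorem hochschildB_mem_trivialChains {x : A.Chains} (hx : x ∈ A.trivialChains) :
    A.hochschildB x ∈ A.trivialChains := by
  refine map_mem_of_mem_trivialChains (fun p q hp => ?_) ?_ hx
  · rw [hochschildB_apply (wd_mem rfl)]
    exact Submodule.add_mem _ (A.differential.tot_mem_trivialChains _ (wd_mem_trivialChains hp rfl))
      (faces_wd_one_mem hp)
  · rw [hochschildB_apply (wd_mem rfl)]
    have : A.faces [(Letter.one : A.Letter)].length (wd [Letter.one]) = 0 :=
      wordsOfLength_zero (faces_mem (wd_mem rfl))
    rw [this, add_zero]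
    exact A.differential.tot_mem_trivialChains _ wd_one_mem_trivialChains

theorem connesB_connesB (x : A.Chains) : A.connesB (A.connesB x) ∈ A.trivialChains :=
  connesB_mem_trivialChains (connesB_mem_unitChains x)

/-! ### Exactness in terms of cycles and boundaries. -/

theorem mem_redCycles {x : A.Chains} : x ∈ A.redCycles ↔ A.hochschildB x ∈ A.trivialChains :=
  Iff.rfl

theorem mem_redBoundaries {x : A.Chains} :
    x ∈ A.redBoundaries ↔ ∃ z, x - A.hochschildB z ∈ A.trivialChains := by
  rw [redBoundaries, Submodule.mem_sup]
  constructor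
  · rintro ⟨_, ⟨z, rfl⟩, t, ht, rfl⟩
    exact ⟨z, by simpa using ht⟩
  · rintro ⟨z, hz⟩
    exact ⟨_, ⟨z, rfl⟩, _, hz, by abel⟩

theorem trivialChains_le_redBoundaries : A.trivialChains ≤ A.redBoundaries := le_sup_right

theorem hochschildB_mem_redBoundaries (x : A.Chains) : A.hochschildB x ∈ A.redBoundaries :=
  Submodule.mem_sup_left ⟨x, rfl⟩

theorem connesB_mem_redCycles {x : A.Chains} (hx : x ∈ A.redCycles) :
    A.connesB x ∈ A.redCycles := by
  rw [mem_redCycles, hochschildB_connesB]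
  exact Submodule.neg_mem _ (connesB_mem_trivialChains (trivialChains_le_unitChains hx))

/-- Only the inclusion of the kernel in the image has content: the other one holds since `B B` takes
values in the trivial chains. -/
theorem isBVExact_iff : A.IsBVExact ↔ ∀ x ∈ A.redCycles, A.connesB x ∈ A.redBoundaries →
    ∃ y ∈ A.redCycles, x - A.connesB y ∈ A.redBoundaries := by
  constructor
  · intro h x hx hBx
    have h1 : A.redBoundaries.mkQ x ∈ A.kerRedB := ⟨x, ⟨hx, hBx⟩, rfl⟩
    rw [← show A.rangeRedB = A.kerRedB from h] at h1
    obtain ⟨_, ⟨y, hy, rfl⟩, h2⟩ := h1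
    refine ⟨y, hy, ?_⟩
    rw [← Submodule.Quotient.mk_eq_zero, Submodule.Quotient.mk_sub, sub_eq_zero]
    exact h2.symm
  · intro h
    refine le_antisymm ?_ ?_
    · rintro _ ⟨_, ⟨y, hy, rfl⟩, rfl⟩
      exact ⟨_, ⟨connesB_mem_redCycles hy,
        trivialChains_le_redBoundaries (connesB_connesB y)⟩, rfl⟩
    · rintro _ ⟨x, ⟨hx, hBx⟩, rfl⟩
      obtain ⟨y, hy, hxy⟩ := h x hx hBx
      refine ⟨_, ⟨y, hy, rfl⟩, ?_⟩
      rw [← Submodule.Quotient.mk_eq_zero, Submodule.Quotient.mk_sub, sub_eq_zero] at hxy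
      exact hxy.symm

/-! ### Diagonalizable derivations -/

namespace GradedDerivation

variable (φ : A.GradedDerivation)

/-- Formal from the Cartan formula: after commuting `b` through each of its terms, only relations
already known remain. -/
theorem hochschildB_lieDerivative [CharZero K] (h0 : φ.deg = 0)
    (hd : ∀ x, φ.toFun (A.d x) = A.d (φ.toFun x)) (x : A.Chains) :
    A.hochschildB (φ.lieDerivative x) = φ.lieDerivative (A.hochschildB x) := by
  rw [← φ.cartan h0 hd x, ← φ.cartan h0 hd (A.hochschildB x)]
  simp only [map_add, hochschildB_hochschildB, hochschildB_connesB, φ.hochschildB_contraction h0 hd,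
    map_zero, map_neg, zero_add, add_zero, neg_neg]

/-- Also formal from the Cartan formula, where `B e B` cancels. The remaining terms contain two
operators that insert a `1`, so the commutation holds modulo trivial chains. -/
theorem connesB_lieDerivative (h0 : φ.deg = 0)
    (hd : ∀ x, φ.toFun (A.d x) = A.d (φ.toFun x)) (x : A.Chains) :
    A.connesB (φ.lieDerivative x) - φ.lieDerivative (A.connesB x) ∈ A.trivialChains := by
  rw [← φ.cartan h0 hd x, ← φ.cartan h0 hd (A.connesB x)]
  have h1 : A.connesB (A.hochschildB (φ.cyclicContraction x)) ∈ A.trivialChains := by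
    rw [← neg_neg (A.connesB _), ← hochschildB_connesB]
    exact Submodule.neg_mem _ (hochschildB_mem_trivialChains
      (connesB_mem_trivialChains (φ.cyclicContraction_mem_unitChains x)))
  have h2 : A.connesB (φ.cyclicContraction (A.hochschildB x)) ∈ A.trivialChains :=
    connesB_mem_trivialChains (φ.cyclicContraction_mem_unitChains _)
  have h3 := connesB_connesB (φ.contraction x)
  have h4 : A.hochschildB (φ.cyclicContraction (A.connesB x)) ∈ A.trivialChains :=
    hochschildB_mem_trivialChains (φ.cyclicContraction_mem_trivialChains (connesB_mem_unitChains x))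
  have h5 : φ.cyclicContraction (A.hochschildB (A.connesB x)) ∈ A.trivialChains := by
    rw [hochschildB_connesB, map_neg]
    exact Submodule.neg_mem _ (φ.cyclicContraction_mem_trivialChains (connesB_mem_unitChains _))
  have h6 := φ.contraction_mem_trivialChains (connesB_connesB x)
  have key := Submodule.sub_mem _ (Submodule.add_mem _ (Submodule.add_mem _ h1 h2) h3)
    (Submodule.add_mem _ (Submodule.add_mem _ h4 h5) h6)
  convert key using 1
  simp only [map_add]
  abel

/-- A cochain algebra with a derivation of degree `0` commuting with the differential, whose action
on reduced Hochschild chains is diagonalizable with nonzero eigenvalues, is BV exact. -/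
theorem isBVExact [CharZero K] (h0 : φ.deg = 0) (hd : ∀ x, φ.toFun (A.d x) = A.d (φ.toFun x))
    (h : A.trivialChains ⊔ ⨆ μ : {μ : K // μ ≠ 0}, Module.End.eigenspace φ.lieDerivative μ = ⊤) :
    A.IsBVExact := by
  rw [isBVExact_iff]
  -- `Z` represents the kernel of `B` and `Y` the image of `B`, each at the level of chains. The
  -- Cartan formula shows that `L` maps `Z` into `Z` and even into `Y`.
  let Z : Submodule K A.Chains := A.redCycles ⊓ A.redBoundaries.comap A.connesB
  let Y : Submodule K A.Chains := A.redCycles.map A.connesB ⊔ A.redBoundaries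
  have hLb := φ.hochschildB_lieDerivative h0 hd
  have hZ : ∀ x ∈ Z, φ.lieDerivative x ∈ Z := by
    rintro x ⟨hx, hBx⟩
    refine Submodule.mem_inf.2 ⟨?_, ?_⟩
    · rw [mem_redCycles, hLb]
      exact φ.lieDerivative_mem_trivialChains hx
    · obtain ⟨z, hz⟩ := mem_redBoundaries.1 hBx
      refine mem_redBoundaries.2 ⟨φ.lieDerivative z, ?_⟩
      rw [hLb, ← sub_add_sub_cancel _ (φ.lieDerivative (A.connesB x)), ← map_sub]
      exact Submodule.add_mem _ (φ.connesB_lieDerivative h0 hd x)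
        (φ.lieDerivative_mem_trivialChains hz)
  have hY : ∀ x ∈ Z, φ.lieDerivative x ∈ Y := by
    rintro x ⟨hx, hBx⟩
    obtain ⟨z, hz⟩ := mem_redBoundaries.1 hBx
    have h1 : φ.contraction (A.connesB x) ∈ A.redBoundaries := by
      rw [← sub_add_cancel (A.connesB x) (A.hochschildB z), map_add]
      refine Submodule.add_mem _
        (trivialChains_le_redBoundaries (φ.contraction_mem_trivialChains hz)) ?_
      rw [← neg_neg (φ.contraction _), ← φ.hochschildB_contraction h0 hd]
      exact Submodule.neg_mem _ (hochschildB_mem_redBoundaries _)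
    have h2 : φ.contraction x ∈ A.redCycles := by
      rw [mem_redCycles, φ.hochschildB_contraction h0 hd]
      exact Submodule.neg_mem _ (φ.contraction_mem_trivialChains hx)
    rw [← φ.cartan h0 hd x]
    refine Submodule.add_mem _ (Submodule.add_mem _ (Submodule.add_mem _ ?_ ?_) ?_)
      (Submodule.mem_sup_right h1)
    · exact Submodule.mem_sup_right (hochschildB_mem_redBoundaries _)
    · exact Submodule.mem_sup_right (trivialChains_le_redBoundaries
        (φ.cyclicContraction_mem_trivialChains (trivialChains_le_unitChains hx)))
    · exact Submodule.mem_sup_left ⟨_, h2, rfl⟩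
  have hpoly : ∀ (S : Submodule K A.Chains), (∀ x ∈ S, φ.lieDerivative x ∈ S) →
      ∀ (p : Polynomial K), ∀ x ∈ S, Polynomial.aeval φ.lieDerivative p x ∈ S := by
    intro S hS p x hx
    induction p using Polynomial.induction_on' with
    | add p q hp hq => rw [map_add, LinearMap.add_apply]; exact Submodule.add_mem _ hp hq
    | monomial n c =>
      rw [Polynomial.aeval_monomial, Module.End.mul_apply, Module.algebraMap_end_apply]
      refine Submodule.smul_mem _ _ ?_
      induction n with
      | zero => simpa
      | succ n ih => rw [pow_succ', Module.End.mul_apply]; exact hS _ ih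
  -- Diagonalizability with nonzero eigenvalues is used in this form: some polynomial in `L` with
  -- nonzero constant term sends `x` into the trivial chains. Products of such polynomials handle
  -- sums of eigenvectors.
  have hann : ∀ x, ∃ p : Polynomial K, p.coeff 0 ≠ 0 ∧
      Polynomial.aeval φ.lieDerivative p x ∈ A.trivialChains := by
    have hadd : ∀ x y, (∃ p : Polynomial K, p.coeff 0 ≠ 0 ∧
        Polynomial.aeval φ.lieDerivative p x ∈ A.trivialChains) →
        (∃ p : Polynomial K, p.coeff 0 ≠ 0 ∧
        Polynomial.aeval φ.lieDerivative p y ∈ A.trivialChains) → ∃ p : Polynomial K,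
        p.coeff 0 ≠ 0 ∧ Polynomial.aeval φ.lieDerivative p (x + y) ∈ A.trivialChains := by
      rintro x y ⟨p, hp, hpx⟩ ⟨q, hq, hqy⟩
      refine ⟨p * q, by rw [Polynomial.mul_coeff_zero]; exact mul_ne_zero hp hq, ?_⟩
      rw [map_add]
      refine Submodule.add_mem _ ?_ ?_
      · rw [mul_comm, map_mul, Module.End.mul_apply]
        exact hpoly _ (fun x hx => φ.lieDerivative_mem_trivialChains hx) q _ hpx
      · rw [map_mul, Module.End.mul_apply]
        exact hpoly _ (fun x hx => φ.lieDerivative_mem_trivialChains hx) p _ hqy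
    intro x
    have hx : x ∈ A.trivialChains ⊔ ⨆ μ : {μ : K // μ ≠ 0},
      Module.End.eigenspace φ.lieDerivative μ := by rw [h]; trivial
    obtain ⟨t, ht, y, hy, rfl⟩ := Submodule.mem_sup.1 hx
    refine hadd _ _ ⟨1, by simp, by simpa⟩ ?_
    refine Submodule.iSup_induction _ (motive := fun y => ∃ p : Polynomial K, p.coeff 0 ≠ 0 ∧
        Polynomial.aeval φ.lieDerivative p y ∈ A.trivialChains) hy ?_ ⟨1, by simp, by simp⟩ hadd
    rintro ⟨μ, hμ⟩ y hy
    refine ⟨Polynomial.X - Polynomial.C μ, by simpa using hμ, ?_⟩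
    rw [Module.End.mem_eigenspace_iff] at hy
    simp [hy]
  have hZY : Z ≤ Y := by
    intro x hx
    obtain ⟨p, hp, hpx⟩ := hann x
    -- Writing `p = X q + p(0)` expresses `p(0) x` as a trivial chain minus `L (q(L) x)`, with `q(L)
    -- x` still in `Z`. No decomposition of `Z` into eigenspaces is needed.
    have h1 : p.coeff 0 • x = Polynomial.aeval φ.lieDerivative p x -
        φ.lieDerivative (Polynomial.aeval φ.lieDerivative p.divX x) := by
      have h3 := congrArg (fun q => Polynomial.aeval φ.lieDerivative q x)
        (Polynomial.X_mul_divX_add p)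
      simp only [map_add, map_mul, Polynomial.aeval_X, Polynomial.aeval_C, LinearMap.add_apply,
        Module.End.mul_apply, Module.algebraMap_end_apply] at h3
      rw [← h3]; abel
    have h2 : x = (p.coeff 0)⁻¹ • p.coeff 0 • x := by rw [smul_smul, inv_mul_cancel₀ hp, one_smul]
    rw [h2, h1]
    exact Submodule.smul_mem _ _ (Submodule.sub_mem _
      (Submodule.mem_sup_right (trivialChains_le_redBoundaries hpx)) (hY _ (hpoly Z hZ _ x hx)))
  intro x hx hBx
  obtain ⟨_, ⟨y, hy, rfl⟩, r, hr, rfl⟩ := Submodule.mem_sup.1 (hZY ⟨hx, hBx⟩)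
  exact ⟨y, hy, by simpa using hr⟩

end GradedDerivation

end CochainAlg

/-! ### Exactness of algebras with positive weights -/

section FreeCGA

variable {K : Type*} [Field K] {V : ℕ → Type*} [∀ n, AddCommGroup (V n)] [∀ n, Module K (V n)]

/-- The inclusion of the generators of a free graded commutative algebra. -/
noncomputable def FreeCGA.ι (n : ℕ) : V n →ₗ[K] FreeCGA K V :=
  (RingQuot.mkAlgHom K (FreeCGA.Rel (K := K) V)).toLinearMap ∘ₗ TensorAlgebra.ι K ∘ₗ
    DirectSum.lof K ℕ V n

theorem FreeCGA.lift_ι {A : Type*} [Ring A] [Algebra K A] (f : ∀ n, V n →ₗ[K] A) (hf) (n : ℕ)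
    (v : V n) : FreeCGA.lift f hf (FreeCGA.ι n v) = f n v := by
  refine (RingQuot.liftAlgHom_mkAlgHom_apply K _ _ _).trans ?_
  simp

theorem FreeCGA.hom_ext {A : Type*} [Ring A] [Algebra K A] {f g : FreeCGA K V →ₐ[K] A}
    (h : ∀ n v, f (FreeCGA.ι n v) = g (FreeCGA.ι n v)) : f = g := by
  refine RingQuot.ringQuot_ext' K f g (TensorAlgebra.hom_ext ?_)
  exact DirectSum.linearMap_ext K fun n => LinearMap.ext fun v => h n v

theorem FreeCGA.induction {P : FreeCGA K V → Prop} (h0 : ∀ c : K, P (algebraMap K _ c))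
    (h1 : ∀ n v, P (FreeCGA.ι n v)) (hm : ∀ x y, P x → P y → P (x * y))
    (ha : ∀ x y, P x → P y → P (x + y)) (x : FreeCGA K V) : P x := by
  obtain ⟨y, rfl⟩ := RingQuot.mkAlgHom_surjective K (FreeCGA.Rel (K := K) V) x
  induction y using TensorAlgebra.induction with
  | algebraMap r => rw [AlgHom.commutes]; exact h0 r
  | mul a b ha' hb' => rw [map_mul]; exact hm _ _ ha' hb'
  | add a b ha' hb' => rw [map_add]; exact ha _ _ ha' hb'
  | ι x =>
    induction x using DirectSum.induction_on with
    | zero =>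
      have h := h0 0
      rw [map_zero] at h
      rw [map_zero]
      exact (congrArg P (map_zero (RingQuot.mkAlgHom K (FreeCGA.Rel (K := K) V)))).mpr h
    | of n v => exact h1 n v
    | add x y hx hy => rw [map_add, map_add]; exact ha _ _ hx hy

end FreeCGA

/-- A linear endomorphism with prescribed eigenspaces. -/
theorem exists_linearMap_of_iSupIndep {K E : Type*} [Field K] [AddCommGroup E] [Module K E]
    {W : ℕ → Submodule K E} {V : Submodule K E} (hW : iSupIndep W) (hV : ⨆ i, W i = V) :
    ∃ θ : V →ₗ[K] V, ∀ i, ∀ v : V, (v : E) ∈ W i → θ v = (i : K) • v := by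
  have hle : ∀ i, W i ≤ V := fun i => hV ▸ le_iSup W i
  have hinj : Function.Injective (DirectSum.coeLinearMap W) := hW.dfinsupp_lsum_injective
  have hr : LinearMap.range (DirectSum.coeLinearMap W) = V := by
    rw [← hV, DirectSum.range_coeLinearMap]
  let e := (LinearEquiv.ofInjective _ hinj).trans (LinearEquiv.ofEq _ _ hr)
  refine ⟨DirectSum.toModule K ℕ V (fun i => (i : K) • Submodule.inclusion (hle i)) ∘ₗ
    e.symm.toLinearMap, fun i v hv => ?_⟩
  have hev : e (DirectSum.lof K ℕ (fun i => W i) i ⟨v, hv⟩) = v := by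
    refine Subtype.ext ?_
    exact DirectSum.coeLinearMap_lof W i ⟨v, hv⟩
  have : e.symm v = DirectSum.lof K ℕ (fun i => W i) i ⟨v, hv⟩ := by
    rw [LinearEquiv.symm_apply_eq, hev]
  rw [LinearMap.comp_apply, LinearEquiv.coe_coe, this, DirectSum.toModule_lof]
  rfl

/-- The letters are freed from `S` one position at a time, with `s` the set of positions already
freed. -/
theorem MultilinearMap.map_mem_of_span_eq_top {K E F ι : Type*} [Field K] [AddCommGroup E]
    [Module K E] [AddCommGroup F] [Module K F] [Fintype ι] [DecidableEq ι]
    (f : MultilinearMap K (fun _ : ι => E) F) {S : Set E} (hS : Submodule.span K S = ⊤)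
    {Y : Submodule K F} (h : ∀ w, (∀ j, w j ∈ S) → f w ∈ Y) (w : ι → E) : f w ∈ Y := by
  suffices H : ∀ (s : Finset ι) (w : ι → E), (∀ j ∉ s, w j ∈ S) → f w ∈ Y from
    H Finset.univ w (by simp)
  intro s
  induction s using Finset.induction_on with
  | empty => exact fun w hw => h w fun j => hw j (by simp)
  | insert i s hi ih =>
    intro w hw
    have key : ∀ x ∈ Submodule.span K S, f (Function.update w i x) ∈ Y := by
      intro x hx
      induction hx using Submodule.span_induction with
      | mem x hx =>
        refine ih _ fun j hj => ?_
        by_cases hji : j = i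
        · subst hji; simpa
        · rw [Function.update_of_ne hji]
          exact hw j (by simp [hji, hj])
      | zero => rw [f.map_update_zero]; exact Y.zero_mem
      | add x y _ _ hx hy => rw [f.map_update_add]; exact Y.add_mem hx hy
      | smul c x _ hx => rw [f.map_update_smul]; exact Y.smul_mem _ hx
    simpa using key (w i) (by rw [hS]; trivial)

namespace CochainAlg

/-! ### Degree components and words of eigenvectors. -/

section Component

variable {K : Type*} [Field K] {A : CochainAlg K}

variable (A) in
/-- The projection onto the component of degree `n`. -/
noncomputable def component (n : ℕ) : A.carrier →ₗ[K] A.carrier :=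
  (A.gr n).subtype ∘ₗ DirectSum.component K ℕ (fun n => A.gr n) n ∘ₗ
    (DirectSum.decomposeLinearEquiv A.gr).toLinearMap

theorem component_mem (n : ℕ) (x : A.carrier) : A.component n x ∈ A.gr n := SetLike.coe_mem _

theorem component_of_mem {n : ℕ} {x : A.carrier} (hx : x ∈ A.gr n) : A.component n x = x :=
  DirectSum.decompose_of_mem_same _ hx

theorem component_of_mem_of_ne {m n : ℕ} {x : A.carrier} (hx : x ∈ A.gr m) (h : m ≠ n) :
    A.component n x = 0 :=
  DirectSum.decompose_of_mem_ne _ hx h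

theorem chains_eq_top_of_forall_word {S : Submodule K A.Chains}
    (h : ∀ (k : ℕ) (w : Fin (k + 1) → A.carrier), A.word w ∈ S) : S = ⊤ := by
  rw [eq_top_iff]
  rintro x -
  induction x using DirectSum.induction_on with
  | zero => exact Submodule.zero_mem _
  | add x y hx hy => exact Submodule.add_mem _ hx hy
  | of k x =>
    induction x using PiTensorProduct.induction_on with
    | add x y hx hy => rw [map_add]; exact Submodule.add_mem _ hx hy
    | smul_tprod r w =>
      change DirectSum.lof K ℕ A.Word k _ ∈ _
      rw [map_smul]
      exact Submodule.smul_mem _ _ (h k w)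

theorem word_mem_trivialChains_of_mem_span_one {k : ℕ} {w : Fin (k + 1) → A.carrier}
    (h : ∀ j, w j ∈ Submodule.span K {(1 : A.carrier)}) : A.word w ∈ A.trivialChains := by
  choose c hc using fun j => Submodule.mem_span_singleton.1 (h j)
  obtain rfl : (fun j => c j • (1 : A.carrier)) = w := funext hc
  rw [word, MultilinearMap.map_smul_univ, map_smul]
  refine Submodule.smul_mem _ _ (Submodule.subset_span ?_)
  cases k with
  | zero => exact Or.inr rfl
  | succ k => exact Or.inl ⟨k + 1, fun _ => 1, ⟨Fin.last _, by simp [Fin.ext_iff], rfl⟩, rfl⟩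

/-- A derivation of degree zero acts without signs, so the eigenvalues of the letters add up. -/
theorem GradedDerivation.lieDerivative_word (φ : A.GradedDerivation) (h0 : φ.deg = 0) {k : ℕ}
    (w : Fin (k + 1) → A.carrier) (n i : Fin (k + 1) → ℕ) (hn : ∀ j, w j ∈ A.gr (n j))
    (hi : ∀ j, φ.toFun (w j) = (i j : K) • w j) :
    φ.lieDerivative (A.word w) = (↑(∑ j, i j) : K) • A.word w := by
  set l : List A.Letter := List.ofFn fun j => ⟨w j, n j, hn j⟩ with hl
  have hlen : l.length = k + 1 := by simp [hl]
  rw [A.wd_eq w l hlen fun i => by rw [List.get_ofFn]; rfl, lieDerivative,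
    byLength_apply _ (wd_mem hlen), tot_apply, Finset.sum_range, Nat.cast_sum, Finset.sum_smul]
  refine Finset.sum_congr rfl fun j _ => ?_
  obtain ⟨p, a, q, hpq, hp⟩ := exists_split l j (by omega)
  have ha : a.val = w j := by
    have h2 : l[(j : ℕ)]'(by omega) = a := by
      simp only [hpq]
      simp [← hp]
    rw [← h2]
    simp only [hl, List.getElem_ofFn]
  rw [hpq, ← hp, φ.act_wd, h0, Nat.cast_zero, zero_mul, sgn_zero, one_smul]
  have h3 := wd_linear p q a a (φ.letter a) (i j : K) 0
    (by rw [zero_smul, add_zero, ha, ← hi, ← ha]; rfl)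
  rw [h3, zero_smul, add_zero]

end Component

variable {K : Type*} [Field K] {M : CochainAlg K} {V : ℕ → Submodule K M.carrier}
  {W : ℕ → ℕ → Submodule K M.carrier}

/-! ### The bigrading by degree and weight, and the weight derivation. -/

/-- The span of the products of weight `i` and degree `n`. -/
def biHomog (W : ℕ → ℕ → Submodule K M.carrier) (n i : ℕ) : Submodule K M.carrier :=
  Submodule.span K {x | ∃ l : List (ℕ × ℕ × M.carrier), (∀ q ∈ l, q.2.2 ∈ W q.2.1 q.1) ∧
    (l.map fun q => q.1).sum = n ∧ (l.map fun q => q.2.1).sum = i ∧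
    (l.map fun q => q.2.2).prod = x}

theorem mul_mem_biHomog {n m i j : ℕ} {x y : M.carrier} (hx : x ∈ biHomog W n i)
    (hy : y ∈ biHomog W m j) : x * y ∈ biHomog W (n + m) (i + j) := by
  have h : biHomog W n i * biHomog W m j ≤ biHomog W (n + m) (i + j) := by
    rw [biHomog, biHomog, Submodule.span_mul_span, Submodule.span_le]
    rintro _ ⟨_, ⟨l, hl, h1, h2, rfl⟩, _, ⟨l', hl', h1', h2', rfl⟩, rfl⟩
    refine Submodule.subset_span ⟨l ++ l', ?_, by simp [h1, h1'], by simp [h2, h2'], by simp⟩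
    intro q hq
    rcases List.mem_append.1 hq with hq | hq
    · exact hl q hq
    · exact hl' q hq
  exact h (Submodule.mul_mem_mul hx hy)

theorem one_mem_biHomog : (1 : M.carrier) ∈ biHomog W 0 0 :=
  Submodule.subset_span ⟨[], by simp, by simp, by simp, by simp⟩

theorem mem_biHomog {n i : ℕ} {x : M.carrier} (hx : x ∈ W i n) : x ∈ biHomog W n i :=
  Submodule.subset_span ⟨[(n, i, x)], by simpa, by simp, by simp, by simp⟩

theorem homogPart_le (i : ℕ) :
    homogPart K (fun j => ⋃ m, (W j m : Set M.carrier)) i ≤ ⨆ n, biHomog W n i := by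
  refine Submodule.span_le.2 ?_
  rintro _ ⟨l, hl, rfl, rfl⟩
  suffices h : ∃ n, (l.map Prod.snd).prod ∈ biHomog W n (l.map Prod.fst).sum from
    h.elim fun n hn => Submodule.mem_iSup_of_mem n hn
  induction l with
  | nil => exact ⟨0, by simpa using one_mem_biHomog⟩
  | cons a l ih =>
    obtain ⟨n, hn⟩ := ih fun q hq => hl q (List.mem_cons_of_mem _ hq)
    obtain ⟨m, hm⟩ := Set.mem_iUnion.1 (hl a List.mem_cons_self)
    exact ⟨m + n, by simpa using mul_mem_biHomog (mem_biHomog hm) hn⟩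

theorem IsPositiveWeight.le (hW : M.IsPositiveWeight V W) (i n : ℕ) : W i n ≤ V n :=
  hW.iSup_eq n ▸ le_iSup (fun i => W i n) i

theorem biHomog_le_gr (hV : M.IsMinimalSullivan V) (hW : M.IsPositiveWeight V W) (n i : ℕ) :
    biHomog W n i ≤ M.gr n := by
  refine Submodule.span_le.2 ?_
  rintro _ ⟨l, hl, rfl, -, rfl⟩
  induction l with
  | nil => simpa using SetLike.GradedOne.one_mem (A := M.gr)
  | cons a l ih =>
    simp only [List.map_cons, List.sum_cons, List.prod_cons]
    exact SetLike.GradedMul.mul_mem (hV.le_gr _ (hW.le _ _ (hl a List.mem_cons_self)))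
      (ih fun q hq => hl q (List.mem_cons_of_mem _ hq))

/-- Positivity of the weights enters here: a nonempty product of total weight zero has a factor of
weight zero, which is `0`, so only the empty product contributes. -/
theorem biHomog_zero_le (hW : M.IsPositiveWeight V W) (n : ℕ) :
    biHomog W n 0 ≤ Submodule.span K {1} := by
  refine Submodule.span_le.2 ?_
  rintro _ ⟨l, hl, -, h0, rfl⟩
  match l with
  | [] => exact Submodule.subset_span (by simp)
  | a :: l =>
    have h1 : a.2.1 = 0 := by
      simp only [List.map_cons, List.sum_cons] at h0; omega
    have h2 := hl a List.mem_cons_self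
    rw [h1, hW.pos, Submodule.mem_bot] at h2
    simp [h2]

theorem span_biHomog (hV : M.IsMinimalSullivan V) (hW : M.IsPositiveWeight V W) :
    Submodule.span K {x : M.carrier | ∃ n i, x ∈ biHomog W n i} = ⊤ := by
  obtain ⟨hc, hbij⟩ := hV.free
  rw [eq_top_iff]
  rintro x -
  obtain ⟨y, rfl⟩ := hbij.2 x
  induction y using FreeCGA.induction with
  | h0 c =>
    rw [AlgHom.commutes, Algebra.algebraMap_eq_smul_one]
    exact Submodule.smul_mem _ _ (Submodule.subset_span ⟨0, 0, one_mem_biHomog⟩)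
  | h1 n v =>
    have h : FreeCGA.lift (fun n => (V n).subtype) hc (FreeCGA.ι n v) = v := FreeCGA.lift_ι (fun n => (V n).subtype) hc n v
    rw [h]
    have hv := v.2
    simp only [← hW.iSup_eq n] at hv
    have hle : ⨆ i, W i n ≤ Submodule.span K {x : M.carrier | ∃ n i, x ∈ biHomog W n i} :=
      iSup_le fun i w hw => Submodule.subset_span ⟨n, i, mem_biHomog hw⟩
    exact hle hv
  | hm x y hx hy =>
    rw [map_mul]
    have h := Submodule.mul_mem_mul hx hy
    rw [Submodule.span_mul_span] at h
    refine Submodule.span_mono ?_ h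
    rintro _ ⟨a, ⟨n, i, ha⟩, b, ⟨m, j, hb⟩, rfl⟩
    exact ⟨_, _, mul_mem_biHomog ha hb⟩
  | ha x y hx hy => rw [map_add]; exact Submodule.add_mem _ hx hy

/-- A derivation is the second component of an algebra map `x ↦ x + ε D x` into the square-zero
extension. Freeness of `∧V` provides this map from its values `v + ε θ v` on generators, where `θ`
multiplies weight `i` by `i`. -/
theorem exists_weight_derivation (hV : M.IsMinimalSullivan V) (hW : M.IsPositiveWeight V W) :
    ∃ D : M.carrier →ₗ[K] M.carrier, (∀ x y, D (x * y) = D x * y + x * D y) ∧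
      ∀ n i, ∀ x ∈ biHomog W n i, D x = (i : K) • x := by
  obtain ⟨hc, hbij⟩ := hV.free
  choose θ hθ using fun n => exists_linearMap_of_iSupIndep (hW.indep n) (hW.iSup_eq n)
  let f : ∀ n, V n →ₗ[K] TrivSqZeroExt M.carrier M.carrier := fun n =>
    { toFun := fun v => TrivSqZeroExt.inl (v : M.carrier) + TrivSqZeroExt.inr (θ n v : M.carrier)
      map_add' := fun v w => by ext <;> simp
      map_smul' := fun c v => by ext <;> simp }
  -- The values commute in the graded sense because `θ` preserves each `V n`, so the same signs
  -- apply to `v`, `w` and their images.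
  have hf : ∀ (m n : ℕ) (v : V m) (w : V n),
      f m v * f n w = (-1 : K) ^ (m * n) • (f n w * f m v) := by
    intro m n v w
    ext
    · simpa [f] using hc m n v w
    · have h1 := hc m n v (θ n w)
      have h2 := hc m n (θ m v) w
      simp only [f, LinearMap.coe_mk, AddHom.coe_mk, TrivSqZeroExt.snd_mul, TrivSqZeroExt.fst_add,
        TrivSqZeroExt.snd_add, TrivSqZeroExt.fst_inl, TrivSqZeroExt.snd_inl, TrivSqZeroExt.fst_inr,
        TrivSqZeroExt.snd_inr, TrivSqZeroExt.snd_smul, add_zero, zero_add, smul_eq_mul,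
        MulOpposite.smul_eq_mul_unop, MulOpposite.unop_op, h1, h2, smul_add]
      rw [add_comm]
  let e := AlgEquiv.ofBijective _ hbij
  let Ψ := (FreeCGA.lift f hf).comp e.symm.toAlgHom
  have hfst : ∀ x, (Ψ x).fst = x := by
    intro x
    obtain ⟨y, rfl⟩ := e.surjective x
    have : (TrivSqZeroExt.fstHom K M.carrier M.carrier).comp (FreeCGA.lift f hf) =
        FreeCGA.lift (fun n => (V n).subtype) hc := by
      refine FreeCGA.hom_ext fun n v => ?_
      have h1 : FreeCGA.lift (fun n => (V n).subtype) hc (FreeCGA.ι n v) = v :=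
        FreeCGA.lift_ι (fun n => (V n).subtype) hc n v
      rw [AlgHom.comp_apply, FreeCGA.lift_ι f hf, h1]
      simp [f]
    have h2 : Ψ (e y) = FreeCGA.lift f hf y := congrArg _ (e.symm_apply_apply y)
    rw [h2]
    exact DFunLike.congr_fun this y
  let D : M.carrier →ₗ[K] M.carrier :=
    { toFun := fun x => (Ψ x).snd
      map_add' := fun x y => by simp
      map_smul' := fun c x => by simp }
  have hD : ∀ x y, D (x * y) = D x * y + x * D y := by
    intro x y
    change (Ψ (x * y)).snd = (Ψ x).snd * y + x * (Ψ y).snd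
    rw [map_mul, TrivSqZeroExt.snd_mul, hfst, hfst, smul_eq_mul, MulOpposite.smul_eq_mul_unop,
      MulOpposite.unop_op, add_comm]
  have hD1 : D 1 = 0 := by
    have := hD 1 1
    simpa using this
  have hDθ : ∀ n i, ∀ x ∈ W i n, D x = (i : K) • x := by
    intro n i x hx
    have h1 : e (FreeCGA.ι n (⟨x, hW.le i n hx⟩ : V n)) = x :=
      FreeCGA.lift_ι (fun n => (V n).subtype) hc n (⟨x, hW.le i n hx⟩ : V n)
    change (Ψ x).snd = _
    have h2 : Ψ x = f n ⟨x, hW.le i n hx⟩ := by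
      conv_lhs => rw [← h1]
      simp only [Ψ, AlgHom.comp_apply]
      rw [← FreeCGA.lift_ι f hf]
      exact congrArg _ (e.symm_apply_apply _)
    rw [h2]
    simp [f, hθ n i ⟨x, hW.le i n hx⟩ hx]
  refine ⟨D, hD, fun n i x hx => ?_⟩
  refine LinearMap.eqOn_span (f := D) (g := (i : K) • LinearMap.id) ?_ hx
  rintro _ ⟨l, hl, -, rfl, rfl⟩
  clear hx
  induction l with
  | nil => simp [hD1]
  | cons a l ih =>
    have ih := ih fun q hq => hl q (List.mem_cons_of_mem _ hq)
    simp only [LinearMap.smul_apply, LinearMap.id_apply] at ih ⊢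
    simp only [List.map_cons, List.sum_cons, List.prod_cons, Nat.cast_add]
    rw [hD, ih, hDθ _ _ _ (hl a List.mem_cons_self)]
    simp [add_smul]

/-- Only the weight of `M.d x` is kept track of, since the eigenvalue of `D` does not depend on the
degree. -/
theorem d_mem_biHomog (hV : M.IsMinimalSullivan V) (hW : M.IsPositiveWeight V W) {n i : ℕ}
    {x : M.carrier} (hx : x ∈ biHomog W n i) : M.d x ∈ ⨆ n, biHomog W n i := by
  have hmul : ∀ {i j : ℕ} {x y : M.carrier}, x ∈ ⨆ n, biHomog W n i → y ∈ ⨆ n, biHomog W n j →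
      x * y ∈ ⨆ n, biHomog W n (i + j) := by
    intro i j x y hx hy
    have h := Submodule.mul_mem_mul hx hy
    rw [Submodule.iSup_mul] at h
    suffices hle : ⨆ n, biHomog W n i * ⨆ n, biHomog W n j ≤ ⨆ n, biHomog W n (i + j) from hle h
    refine iSup_le fun n => ?_
    rw [Submodule.mul_iSup]
    refine iSup_le fun m => Submodule.mul_le.2 fun a ha b hb => ?_
    exact Submodule.mem_iSup_of_mem (n + m) (mul_mem_biHomog ha hb)
  refine (Submodule.span_le.2 ?_ : biHomog W n i ≤ (⨆ n, biHomog W n i).comap M.d) hx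
  rintro _ ⟨l, hl, rfl, rfl, rfl⟩
  clear hx
  simp only [Submodule.comap_coe, Set.mem_preimage, SetLike.mem_coe]
  induction l with
  | nil =>
    have := (differential M).map_one
    simp only [differential] at this
    simp [this]
  | cons a l ih =>
    have hl' : ∀ q ∈ l, q.2.2 ∈ W q.2.1 q.1 := fun q hq => hl q (List.mem_cons_of_mem _ hq)
    have ha := hl a List.mem_cons_self
    simp only [List.map_cons, List.sum_cons, List.prod_cons]
    rw [M.leibniz a.1 _ _ (hV.le_gr _ (hW.le _ _ ha))]
    refine Submodule.add_mem _ (hmul (homogPart_le _ (hW.d_mem _ _ _ ha)) ?_)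
      (Submodule.smul_mem _ _ (hmul ?_ (ih hl')))
    · exact Submodule.mem_iSup_of_mem _ (Submodule.subset_span ⟨l, hl', rfl, rfl, rfl⟩)
    · exact Submodule.mem_iSup_of_mem _ (mem_biHomog ha)

/-- A minimal Sullivan algebra with positive weights is BV exact. -/
theorem IsPositiveWeight.isBVExact [CharZero K] (hV : M.IsMinimalSullivan V)
    (hW : M.IsPositiveWeight V W) : M.IsBVExact := by
  obtain ⟨D, hD, hDi⟩ := exists_weight_derivation hV hW
  have hspan := span_biHomog hV hW
  -- On the spanning bihomogeneous elements `D` is a scalar, hence commutes with the degree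
  -- projections; this gives preservation of degrees everywhere.
  have hgr : ∀ n, ∀ x ∈ M.gr n, D x ∈ M.gr n := by
    intro n x hx
    have hcomm : D ∘ₗ M.component n = M.component n ∘ₗ D := by
      refine LinearMap.ext_on hspan ?_
      rintro y ⟨m, i, hy⟩
      have hm := biHomog_le_gr hV hW m i hy
      rw [LinearMap.comp_apply, LinearMap.comp_apply, hDi m i y hy, map_smul]
      by_cases h : m = n
      · subst h
        rw [component_of_mem hm, hDi m i y hy]
      · rw [component_of_mem_of_ne hm h, map_zero, smul_zero]
    have h := LinearMap.congr_fun hcomm x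
    rw [LinearMap.comp_apply, LinearMap.comp_apply, component_of_mem hx] at h
    rw [h]
    exact component_mem n _
  have hd : ∀ x, D (M.d x) = M.d (D x) := by
    intro x
    refine LinearMap.congr_fun (f := D ∘ₗ M.d) (g := M.d ∘ₗ D) ?_ x
    refine LinearMap.ext_on hspan ?_
    rintro x ⟨n, i, hx⟩
    rw [LinearMap.comp_apply, LinearMap.comp_apply, hDi n i x hx, map_smul]
    have hle : ⨆ n, biHomog W n i ≤ LinearMap.eqLocus D ((i : K) • LinearMap.id) :=
      iSup_le fun n y hy => hDi n i y hy
    exact hle (d_mem_biHomog hV hW hx)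
  let φ : M.GradedDerivation :=
    { toFun := D
      deg := 0
      map_mem := hgr
      leibniz := fun n x _ y => by simp [hD] }
  refine φ.isBVExact rfl hd ?_
  refine chains_eq_top_of_forall_word fun k => MultilinearMap.map_mem_of_span_eq_top
    ((DirectSum.lof K ℕ M.Word k).compMultilinearMap (PiTensorProduct.tprod K)) hspan ?_
  intro w hw
  choose n i hw using hw
  have hx := φ.lieDerivative_word rfl w n i (fun j => biHomog_le_gr hV hW _ _ (hw j))
    fun j => hDi _ _ _ (hw j)
  -- Total weight zero forces every letter to be a scalar, hence a trivial chain. Otherwise the word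
  -- is an eigenvector, and its weight stays nonzero in `K` by characteristic zero.
  by_cases hi : ∑ j, i j = 0
  · refine Submodule.mem_sup_left (word_mem_trivialChains_of_mem_span_one fun j => ?_)
    have hij : i j = 0 := Finset.sum_eq_zero_iff.1 hi j (Finset.mem_univ j)
    exact biHomog_zero_le hW (n j) (hij ▸ hw j)
  · refine Submodule.mem_sup_right (Submodule.mem_iSup_of_mem ⟨(↑(∑ j, i j) : K), by
      exact_mod_cast hi⟩ ?_)
    rw [Module.End.mem_eigenspace_iff]
    exact hx

end CochainAlg

/-! ### Functoriality of the Hochschild complex -/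

namespace CochainAlg

namespace Hom

variable {K : Type*} [Field K] {M : CochainAlg K} {A : CochainAlg K} (f : Hom M A)

/-- The action of a morphism on letters. -/
def letter (a : M.Letter) : A.Letter := ⟨f.toAlgHom a.val, a.deg, f.map_gr _ _ a.mem⟩

@[simp] theorem par_letter (a : M.Letter) : (f.letter a).par = a.par := rfl

@[simp] theorem par_map_letter (l : List M.Letter) : par (l.map f.letter) = par l := by
  induction l with
  | nil => rfl
  | cons a l ih => simp [ih]

theorem letter_mul (a b : M.Letter) : f.letter (a.mul b) = (f.letter a).mul (f.letter b) := by
  simp [letter, Letter.mul]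

theorem letter_one : f.letter Letter.one = Letter.one := by
  simp [letter, Letter.one]

theorem letter_differential (a : M.Letter) :
    f.letter (M.differential.letter a) = A.differential.letter (f.letter a) := by
  simp [letter, GradedDerivation.letter, Letter.map, differential, f.map_d]

/-- The map induced on words. -/
noncomputable def mapWord (k : ℕ) : M.Word k →ₗ[K] A.Word k :=
  PiTensorProduct.map fun _ => f.toAlgHom.toLinearMap

/-- The map induced on Hochschild chains. -/
noncomputable def mapChains : M.Chains →ₗ[K] A.Chains :=
  DirectSum.toModule K ℕ _ fun k => DirectSum.lof K ℕ A.Word k ∘ₗ f.mapWord k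

theorem mapChains_lof (k : ℕ) (x : M.Word k) :
    f.mapChains (DirectSum.lof K ℕ M.Word k x) = DirectSum.lof K ℕ A.Word k (f.mapWord k x) := by
  rw [mapChains, DirectSum.toModule_lof]; rfl

theorem mapChains_wd (l : List M.Letter) : f.mapChains (wd l) = wd (l.map f.letter) := by
  match l with
  | [] => exact map_zero _
  | a :: l =>
    rw [wd_cons_eq M (k := l.length) rfl, mapChains_lof, mapWord, PiTensorProduct.map_tprod]
    refine A.wd_eq _ _ (by simp) fun i => ?_
    simp only [List.get_eq_getElem, List.getElem_map]
    rfl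

theorem mapChains_mem {n : ℕ} {x : M.Chains} (hx : x ∈ M.wordsOfLength n) :
    f.mapChains x ∈ A.wordsOfLength n :=
  wordsOfLength_le (fun l hl => by rw [mapChains_wd]; exact wd_mem (by simpa using hl)) hx

theorem mapChains_contr (j : ℕ) {n : ℕ} {x : M.Chains} (hx : x ∈ M.wordsOfLength n) :
    f.mapChains (M.contr j x) = A.contr j (f.mapChains x) := by
  refine eq_on_wordsOfLength (f := f.mapChains ∘ₗ M.contr j) (g := A.contr j ∘ₗ f.mapChains)
    (fun l _ => ?_) hx
  simp only [LinearMap.comp_apply, mapChains_wd]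
  by_cases h : j + 1 < l.length
  · obtain ⟨p, a, b, q, rfl, rfl⟩ := exists_split_two l j h
    have := A.contr_wd (p.map f.letter) (f.letter a) (f.letter b) (q.map f.letter)
    simp only [List.length_map] at this
    simp only [contr_wd, map_smul, mapChains_wd, List.map_append, List.map_cons, this,
      par_map_letter, par_letter, letter_mul]
  · rw [contr_wd_of_le _ _ _ (by omega), contr_wd_of_le _ _ _ (by simp; omega), map_zero]

theorem mapChains_rot {n : ℕ} {x : M.Chains} (hx : x ∈ M.wordsOfLength n) :
    f.mapChains (M.rot x) = A.rot (f.mapChains x) := by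
  refine eq_on_wordsOfLength (f := f.mapChains ∘ₗ M.rot) (g := A.rot ∘ₗ f.mapChains)
    (fun l _ => ?_) hx
  simp only [LinearMap.comp_apply, mapChains_wd]
  rcases List.eq_nil_or_concat l with rfl | ⟨p, c, rfl⟩
  · exact (congrArg f.mapChains (map_zero M.rot)).trans ((map_zero _).trans (map_zero _).symm)
  · simp only [List.concat_eq_append, rot_wd, map_smul, mapChains_wd, List.map_append,
      List.map_cons, List.map_nil, par_map_letter, par_letter]

theorem mapChains_act (i : ℕ) {n : ℕ} {x : M.Chains} (hx : x ∈ M.wordsOfLength n) :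
    f.mapChains (M.differential.act i x) = A.differential.act i (f.mapChains x) := by
  refine eq_on_wordsOfLength (f := f.mapChains ∘ₗ M.differential.act i)
    (g := A.differential.act i ∘ₗ f.mapChains) (fun l _ => ?_) hx
  simp only [LinearMap.comp_apply, mapChains_wd]
  by_cases h : i < l.length
  · obtain ⟨p, a, q, rfl, rfl⟩ := exists_split l i h
    have := A.differential.act_wd (p.map f.letter) (f.letter a) (q.map f.letter)
    simp only [List.length_map] at this
    simp only [GradedDerivation.act_wd, map_smul, mapChains_wd, List.map_append, List.map_cons,
      this, par_map_letter, letter_differential]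
    rfl
  · simp only [GradedDerivation.act]
    rw [applyAt_wd_of_le _ _ _ _ _ (by omega), applyAt_wd_of_le _ _ _ _ _ (by simp; omega),
      map_zero]

theorem mapChains_ins {n : ℕ} {x : M.Chains} (hx : x ∈ M.wordsOfLength n) :
    f.mapChains (M.ins x) = A.ins (f.mapChains x) := by
  refine eq_on_wordsOfLength (f := f.mapChains ∘ₗ M.ins) (g := A.ins ∘ₗ f.mapChains)
    (fun l _ => ?_) hx
  simp only [LinearMap.comp_apply, mapChains_wd]
  rcases eq_or_ne l [] with rfl | hl
  · exact (congrArg f.mapChains (map_zero M.ins)).trans ((map_zero _).trans (map_zero _).symm)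
  · rw [ins_wd M hl, ins_wd A (by simpa using hl), mapChains_wd, List.map_cons, letter_one]

theorem mapChains_hochschildB (x : M.Chains) :
    f.mapChains (M.hochschildB x) = A.hochschildB (f.mapChains x) := by
  refine LinearMap.congr_fun (f := f.mapChains ∘ₗ M.hochschildB)
    (g := A.hochschildB ∘ₗ f.mapChains) (chains_ext fun n x hx => ?_) x
  simp only [LinearMap.comp_apply]
  rw [hochschildB_apply hx, hochschildB_apply (f.mapChains_mem hx), map_add]
  simp only [GradedDerivation.tot_apply, faces_apply, map_add, map_sum, f.mapChains_act _ hx,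
    f.mapChains_contr _ hx, f.mapChains_contr _ (rot_mem hx), f.mapChains_rot hx]

theorem mapChains_rot_pow (r : ℕ) {n : ℕ} {x : M.Chains} (hx : x ∈ M.wordsOfLength n) :
    f.mapChains ((M.rot ^ r) x) = (A.rot ^ r) (f.mapChains x) := by
  induction r with
  | zero => rfl
  | succ r ih =>
    rw [pow_succ', pow_succ', Module.End.mul_apply, Module.End.mul_apply,
      f.mapChains_rot (rot_pow_mem r hx), ih]

theorem mapChains_connesB (x : M.Chains) :
    f.mapChains (M.connesB x) = A.connesB (f.mapChains x) := by
  refine LinearMap.congr_fun (f := f.mapChains ∘ₗ M.connesB)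
    (g := A.connesB ∘ₗ f.mapChains) (chains_ext fun n x hx => ?_) x
  simp only [LinearMap.comp_apply]
  rw [connesB_apply hx, connesB_apply (f.mapChains_mem hx), f.mapChains_ins (norm_mem _ hx)]
  simp only [norm_apply, map_sum, f.mapChains_rot_pow _ hx]

theorem mapChains_mem_trivialChains {x : M.Chains} (hx : x ∈ M.trivialChains) :
    f.mapChains x ∈ A.trivialChains := by
  refine trivialChains_le (S := A.trivialChains.comap f.mapChains) (fun p q hp => ?_) ?_ hx
  · rw [Submodule.mem_comap, mapChains_wd, List.map_append, List.map_cons, letter_one]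
    exact wd_mem_trivialChains (by simpa using hp) rfl
  · rw [Submodule.mem_comap, mapChains_wd, List.map_cons, letter_one]
    exact wd_one_mem_trivialChains

end Hom

end CochainAlg

/-! ### Homotopy inverses of quasi-isomorphisms -/

/-- An endomorphism whose kernel is its range is contractible. -/
theorem LinearMap.exists_contraction {K E : Type*} [Field K] [AddCommGroup E] [Module K E]
    (D : E →ₗ[K] E) (h : ∀ x, D x = 0 ↔ ∃ y, D y = x) :
    ∃ s : E →ₗ[K] E, ∀ x, D (s x) + s (D x) = x := by
  -- `σ` is a linear section of `D` over its range, extended to all of `E`. The contraction is `σ (1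
  -- - σ D)`: since `x - σ D x` is a cycle, applying `D σ` returns it, and the missing `σ D x` comes
  -- from the second summand.
  obtain ⟨σ', hσ'⟩ := D.rangeRestrict.exists_rightInverse_of_surjective D.range_rangeRestrict
  obtain ⟨σ, hσ⟩ := σ'.exists_extend
  have hDσ : ∀ x, D x = 0 → D (σ x) = x := by
    intro x hx
    obtain ⟨y, hy⟩ := (h x).1 hx
    have h1 : σ x = σ' ⟨x, y, hy⟩ := LinearMap.congr_fun hσ ⟨x, y, hy⟩
    rw [h1]
    exact congrArg Subtype.val (LinearMap.congr_fun hσ' ⟨x, y, hy⟩)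
  have hDD : ∀ x, D (D x) = 0 := fun x => (h _).2 ⟨x, rfl⟩
  refine ⟨σ ∘ₗ (LinearMap.id - σ ∘ₗ D), fun x => ?_⟩
  simp only [LinearMap.comp_apply, LinearMap.sub_apply, LinearMap.id_apply]
  rw [hDσ (x - σ (D x)) (by rw [map_sub, hDσ _ (hDD x), sub_self]), hDD, map_zero, sub_zero,
    sub_add_cancel]

namespace CochainAlg

variable {K : Type*} [Field K] {A : CochainAlg K} {M : CochainAlg K}

/-- A linear map given on homogeneous elements of each degree. -/
noncomputable def byDegree {E : Type*} [AddCommGroup E] [Module K E] (F : ℕ → A.carrier →ₗ[K] E) :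
    A.carrier →ₗ[K] E :=
  DirectSum.toModule K ℕ E (fun n => F n ∘ₗ (A.gr n).subtype) ∘ₗ
    (DirectSum.decomposeLinearEquiv A.gr).toLinearMap

theorem byDegree_of_mem {E : Type*} [AddCommGroup E] [Module K E] (F : ℕ → A.carrier →ₗ[K] E)
    {n : ℕ} {x : A.carrier} (hx : x ∈ A.gr n) : byDegree F x = F n x := by
  lift x to A.gr n using hx
  simp only [byDegree, LinearMap.comp_apply, LinearEquiv.coe_coe,
    DirectSum.decomposeLinearEquiv_apply, DirectSum.decompose_coe]
  erw [DirectSum.toModule_lof]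
  rfl

theorem span_gr : Submodule.span K {x : A.carrier | ∃ n, x ∈ A.gr n} = ⊤ := by
  rw [eq_top_iff]
  rintro x -
  classical
  rw [← DirectSum.sum_support_decompose A.gr x]
  exact Submodule.sum_mem _ fun n _ => Submodule.subset_span ⟨n, SetLike.coe_mem _⟩

theorem linearMap_ext_gr {E : Type*} [AddCommGroup E] [Module K E] {F G : A.carrier →ₗ[K] E}
    (h : ∀ n, ∀ x ∈ A.gr n, F x = G x) : F = G :=
  LinearMap.ext_on span_gr (by rintro x ⟨n, hx⟩; exact h n x hx)

theorem component_succ_d (n : ℕ) (x : A.carrier) :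
    A.component (n + 1) (A.d x) = A.d (A.component n x) := by
  refine LinearMap.congr_fun (f := A.component (n + 1) ∘ₗ A.d) (g := A.d ∘ₗ A.component n)
    (linearMap_ext_gr fun m x hx => ?_) x
  simp only [LinearMap.comp_apply]
  by_cases h : m = n
  · subst h
    rw [component_of_mem hx, component_of_mem (A.d_mem _ _ hx)]
  · rw [component_of_mem_of_ne hx h, component_of_mem_of_ne (A.d_mem _ _ hx) (by omega), map_zero]

theorem component_zero_d (x : A.carrier) : A.component 0 (A.d x) = 0 := by
  refine LinearMap.congr_fun (f := A.component 0 ∘ₗ A.d) (g := 0)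
    (linearMap_ext_gr fun m x hx => ?_) x
  simp only [LinearMap.comp_apply, LinearMap.zero_apply]
  rw [component_of_mem_of_ne (A.d_mem _ _ hx) (by omega)]

theorem Hom.component_map (f : Hom M A) (n : ℕ) (x : M.carrier) :
    A.component n (f.toAlgHom x) = f.toAlgHom (M.component n x) := by
  refine LinearMap.congr_fun (f := A.component n ∘ₗ f.toAlgHom.toLinearMap)
    (g := f.toAlgHom.toLinearMap ∘ₗ M.component n) (linearMap_ext_gr fun m x hx => ?_) x
  simp only [LinearMap.comp_apply, AlgHom.toLinearMap_apply]
  by_cases h : m = n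
  · subst h
    rw [component_of_mem hx, component_of_mem (f.map_gr _ _ hx)]
  · rw [component_of_mem_of_ne hx h, component_of_mem_of_ne (f.map_gr _ _ hx) h, map_zero]

/-! ### The Koszul sign operator and homotopies of degree minus one. -/

variable (A) in
/-- The sign of the suspension: multiplication by `(-1)^{n+1}` in degree `n`. -/
noncomputable def susp : A.carrier →ₗ[K] A.carrier :=
  byDegree fun n => sgn K (n + 1) • LinearMap.id

theorem susp_of_mem {n : ℕ} {x : A.carrier} (hx : x ∈ A.gr n) : A.susp x = sgn K (n + 1) • x := by
  rw [susp, byDegree_of_mem _ hx]; rfl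

theorem sgn_mul_self (z : ZMod 2) : sgn K z * sgn K z = 1 := by
  rw [← sgn_add, ← two_mul, show (2 : ZMod 2) = 0 from rfl, zero_mul, sgn_zero]

theorem susp_comp_susp : A.susp ∘ₗ A.susp = LinearMap.id := by
  refine linearMap_ext_gr fun n x hx => ?_
  rw [LinearMap.comp_apply, susp_of_mem hx, map_smul, susp_of_mem hx, smul_smul, sgn_mul_self,
    one_smul, LinearMap.id_apply]

theorem susp_one : A.susp 1 = -1 := by
  rw [susp_of_mem SetLike.GradedOne.one_mem]; simp

theorem sgn_succ (n : ℕ) : sgn K (((n + 1 : ℕ) : ZMod 2) + 1) = -sgn K (n + 1) := by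
  rw [Nat.cast_succ, sgn_add _ 1, sgn_one, mul_neg_one]

theorem d_comp_susp : A.d ∘ₗ A.susp = -(A.susp ∘ₗ A.d) := by
  refine linearMap_ext_gr fun n x hx => ?_
  rw [LinearMap.neg_apply, LinearMap.comp_apply, LinearMap.comp_apply, susp_of_mem hx, map_smul,
    susp_of_mem (A.d_mem _ _ hx), sgn_succ, neg_smul, neg_neg]

theorem susp_comp_of_map_gr {F : M.carrier →ₗ[K] A.carrier}
    (h : ∀ n, ∀ x ∈ M.gr n, F x ∈ A.gr n) : A.susp ∘ₗ F = F ∘ₗ M.susp := by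
  refine linearMap_ext_gr fun n x hx => ?_
  rw [LinearMap.comp_apply, LinearMap.comp_apply, susp_of_mem hx, susp_of_mem (h n x hx), map_smul]

/-- A contracting homotopy of degree `-1` anticommutes with the suspension sign. -/
theorem comp_susp_of_lower {F : A.carrier →ₗ[K] A.carrier} (h0 : ∀ x ∈ A.gr 0, F x = 0)
    (h : ∀ n, ∀ x ∈ A.gr (n + 1), F x ∈ A.gr n) : F ∘ₗ A.susp = -(A.susp ∘ₗ F) := by
  refine linearMap_ext_gr fun n x hx => ?_
  rw [LinearMap.neg_apply, LinearMap.comp_apply, LinearMap.comp_apply, susp_of_mem hx, map_smul]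
  cases n with
  | zero => rw [h0 x hx, map_zero, smul_zero, neg_zero]
  | succ n => rw [susp_of_mem (h n x hx), sgn_succ, neg_smul]

/-- The data of a homotopy between an endomorphism `p` and the identity. -/
structure Homotopy (A : CochainAlg K) (p : A.carrier →ₗ[K] A.carrier) where
  h : A.carrier →ₗ[K] A.carrier
  zero : ∀ x ∈ A.gr 0, h x = 0
  lower : ∀ n, ∀ x ∈ A.gr (n + 1), h x ∈ A.gr n
  eq : ∀ x, A.d (h x) + h (A.d x) = p x - x

/-- The part of degree `-1` of a homotopy. -/
theorem exists_homotopy {p h : A.carrier →ₗ[K] A.carrier}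
    (heq : ∀ x, A.d (h x) + h (A.d x) = p x - x) :
    Nonempty (A.Homotopy (byDegree fun n => A.component n ∘ₗ p)) := by
  let h' : A.carrier →ₗ[K] A.carrier := byDegree fun n => match n with
    | 0 => 0
    | n + 1 => A.component n ∘ₗ h
  have h0 : ∀ x ∈ A.gr 0, h' x = 0 := fun x hx => byDegree_of_mem _ hx
  have h1 : ∀ n, ∀ x ∈ A.gr (n + 1), h' x = A.component n (h x) :=
    fun n x hx => byDegree_of_mem _ hx
  refine ⟨⟨h', h0, fun n x hx => by rw [h1 n x hx]; exact component_mem _ _, fun x => ?_⟩⟩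
  refine LinearMap.congr_fun (f := A.d ∘ₗ h' + h' ∘ₗ A.d)
    (g := (byDegree fun n => A.component n ∘ₗ p) - LinearMap.id) (linearMap_ext_gr fun n x hx => ?_) x
  simp only [LinearMap.add_apply, LinearMap.sub_apply, LinearMap.comp_apply, LinearMap.id_apply]
  rw [byDegree_of_mem (fun n => A.component n ∘ₗ p) hx, h1 _ _ (A.d_mem _ _ hx),
    LinearMap.comp_apply]
  have key := congrArg (A.component n) (heq x)
  rw [map_add, map_sub, component_of_mem hx] at key
  rw [← key]
  congr 1
  cases n with
  | zero => rw [h0 x hx, map_zero, component_zero_d]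
  | succ n => rw [h1 n x hx, component_succ_d]

namespace Hom

variable (f : Hom M A)

theorem IsQuasiIso.exists_eq_of_map_eq (hf : f.IsQuasiIso) {x : M.carrier} (hx : M.d x = 0)
    {y : A.carrier} (hy : f.toAlgHom x = A.d y) : ∃ z, M.d z = x := by
  have h : f.mapCohomology (Submodule.Quotient.mk ⟨x, hx⟩) = f.mapCohomology 0 := by
    rw [map_zero]
    refine (Submodule.Quotient.mk_eq_zero _).2 ⟨y, hy.symm⟩
  obtain ⟨z, hz⟩ := (Submodule.Quotient.mk_eq_zero _).1 (hf.1 h)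
  exact ⟨z, hz⟩

theorem IsQuasiIso.exists_sub_eq (hf : f.IsQuasiIso) {y : A.carrier} (hy : A.d y = 0) :
    ∃ x z, M.d x = 0 ∧ f.toAlgHom x - y = A.d z := by
  obtain ⟨c, hc⟩ := hf.2 (Submodule.Quotient.mk ⟨y, hy⟩)
  obtain ⟨⟨x, hx⟩, rfl⟩ := Submodule.Quotient.mk_surjective _ c
  obtain ⟨z, hz⟩ := (Submodule.Quotient.eq _).1 hc
  exact ⟨x, z, hx, hz.symm⟩

/-- A quasi-isomorphism over a field has a homotopy inverse, as a map of complexes. -/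
theorem IsQuasiIso.exists_homotopyInverse (hf : f.IsQuasiIso) :
    ∃ g : A.carrier →ₗ[K] M.carrier, (∀ n, ∀ x ∈ A.gr n, g x ∈ M.gr n) ∧
      (∀ x, g (A.d x) = M.d (g x)) ∧
      Nonempty (M.Homotopy (g ∘ₗ f.toAlgHom.toLinearMap)) ∧
      Nonempty (A.Homotopy (f.toAlgHom.toLinearMap ∘ₗ g)) := by
  -- The differential of the mapping cone of `f`, acyclic because `f` is a quasi-isomorphism. The
  -- blocks of a contraction provide the inverse `g` and the two homotopies.
  let D : (M.carrier × A.carrier) →ₗ[K] (M.carrier × A.carrier) :=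
    LinearMap.prod (-(M.d ∘ₗ LinearMap.fst K _ _))
      (f.toAlgHom.toLinearMap ∘ₗ LinearMap.fst K _ _ + A.d ∘ₗ LinearMap.snd K _ _)
  have hD : ∀ x y, D (x, y) = (-M.d x, f.toAlgHom x + A.d y) := fun x y => rfl
  obtain ⟨s, hs⟩ := LinearMap.exists_contraction D (by
    rintro ⟨x, y⟩
    constructor
    · intro h
      rw [hD, Prod.mk_eq_zero, neg_eq_zero] at h
      obtain ⟨z, rfl⟩ := hf.exists_eq_of_map_eq f h.1 (y := -y) (by
        rw [map_neg]; exact eq_neg_of_add_eq_zero_left h.2)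
      obtain ⟨u, v, hu, hv⟩ := hf.exists_sub_eq f (y := f.toAlgHom z + y) (by
        rw [map_add, ← f.map_d]; exact h.2)
      refine ⟨(u - z, -v), ?_⟩
      rw [hD, map_sub, hu, map_sub, map_neg, ← hv]
      ext
      · simp
      · simp
    · rintro ⟨⟨a, b⟩, h⟩
      rw [hD, Prod.mk.injEq] at h
      obtain ⟨rfl, rfl⟩ := h
      rw [hD]
      simp [M.d_d, A.d_d, f.map_d])
  let s₁ : M.carrier × A.carrier →ₗ[K] M.carrier := LinearMap.fst K _ _ ∘ₗ s
  let s₂ : M.carrier × A.carrier →ₗ[K] A.carrier := LinearMap.snd K _ _ ∘ₗ s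
  let g : A.carrier →ₗ[K] M.carrier := s₁ ∘ₗ LinearMap.inr K _ _
  have hsplit : ∀ x y, s₁ (x, y) = s₁ (x, 0) + g y := by
    intro x y
    change _ = s₁ (x, 0) + s₁ (0, y)
    rw [← map_add]; simp
  have h1 : ∀ x y, -M.d (s₁ (x, y)) + s₁ (-M.d x, f.toAlgHom x + A.d y) = x :=
    fun x y => congrArg Prod.fst (hs (x, y))
  have h2 : ∀ x y, f.toAlgHom (s₁ (x, y)) + A.d (s₂ (x, y)) +
      s₂ (-M.d x, f.toAlgHom x + A.d y) = y :=
    fun x y => congrArg Prod.snd (hs (x, y))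
  have hg : ∀ y, g (A.d y) = M.d (g y) := by
    intro y
    have := h1 0 y
    simp only [map_zero, neg_zero, zero_add] at this
    exact (neg_add_eq_zero.1 this).symm
  obtain ⟨H⟩ := exists_homotopy (A := M) (p := g ∘ₗ f.toAlgHom.toLinearMap)
    (h := s₁ ∘ₗ LinearMap.inl K _ _) (fun x => by
      have := h1 x 0
      rw [map_zero, add_zero, hsplit (-M.d x)] at this
      have h3 : s₁ (-M.d x, 0) = -s₁ (M.d x, 0) := by
        rw [← map_neg s₁, Prod.neg_mk, neg_zero]
      rw [h3] at this
      change M.d (s₁ (x, 0)) + s₁ (M.d x, 0) = g (f.toAlgHom x) - x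
      linear_combination (norm := abel) -this)
  obtain ⟨H'⟩ := exists_homotopy (A := A) (p := f.toAlgHom.toLinearMap ∘ₗ g)
    (h := -(s₂ ∘ₗ LinearMap.inr K _ _)) (fun y => by
      have := h2 0 y
      rw [map_zero, map_zero, neg_zero, zero_add] at this
      change A.d (-s₂ (0, y)) + -s₂ (0, A.d y) = f.toAlgHom (s₁ (0, y)) - y
      rw [map_neg]
      linear_combination (norm := abel) -this)
  -- The contraction need not respect degrees, so `g` is replaced by its part of degree zero; `H`
  -- and `H'` have been truncated to match.
  let g' : A.carrier →ₗ[K] M.carrier := byDegree fun n => M.component n ∘ₗ g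
  have hg' : ∀ n, ∀ x ∈ A.gr n, g' x = M.component n (g x) := fun n x hx => byDegree_of_mem _ hx
  refine ⟨g', fun n x hx => by rw [hg' n x hx]; exact component_mem _ _, fun x => ?_, ⟨?_⟩, ⟨?_⟩⟩
  · refine LinearMap.congr_fun (f := g' ∘ₗ A.d) (g := M.d ∘ₗ g')
      (linearMap_ext_gr fun n x hx => ?_) x
    rw [LinearMap.comp_apply, LinearMap.comp_apply, hg' n x hx, hg' _ _ (A.d_mem _ _ hx), hg,
      component_succ_d]
  · have : g' ∘ₗ f.toAlgHom.toLinearMap =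
        byDegree fun n => M.component n ∘ₗ (g ∘ₗ f.toAlgHom.toLinearMap) :=
      linearMap_ext_gr fun n x hx => by
        rw [byDegree_of_mem _ hx, LinearMap.comp_apply, AlgHom.toLinearMap_apply,
          hg' n _ (f.map_gr _ _ hx)]
        rfl
    rw [this]
    exact H
  · have : f.toAlgHom.toLinearMap ∘ₗ g' =
        byDegree fun n => A.component n ∘ₗ (f.toAlgHom.toLinearMap ∘ₗ g) :=
      linearMap_ext_gr fun n x hx => by
        rw [byDegree_of_mem _ hx, LinearMap.comp_apply, AlgHom.toLinearMap_apply, hg' n _ hx]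
        exact (f.component_map _ _).symm
    rw [this]
    exact H'

end Hom

end CochainAlg

/-! ### Tensor powers of homotopies -/

section Stair

variable {K E : Type*} [Field K] [AddCommGroup E] [Module K E]

/-- The family equal to `α` before position `i`, to `β` in position `i` and to `γ` after it. -/
def stair {E : Type*} (n : ℕ) (α β γ : E) (i : ℕ) (j : Fin n) : E :=
  if j.val < i then α else if j.val = i then β else γ

theorem map_stair_comp {n : ℕ} (a b : Fin n → E →ₗ[K] E) :
    PiTensorProduct.map (R := K) a ∘ₗ PiTensorProduct.map b =
      PiTensorProduct.map fun j => a j ∘ₗ b j :=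
  (PiTensorProduct.map_comp _ _).symm

/-- Tensor products of families of maps which commute in all positions but one, where they
anticommute. -/
theorem map_comp_add_map_comp_eq_zero {n : ℕ} (a b : Fin n → E →ₗ[K] E) (i : Fin n)
    (hi : a i ∘ₗ b i = -(b i ∘ₗ a i)) (h : ∀ j ≠ i, a j ∘ₗ b j = b j ∘ₗ a j) :
    PiTensorProduct.map (R := K) a ∘ₗ PiTensorProduct.map b +
      PiTensorProduct.map b ∘ₗ PiTensorProduct.map a = 0 := by
  rw [map_stair_comp, map_stair_comp]
  have h1 : (fun j => a j ∘ₗ b j) =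
      Function.update (fun j => b j ∘ₗ a j) i ((-1 : K) • (b i ∘ₗ a i)) := by
    funext j
    rcases eq_or_ne j i with rfl | hj
    · rw [Function.update_self, hi, neg_one_smul]
    · rw [Function.update_of_ne hj, h j hj]
  rw [h1, PiTensorProduct.map_update_smul, Function.update_eq_self i (fun j => b j ∘ₗ a j)]
  exact (congrArg (· + _) (neg_one_smul K _)).trans (neg_add_cancel _)

variable {τ d h p : E →ₗ[K] E}

/-- The two families commute in every position except the smaller of `i` and `i'`, where an odd map
meets the sign `τ` of the other family and they anticommute. -/
theorem stair_comp_stair_of_ne (hd : d ∘ₗ τ = -(τ ∘ₗ d))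
    (hh : h ∘ₗ τ = -(τ ∘ₗ h)) (hp : τ ∘ₗ p = p ∘ₗ τ) (hdp : d ∘ₗ p = p ∘ₗ d) {n i i' : ℕ}
    (hi : i < n) (hi' : i' < n) (hne : i ≠ i') :
    PiTensorProduct.map (R := K) (stair n τ d LinearMap.id i) ∘ₗ
        PiTensorProduct.map (stair n (τ ∘ₗ p) h LinearMap.id i') +
      PiTensorProduct.map (stair n (τ ∘ₗ p) h LinearMap.id i') ∘ₗ
        PiTensorProduct.map (stair n τ d LinearMap.id i) = 0 := by
  rcases Nat.lt_or_gt_of_ne hne with hlt | hlt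
  · refine map_comp_add_map_comp_eq_zero _ _ ⟨i, hi⟩ ?_ fun j hj => ?_
    · simp only [stair, lt_irrefl, if_false, if_true, hlt]
      rw [← LinearMap.comp_assoc, hd, LinearMap.neg_comp, LinearMap.comp_assoc,
        LinearMap.comp_assoc, hdp]
    · have hj : (j : ℕ) ≠ i := fun h => hj (Fin.ext h)
      simp only [stair, hj, if_false]
      split_ifs <;> first | omega | rfl | rw [LinearMap.comp_assoc, ← hp]
  · refine map_comp_add_map_comp_eq_zero _ _ ⟨i', hi'⟩ ?_ fun j hj => ?_
    · simp only [stair, lt_irrefl, if_false, if_true, hlt]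
      rw [hh, neg_neg]
    · have hj : (j : ℕ) ≠ i' := fun h => hj (Fin.ext h)
      simp only [stair, hj, if_false]
      split_ifs <;> first | omega | rfl | rw [LinearMap.comp_assoc, ← hp]

/-- Before position `i` the two signs cancel and leave `p`; at position `i` the homotopy relation
gives `p - 1`. The result is a difference ready to telescope. -/
theorem stair_comp_stair_self (hτ : τ ∘ₗ τ = LinearMap.id) (hp : τ ∘ₗ p = p ∘ₗ τ)
    (hdh : d ∘ₗ h + h ∘ₗ d = p - LinearMap.id) {n i : ℕ} (hi : i < n) :
    PiTensorProduct.map (R := K) (stair n τ d LinearMap.id i) ∘ₗ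
        PiTensorProduct.map (stair n (τ ∘ₗ p) h LinearMap.id i) +
      PiTensorProduct.map (stair n (τ ∘ₗ p) h LinearMap.id i) ∘ₗ
        PiTensorProduct.map (stair n τ d LinearMap.id i) =
      PiTensorProduct.map (stair n p p LinearMap.id i) -
        PiTensorProduct.map (stair n p LinearMap.id LinearMap.id i) := by
  have hu : ∀ u : E →ₗ[K] E, stair n p u LinearMap.id i =
      Function.update (stair n p LinearMap.id LinearMap.id i) ⟨i, hi⟩ u := by
    intro u
    funext j
    simp only [stair, Function.update_apply, Fin.ext_iff]
    split_ifs <;> first | omega | rfl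
  have hτp : τ ∘ₗ τ ∘ₗ p = p := by rw [← LinearMap.comp_assoc, hτ, LinearMap.id_comp]
  have hτp' : (τ ∘ₗ p) ∘ₗ τ = p := by rw [LinearMap.comp_assoc, ← hp, hτp]
  have h1 : (fun j => stair n τ d LinearMap.id i j ∘ₗ stair n (τ ∘ₗ p) h LinearMap.id i j) =
      stair n p (d ∘ₗ h) LinearMap.id i := by
    funext j
    simp only [stair]
    split_ifs <;> first | rfl | exact hτp
  have h2 : (fun j => stair n (τ ∘ₗ p) h LinearMap.id i j ∘ₗ stair n τ d LinearMap.id i j) =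
      stair n p (h ∘ₗ d) LinearMap.id i := by
    funext j
    simp only [stair]
    split_ifs <;> first | rfl | exact hτp'
  rw [map_stair_comp, map_stair_comp, h1, h2, hu (d ∘ₗ h), hu (h ∘ₗ d),
    ← PiTensorProduct.map_update_add, hdh, eq_sub_iff_add_eq, hu p]
  have h3 := PiTensorProduct.map_update_add (R := K) (stair n p LinearMap.id LinearMap.id i)
    ⟨i, hi⟩ (p - LinearMap.id) LinearMap.id
  rw [sub_add_cancel, ← hu LinearMap.id] at h3
  exact h3.symm

/-- The homotopy between a tensor power of `p` and the identity induced by a homotopy between `p`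
and the identity. -/
theorem sum_stair_homotopy (hτ : τ ∘ₗ τ = LinearMap.id) (hd : d ∘ₗ τ = -(τ ∘ₗ d))
    (hh : h ∘ₗ τ = -(τ ∘ₗ h)) (hp : τ ∘ₗ p = p ∘ₗ τ) (hdp : d ∘ₗ p = p ∘ₗ d)
    (hdh : d ∘ₗ h + h ∘ₗ d = p - LinearMap.id) (n : ℕ) :
    (∑ i ∈ Finset.range n, PiTensorProduct.map (R := K) (stair n τ d LinearMap.id i)) ∘ₗ
        (∑ i ∈ Finset.range n, PiTensorProduct.map (stair n (τ ∘ₗ p) h LinearMap.id i)) +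
      (∑ i ∈ Finset.range n, PiTensorProduct.map (stair n (τ ∘ₗ p) h LinearMap.id i)) ∘ₗ
        (∑ i ∈ Finset.range n, PiTensorProduct.map (stair n τ d LinearMap.id i)) =
      PiTensorProduct.map (fun _ => p) - LinearMap.id := by
  simp only [← Module.End.mul_eq_comp]
  rw [Finset.sum_mul_sum, Finset.sum_mul_sum, Finset.sum_comm (s := Finset.range n)
    (f := fun i j => PiTensorProduct.map (R := K) (stair n (τ * p) h LinearMap.id i) *
        PiTensorProduct.map (stair n τ d LinearMap.id j)), ← Finset.sum_add_distrib]
  -- For fixed `i` all off-diagonal products cancel, and the diagonal one replaces the identity by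
  -- `p` in position `i`. Summation over `i` telescopes.
  have key : ∀ i ∈ Finset.range n,
      (∑ j ∈ Finset.range n, PiTensorProduct.map (R := K) (stair n τ d LinearMap.id i) *
        PiTensorProduct.map (stair n (τ * p) h LinearMap.id j)) +
      (∑ j ∈ Finset.range n, PiTensorProduct.map (stair n (τ * p) h LinearMap.id j) *
        PiTensorProduct.map (stair n τ d LinearMap.id i)) =
      PiTensorProduct.map (stair n p LinearMap.id LinearMap.id (i + 1)) -
        PiTensorProduct.map (stair n p LinearMap.id LinearMap.id i) := by
    intro i hi
    rw [Finset.mem_range] at hi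
    rw [← Finset.sum_add_distrib, Finset.sum_eq_single i]
    · refine (stair_comp_stair_self hτ hp hdh hi).trans ?_
      congr 2
      funext j
      simp only [stair]
      split_ifs <;> first | omega | rfl
    · intro j hj hne
      rw [Finset.mem_range] at hj
      exact stair_comp_stair_of_ne hd hh hp hdp hi hj (Ne.symm hne)
    · intro h
      exact absurd (Finset.mem_range.2 hi) h
  rw [Finset.sum_congr rfl key]
  refine (Finset.sum_range_sub (fun i => PiTensorProduct.map (R := K)
    (stair n p LinearMap.id LinearMap.id i)) n).trans ?_
  have h0 : stair n p LinearMap.id LinearMap.id 0 = fun _ => LinearMap.id := by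
    funext j
    simp [stair]
  have hn : stair n p LinearMap.id LinearMap.id n = fun _ => p := by
    funext j
    simp [stair]
  rw [h0, hn, PiTensorProduct.map_id]

theorem map_comp_sum_stair {E' : Type*} [AddCommGroup E'] [Module K E'] {u : E →ₗ[K] E'}
    {α β γ : E →ₗ[K] E} {α' β' γ' : E' →ₗ[K] E'} (hα : ∀ x, u (α x) = α' (u x))
    (hβ : ∀ x, u (β x) = β' (u x)) (hγ : ∀ x, u (γ x) = γ' (u x)) (n : ℕ)
    (x : PiTensorProduct K fun _ : Fin n => E) :
    PiTensorProduct.map (fun _ => u)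
        ((∑ i ∈ Finset.range n, PiTensorProduct.map (stair n α β γ i)) x) =
      (∑ i ∈ Finset.range n, PiTensorProduct.map (R := K) (stair n α' β' γ' i))
        (PiTensorProduct.map (fun _ => u) x) := by
  rw [LinearMap.sum_apply, LinearMap.sum_apply, map_sum]
  refine Finset.sum_congr rfl fun i _ => ?_
  rw [← LinearMap.comp_apply, ← LinearMap.comp_apply, ← PiTensorProduct.map_comp,
    ← PiTensorProduct.map_comp]
  congr 2
  funext j
  refine LinearMap.ext fun x => ?_
  simp only [LinearMap.comp_apply, stair]
  split_ifs
  · exact hα x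
  · exact hβ x
  · exact hγ x

end Stair

/-! ### The Hochschild complex by word length -/

namespace CochainAlg

variable {K : Type*} [Field K] {A : CochainAlg K} {M : CochainAlg K}

theorem sgn_sum {ι : Type*} (s : Finset ι) (z : ι → ZMod 2) :
    sgn K (∑ j ∈ s, z j) = ∏ j ∈ s, sgn K (z j) := by
  classical
  induction s using Finset.induction_on with
  | empty => simp
  | insert a s ha ih => rw [Finset.sum_insert ha, Finset.prod_insert ha, sgn_add, ih]

theorem prod_sgn {k i : ℕ} (hi : i < k + 1) (e : Fin (k + 1) → ZMod 2) :
    ∏ j : Fin (k + 1), (if j.val < i then sgn K (e j + 1) else 1) = -sgn K (epsBefore e i) := by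
  have hcard : (Finset.univ.filter fun j : Fin (k + 1) => j.val < i).card = i := by
    rw [show (Finset.univ.filter fun j : Fin (k + 1) => j.val < i) = Finset.Iio ⟨i, hi⟩ by
      ext j; simp [Fin.lt_def], Fin.card_Iio]
  rw [← Finset.prod_filter, ← sgn_sum, neg_sgn]
  congr 1
  rw [Finset.sum_add_distrib, Finset.sum_const, hcard, epsBefore, nsmul_one]
  generalize (∑ j : Fin (k + 1) with j.val < i, e j) = a
  generalize (i : ZMod 2) = b
  decide +revert

theorem word_linearMap_ext {E : Type*} [AddCommGroup E] [Module K E] {k : ℕ}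
    {F G : A.Word k →ₗ[K] E}
    (h : ∀ (w : Fin (k + 1) → A.carrier) (n : Fin (k + 1) → ℕ), (∀ j, w j ∈ A.gr (n j)) →
      F (PiTensorProduct.tprod K w) = G (PiTensorProduct.tprod K w)) : F = G := by
  refine PiTensorProduct.ext (MultilinearMap.ext fun w => ?_)
  refine MultilinearMap.map_mem_of_span_eq_top (PiTensorProduct.tprod K) span_gr
    (Y := LinearMap.eqLocus F G) (fun w hw => ?_) w
  choose n hn using hw
  exact h w n hn

/-- The internal differential becomes the usual tensor differential, with the suspension sign on
every letter left of `d`. In this form the stair computations apply to it. -/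
theorem bInner_eq (k : ℕ) : A.bInner k =
    ∑ i ∈ Finset.range (k + 1), PiTensorProduct.map (stair (k + 1) A.susp A.d LinearMap.id i) := by
  refine word_linearMap_ext fun w n hw => ?_
  rw [Finset.sum_range, bInner, LinearMap.neg_apply, LinearMap.sum_apply, LinearMap.sum_apply,
    ← Finset.sum_neg_distrib]
  refine Finset.sum_congr rfl fun i _ => ?_
  rw [LinearMap.comp_apply, signed_tprod A _ w n hw, map_smul, dAt, PiTensorProduct.map_tprod,
    PiTensorProduct.map_tprod, ← neg_smul, ← prod_sgn i.2, ← MultilinearMap.map_smul_univ]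
  congr 1
  funext j
  simp only [stair, Function.update_apply, Fin.ext_iff]
  split_ifs with h1 h2
  · omega
  · rw [susp_of_mem (hw j)]; rfl
  · rw [one_smul]
  · rw [one_smul]

variable (A) in
/-- The words which are trivial in the reduced Hochschild complex. -/
noncomputable def trivialWords (k : ℕ) : Submodule K (A.Word k) :=
  A.trivialChains.comap (DirectSum.lof K ℕ A.Word k)

theorem tprod_mem_trivialWords {k : ℕ} {w : Fin (k + 1) → A.carrier}
    (h : (∃ i, i ≠ 0 ∧ w i = 1) ∨ ∀ i, w i = 1) : PiTensorProduct.tprod K w ∈ A.trivialWords k := by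
  rcases h with h | h
  · exact Submodule.subset_span (Or.inl ⟨k, w, h, rfl⟩)
  · exact word_mem_trivialChains_of_mem_span_one fun j => by
      rw [h]; exact Submodule.mem_span_singleton_self 1

/-- The trivial chains are spanned by words of a single length, so membership can be tested length
by length. -/
theorem component_mem_of_mem_trivialChains {k : ℕ} {S : Submodule K (A.Word k)}
    (h : ∀ w : Fin (k + 1) → A.carrier, ((∃ i, i ≠ 0 ∧ w i = 1) ∨ ∀ i, w i = 1) →
      PiTensorProduct.tprod K w ∈ S) {x : A.Chains} (hx : x ∈ A.trivialChains) :
    DirectSum.component K ℕ A.Word k x ∈ S := by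
  suffices A.trivialChains ≤ S.comap (DirectSum.component K ℕ A.Word k) from this hx
  have key : ∀ (m : ℕ) (w : Fin (m + 1) → A.carrier), ((∃ i, i ≠ 0 ∧ w i = 1) ∨ ∀ i, w i = 1) →
      DirectSum.component K ℕ A.Word k (A.word w) ∈ S := by
    intro m w hw
    by_cases hm : m = k
    · subst hm
      rw [word, DirectSum.component.lof_self]
      exact h w hw
    · rw [word, DirectSum.component.of, dif_neg hm]
      exact S.zero_mem
  refine Submodule.span_le.2 ?_
  rintro _ (⟨m, w, hw, rfl⟩ | rfl)
  · exact key m w (Or.inl hw)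
  · exact key 0 _ (Or.inr fun _ => rfl)

theorem component_mem_trivialWords (k : ℕ) {x : A.Chains} (hx : x ∈ A.trivialChains) :
    DirectSum.component K ℕ A.Word k x ∈ A.trivialWords k :=
  component_mem_of_mem_trivialChains (fun _ => tprod_mem_trivialWords) hx

theorem mem_trivialChains_of_component {x : A.Chains}
    (h : ∀ k, DirectSum.component K ℕ A.Word k x ∈ A.trivialWords k) : x ∈ A.trivialChains := by
  classical
  rw [← DirectSum.sum_support_of x]
  exact Submodule.sum_mem _ fun k _ => h k

/-- Tensor products of linear maps sending `1` to multiples of `1` preserve trivial words. -/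
theorem map_mem_trivialWords {k : ℕ} {u : Fin (k + 1) → M.carrier →ₗ[K] A.carrier}
    (hu : ∀ j, u j 1 ∈ Submodule.span K {(1 : A.carrier)}) {x : M.Word k}
    (hx : x ∈ M.trivialWords k) : PiTensorProduct.map u x ∈ A.trivialWords k := by
  have h := component_mem_of_mem_trivialChains (k := k)
    (S := (A.trivialWords k).comap (PiTensorProduct.map u)) (fun w hw => ?_) hx
  · rwa [DirectSum.component.lof_self] at h
  · rw [Submodule.mem_comap, PiTensorProduct.map_tprod]
    rcases hw with ⟨i, hi, hw⟩ | hw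
    · obtain ⟨c, hc⟩ := Submodule.mem_span_singleton.1 (hu i)
      have h1 : (fun j => u j (w j)) =
          Function.update (Function.update (fun j => u j (w j)) i 1) i (c • 1) := by
        rw [Function.update_idem, hc, ← hw, Function.update_eq_self i (fun j => u j (w j))]
      rw [h1, MultilinearMap.map_update_smul, Function.update_idem]
      exact Submodule.smul_mem _ _ (tprod_mem_trivialWords (Or.inl ⟨i, hi, by simp⟩))
    · exact word_mem_trivialChains_of_mem_span_one fun j => by rw [hw]; exact hu j

theorem sum_stair_mem_trivialWords {k : ℕ} {α β : A.carrier →ₗ[K] A.carrier}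
    (hα : α 1 ∈ Submodule.span K {(1 : A.carrier)}) (hβ : β 1 ∈ Submodule.span K {(1 : A.carrier)})
    {x : A.Word k} (hx : x ∈ A.trivialWords k) :
    (∑ i ∈ Finset.range (k + 1), PiTensorProduct.map (R := K)
      (stair (k + 1) α β LinearMap.id i)) x ∈ A.trivialWords k := by
  rw [LinearMap.sum_apply]
  refine Submodule.sum_mem _ fun i _ => map_mem_trivialWords (fun j => ?_) hx
  simp only [stair]
  split_ifs
  · exact hα
  · exact hβ
  · exact Submodule.mem_span_singleton_self _

theorem d_one : A.d 1 = 0 := A.differential.map_one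

theorem Hom.mapWord_bInner (f : Hom M A) (k : ℕ) (x : M.Word k) :
    f.mapWord k (M.bInner k x) = A.bInner k (f.mapWord k x) := by
  have hs : A.susp ∘ₗ f.toAlgHom.toLinearMap = f.toAlgHom.toLinearMap ∘ₗ M.susp :=
    susp_comp_of_map_gr f.map_gr
  have hd : ∀ x, f.toAlgHom.toLinearMap (M.d x) = A.d (f.toAlgHom.toLinearMap x) := f.map_d
  rw [bInner_eq, bInner_eq, mapWord]
  exact map_comp_sum_stair (fun x => (LinearMap.congr_fun hs x).symm) hd (fun _ => rfl) _ x

theorem Hom.mapWord_mem_trivialWords (f : Hom M A) {k : ℕ} {x : M.Word k}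
    (hx : x ∈ M.trivialWords k) : f.mapWord k x ∈ A.trivialWords k :=
  map_mem_trivialWords (fun _ => by
    rw [AlgHom.toLinearMap_apply, map_one]; exact Submodule.mem_span_singleton_self _) hx

/-- The unit is a cycle of degree zero, so both homotopy terms vanish on it. This makes the tensor
powers of `p` descend to reduced words. -/
theorem Homotopy.map_one {p : A.carrier →ₗ[K] A.carrier} (H : A.Homotopy p) : p 1 = 1 := by
  have h := H.eq 1
  rw [H.zero 1 SetLike.GradedOne.one_mem, d_one, map_zero, map_zero, add_zero] at h
  exact (sub_eq_zero.1 h.symm)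

/-- The homotopy induced on words. -/
theorem Homotopy.exists_word {p : A.carrier →ₗ[K] A.carrier} (H : A.Homotopy p)
    (hp : ∀ n, ∀ x ∈ A.gr n, p x ∈ A.gr n) (hd : ∀ x, p (A.d x) = A.d (p x)) (k : ℕ) :
    ∃ h : A.Word k →ₗ[K] A.Word k, (∀ x ∈ A.trivialWords k, h x ∈ A.trivialWords k) ∧
      ∀ x, A.bInner k (h x) + h (A.bInner k x) = PiTensorProduct.map (fun _ => p) x - x := by
  have key := sum_stair_homotopy susp_comp_susp d_comp_susp (comp_susp_of_lower H.zero H.lower)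
    (susp_comp_of_map_gr hp) (LinearMap.ext fun x => (hd x).symm) (LinearMap.ext H.eq) (k + 1)
  refine ⟨∑ i ∈ Finset.range (k + 1), PiTensorProduct.map
    (stair (k + 1) (A.susp ∘ₗ p) H.h LinearMap.id i), fun x hx => ?_, fun x => ?_⟩
  · refine sum_stair_mem_trivialWords ?_ ?_ hx
    · rw [LinearMap.comp_apply, H.map_one, susp_one]
      exact Submodule.neg_mem _ (Submodule.mem_span_singleton_self _)
    · rw [H.zero 1 SetLike.GradedOne.one_mem]; exact Submodule.zero_mem _
  · rw [bInner_eq]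
    exact LinearMap.congr_fun key x

/-- Acyclicity of the cone of the map induced by a quasi-isomorphism on reduced words. -/
theorem Hom.IsQuasiIso.exists_word {f : Hom M A} (hf : f.IsQuasiIso) {k : ℕ} {x : M.Word k}
    {y : A.Word k} (hx : M.bInner k x ∈ M.trivialWords k)
    (hxy : f.mapWord k x - A.bInner k y ∈ A.trivialWords k) :
    ∃ x' y', x - M.bInner k x' ∈ M.trivialWords k ∧
      y - f.mapWord k x' - A.bInner k y' ∈ A.trivialWords k := by
  obtain ⟨g, hg, hgd, ⟨H₁⟩, ⟨H₂⟩⟩ := hf.exists_homotopyInverse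
  obtain ⟨h₁, hT₁, hh₁⟩ := H₁.exists_word (fun n x hx => hg n _ (f.map_gr n x hx))
    (fun x => by simp [f.map_d, hgd]) k
  obtain ⟨h₂, hT₂, hh₂⟩ := H₂.exists_word (fun n x hx => f.map_gr n _ (hg n x hx))
    (fun x => by simp [f.map_d, hgd]) k
  have hg1 : g 1 = 1 := by simpa using H₁.map_one
  let G : A.Word k →ₗ[K] M.Word k := PiTensorProduct.map fun _ => g
  have hGd : ∀ y, G (A.bInner k y) = M.bInner k (G y) := by
    intro y
    rw [bInner_eq, bInner_eq]
    exact map_comp_sum_stair (fun x => (LinearMap.congr_fun (susp_comp_of_map_gr hg) x).symm)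
      hgd (fun _ => rfl) _ y
  have hGT : ∀ y ∈ A.trivialWords k, G y ∈ M.trivialWords k := fun y hy =>
    map_mem_trivialWords (fun _ => by rw [hg1]; exact Submodule.mem_span_singleton_self _) hy
  have hGF : ∀ x, G (f.mapWord k x) = M.bInner k (h₁ x) + h₁ (M.bInner k x) + x := by
    intro x
    rw [hh₁, sub_add_cancel, PiTensorProduct.map_comp]; rfl
  have hFG : ∀ y, f.mapWord k (G y) = A.bInner k (h₂ y) + h₂ (A.bInner k y) + y := by
    intro y
    rw [hh₂, sub_add_cancel, PiTensorProduct.map_comp]; rfl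
  -- A first candidate for `x'`, obtained by applying the homotopy inverse to `f x = b y`. It bounds
  -- `x` but leaves an error `z`, a cycle modulo trivial words, which `G z` and `h₂` correct.
  set u := G y - h₁ x with hu
  set z := y - f.mapWord k u with hz
  have hux : x - M.bInner k u ∈ M.trivialWords k := by
    have h1 := Submodule.add_mem _ (hGT _ hxy) (Submodule.neg_mem _ (hT₁ _ hx))
    rw [map_sub, hGF, hGd] at h1
    rw [hu, map_sub]
    convert h1 using 1
    abel
  have hzT : A.bInner k z ∈ A.trivialWords k := by
    have h1 := Submodule.add_mem _ (Submodule.neg_mem _ hxy) (f.mapWord_mem_trivialWords hux)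
    rw [map_sub, f.mapWord_bInner] at h1
    rw [hz, map_sub]
    convert h1 using 1
    abel
  refine ⟨u + G z, -h₂ z, ?_, ?_⟩
  · have h1 := Submodule.sub_mem _ hux (hGT _ hzT)
    rw [hGd] at h1
    rw [map_add]
    convert h1 using 1
    abel
  · have h1 := Submodule.neg_mem _ (hT₂ _ hzT)
    have h2 := hFG z
    rw [map_add, ← sub_sub, ← hz, h2, map_neg]
    convert h1 using 1
    abel

theorem component_hochschildB (n : ℕ) (x : A.Chains) :
    DirectSum.component K ℕ A.Word n (A.hochschildB x) =
      A.bInner n (DirectSum.component K ℕ A.Word n x) +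
        A.bOuter n (DirectSum.component K ℕ A.Word (n + 1) x) := by
  refine LinearMap.congr_fun (f := DirectSum.component K ℕ A.Word n ∘ₗ A.hochschildB)
    (g := A.bInner n ∘ₗ DirectSum.component K ℕ A.Word n +
      A.bOuter n ∘ₗ DirectSum.component K ℕ A.Word (n + 1))
    (DirectSum.linearMap_ext K fun k => LinearMap.ext fun w => ?_) x
  simp only [LinearMap.comp_apply, LinearMap.add_apply, hochschildB, DirectSum.toModule_lof]
  have hne : ∀ {i j : ℕ} (w : A.Word i), i ≠ j →
      DirectSum.component K ℕ A.Word j (DirectSum.lof K ℕ A.Word i w) = 0 := fun w h => by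
    rw [DirectSum.component.of, dif_neg h]
  have hself : ∀ {i : ℕ} (w : A.Word i),
      DirectSum.component K ℕ A.Word i (DirectSum.lof K ℕ A.Word i w) = w :=
    fun w => DirectSum.component.lof_self _ _ _
  cases k with
  | zero =>
    rw [LinearMap.comp_apply, hne (j := n + 1) w (by omega), map_zero, add_zero]
    by_cases h : 0 = n
    · subst h
      rw [hself, hself]
    · rw [hne _ h, hne _ h, map_zero]
  | succ k =>
    rw [LinearMap.add_apply, LinearMap.comp_apply, LinearMap.comp_apply, map_add]
    congr 1
    · by_cases h : k + 1 = n
      · subst h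
        rw [hself, hself]
      · rw [hne _ h, hne _ h, map_zero]
    · by_cases h : k = n
      · subst h
        rw [hself, hself]
      · rw [hne _ h, hne _ (by omega), map_zero]

theorem Hom.component_mapChains (f : Hom M A) (n : ℕ) (x : M.Chains) :
    DirectSum.component K ℕ A.Word n (f.mapChains x) =
      f.mapWord n (DirectSum.component K ℕ M.Word n x) := by
  refine LinearMap.congr_fun (f := DirectSum.component K ℕ A.Word n ∘ₗ f.mapChains)
    (g := f.mapWord n ∘ₗ DirectSum.component K ℕ M.Word n)
    (DirectSum.linearMap_ext K fun k => LinearMap.ext fun w => ?_) x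
  simp only [LinearMap.comp_apply, mapChains_lof]
  by_cases h : k = n
  · subst h
    rw [DirectSum.component.lof_self, DirectSum.component.lof_self]
  · rw [DirectSum.component.of, dif_neg h, DirectSum.component.of, dif_neg h, map_zero]

/-- Read off from the stability of trivial chains under `b`: on a single word length, the next lower
component of `b` is its product part. -/
theorem component_bOuter_mem {n : ℕ} {w : A.Word (n + 1)} (hw : w ∈ A.trivialWords (n + 1)) :
    A.bOuter n w ∈ A.trivialWords n := by
  have h := component_mem_trivialWords n (hochschildB_mem_trivialChains hw)
  rw [component_hochschildB, DirectSum.component.lof_self, DirectSum.component.of,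
    dif_neg (by omega), map_zero, zero_add] at h
  exact h

theorem component_hochschildB_lof_of_lt {n k : ℕ} (h : n < k) (w : A.Word n) :
    DirectSum.component K ℕ A.Word k
      (A.hochschildB (DirectSum.lof K ℕ A.Word n w)) = 0 := by
  rw [component_hochschildB, DirectSum.component.of, dif_neg (by omega), DirectSum.component.of,
    dif_neg (by omega), map_zero, map_zero, add_zero]

theorem component_hochschildB_lof {n : ℕ} (w : A.Word n) :
    DirectSum.component K ℕ A.Word n
      (A.hochschildB (DirectSum.lof K ℕ A.Word n w)) = A.bInner n w := by
  rw [component_hochschildB, DirectSum.component.of _ (n + 1) n, dif_neg (by omega),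
    DirectSum.component.lof_self, map_zero, add_zero]

theorem exists_forall_component_eq_zero (x : A.Chains) :
    ∃ n, ∀ k ≥ n, DirectSum.component K ℕ A.Word k x = 0 := by
  classical
  refine ⟨(DFinsupp.support x).sup id + 1, fun k hk => ?_⟩
  by_contra h
  have := Finset.le_sup (f := id) (DFinsupp.mem_support_iff.2 h)
  simp only [id] at this
  omega

/-- Acyclicity of the cone of the map induced by a quasi-isomorphism on reduced Hochschild
chains. -/
theorem Hom.IsQuasiIso.exists_chains [CharZero K] {f : Hom M A} (hf : f.IsQuasiIso) (x : M.Chains)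
    (y : A.Chains) (hx : M.hochschildB x ∈ M.trivialChains)
    (hxy : f.mapChains x - A.hochschildB y ∈ A.trivialChains) :
    ∃ x' y', x - M.hochschildB x' ∈ M.trivialChains ∧
      y - f.mapChains x' - A.hochschildB y' ∈ A.trivialChains := by
  -- Comparison along the filtration by word length: the induction is on a bound beyond which all
  -- components of `x` and `y` are trivial.
  suffices H : ∀ (n : ℕ) (x : M.Chains) (y : A.Chains),
      (∀ k ≥ n, DirectSum.component K ℕ M.Word k x ∈ M.trivialWords k) →
      (∀ k ≥ n, DirectSum.component K ℕ A.Word k y ∈ A.trivialWords k) →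
      M.hochschildB x ∈ M.trivialChains → f.mapChains x - A.hochschildB y ∈ A.trivialChains →
      ∃ x' y', x - M.hochschildB x' ∈ M.trivialChains ∧
        y - f.mapChains x' - A.hochschildB y' ∈ A.trivialChains by
    obtain ⟨n₁, h₁⟩ := exists_forall_component_eq_zero x
    obtain ⟨n₂, h₂⟩ := exists_forall_component_eq_zero y
    refine H (max n₁ n₂) x y (fun k hk => ?_) (fun k hk => ?_) hx hxy
    · rw [h₁ k (le_of_max_le_left hk)]; exact Submodule.zero_mem _
    · rw [h₂ k (le_of_max_le_right hk)]; exact Submodule.zero_mem _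
  intro n
  induction n with
  | zero =>
    intro x y hx hy _ _
    refine ⟨0, 0, ?_, ?_⟩
    · rw [map_zero, sub_zero]
      exact mem_trivialChains_of_component fun k => hx k (Nat.zero_le k)
    · rw [map_zero, map_zero, sub_zero, sub_zero]
      exact mem_trivialChains_of_component fun k => hy k (Nat.zero_le k)
  | succ n ih =>
    intro x y hx hy hbx hxy
    -- The component of length index `n + 1` is trivial, so its product part does not contribute.
    -- The top components therefore satisfy the hypotheses for the internal differential alone, and
    -- `exists_word` removes them at the cost of changing lower components.
    have h1 := component_mem_trivialWords n hbx
    rw [component_hochschildB] at h1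
    have h1 := (Submodule.add_mem_iff_left _ (component_bOuter_mem (hx (n + 1) le_rfl))).1 h1
    have h2 := component_mem_trivialWords n hxy
    rw [map_sub, component_hochschildB, f.component_mapChains, ← sub_sub] at h2
    have h2 := (Submodule.sub_mem_iff_left _ (component_bOuter_mem (hy (n + 1) le_rfl))).1 h2
    obtain ⟨u, v, hu, hv⟩ := hf.exists_word h1 h2
    set u' := DirectSum.lof K ℕ M.Word n u with hu'
    set v' := DirectSum.lof K ℕ A.Word n v with hv'
    have hx₁ : ∀ k ≥ n, DirectSum.component K ℕ M.Word k (x - M.hochschildB u') ∈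
        M.trivialWords k := by
      intro k hk
      rw [map_sub]
      rcases hk.eq_or_lt with rfl | hk
      · rwa [component_hochschildB_lof]
      · rw [component_hochschildB_lof_of_lt hk, sub_zero]
        exact hx k hk
    have hy₁ : ∀ k ≥ n, DirectSum.component K ℕ A.Word k
        (y - f.mapChains u' - A.hochschildB v') ∈ A.trivialWords k := by
      intro k hk
      rw [map_sub, map_sub, f.component_mapChains]
      rcases hk.eq_or_lt with rfl | hk
      · rwa [component_hochschildB_lof, DirectSum.component.lof_self]
      · rw [component_hochschildB_lof_of_lt hk, sub_zero, DirectSum.component.of,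
          dif_neg (by omega), map_zero, sub_zero]
        exact hy k hk
    obtain ⟨x', y', hx', hy'⟩ := ih (x - M.hochschildB u')
      (y - f.mapChains u' - A.hochschildB v') hx₁ hy₁
      (by rwa [map_sub, hochschildB_hochschildB, sub_zero]) (by
        convert hxy using 1
        rw [map_sub, map_sub, map_sub, hochschildB_hochschildB, f.mapChains_hochschildB]
        abel)
    refine ⟨u' + x', v' + y', ?_, ?_⟩
    · rwa [map_add, ← sub_sub]
    · rw [map_add, map_add]
      convert hy' using 1
      abel

end CochainAlg

/-! ### Invariance of exactness under quasi-isomorphisms -/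

namespace CochainAlg

variable {K : Type*} [Field K] {A : CochainAlg K} {M : CochainAlg K}

theorem connesB_mem_redBoundaries {x : A.Chains} (hx : x ∈ A.redBoundaries) :
    A.connesB x ∈ A.redBoundaries := by
  obtain ⟨z, hz⟩ := mem_redBoundaries.1 hx
  refine mem_redBoundaries.2 ⟨-A.connesB z, ?_⟩
  rw [map_neg, hochschildB_connesB, neg_neg, ← map_sub]
  exact connesB_mem_trivialChains (trivialChains_le_unitChains hz)

theorem Hom.mapChains_mem_redCycles (f : Hom M A) {x : M.Chains} (hx : x ∈ M.redCycles) :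
    f.mapChains x ∈ A.redCycles := by
  rw [mem_redCycles, ← f.mapChains_hochschildB]
  exact f.mapChains_mem_trivialChains hx

theorem Hom.mapChains_mem_redBoundaries (f : Hom M A) {x : M.Chains} (hx : x ∈ M.redBoundaries) :
    f.mapChains x ∈ A.redBoundaries := by
  obtain ⟨z, hz⟩ := mem_redBoundaries.1 hx
  refine mem_redBoundaries.2 ⟨f.mapChains z, ?_⟩
  rw [← f.mapChains_hochschildB, ← map_sub]
  exact f.mapChains_mem_trivialChains hz

/-- A quasi-isomorphism is injective on reduced Hochschild homology. -/
theorem Hom.IsQuasiIso.mem_redBoundaries [CharZero K] {f : Hom M A} (hf : f.IsQuasiIso)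
    {x : M.Chains} (hx : x ∈ M.redCycles) (hfx : f.mapChains x ∈ A.redBoundaries) :
    x ∈ M.redBoundaries := by
  obtain ⟨y, hy⟩ := CochainAlg.mem_redBoundaries.1 hfx
  obtain ⟨x', -, hx', -⟩ := hf.exists_chains x y hx hy
  exact CochainAlg.mem_redBoundaries.2 ⟨x', hx'⟩

/-- A quasi-isomorphism is surjective on reduced Hochschild homology. -/
theorem Hom.IsQuasiIso.exists_sub_mem_redBoundaries [CharZero K] {f : Hom M A}
    (hf : f.IsQuasiIso) {y : A.Chains} (hy : y ∈ A.redCycles) :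
    ∃ x ∈ M.redCycles, y - f.mapChains x ∈ A.redBoundaries := by
  -- Acyclicity of the cone with first entry `0` gives surjectivity, as its vanishing on a general
  -- first entry gave injectivity.
  obtain ⟨x, y', hx, hy'⟩ := hf.exists_chains 0 y (by rw [map_zero]; exact Submodule.zero_mem _)
    (by rw [map_zero, zero_sub]; exact Submodule.neg_mem _ hy)
  rw [zero_sub] at hx
  exact ⟨x, mem_redCycles.2 ((Submodule.neg_mem_iff _).1 hx),
    CochainAlg.mem_redBoundaries.2 ⟨y', hy'⟩⟩

/-- BV exactness is invariant under quasi-isomorphisms. -/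
theorem Hom.IsQuasiIso.isBVExact [CharZero K] {f : Hom M A} (hf : f.IsQuasiIso)
    (hM : M.IsBVExact) : A.IsBVExact := by
  rw [isBVExact_iff] at hM ⊢
  intro y hy hBy
  obtain ⟨x, hx, hyx⟩ := hf.exists_sub_mem_redBoundaries hy
  -- Injectivity on homology pulls the condition on `B y` back to `M`, where exactness is known.
  have hBx : M.connesB x ∈ M.redBoundaries := by
    refine hf.mem_redBoundaries (connesB_mem_redCycles hx) ?_
    have h := Submodule.sub_mem _ hBy (connesB_mem_redBoundaries hyx)
    rwa [map_sub, sub_sub_cancel, ← f.mapChains_connesB] at h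
  obtain ⟨u, hu, hxu⟩ := hM x hx hBx
  refine ⟨f.mapChains u, f.mapChains_mem_redCycles hu, ?_⟩
  have h := Submodule.add_mem _ hyx (f.mapChains_mem_redBoundaries hxu)
  rwa [map_sub, sub_add_sub_cancel, f.mapChains_connesB] at h

end CochainAlg

/-! ### Conclusion for spaces. -/

theorem mainTheorem4 (K : Type v) [Field K] [CharZero K] (X : Type u) [TopologicalSpace X]
    [SimplyConnectedSpace X] (hX : AdmitsPositiveWeights.{u, v, w} K X) :
    IsBVExactSpace K X := by
  obtain ⟨M, V, φ, W, ⟨hS, hq⟩, hW⟩ := hX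
  exact hq.isBVExact (hW.isBVExact hS)
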